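/- Let $\beta\in(0,1)$ and let $u_0$ be a vector field on $\mathbb{R}^2$ that is locally Hölder continuous with exponent $\beta$ on $\mathbb{R}^2\setminus\{0\}$, homogeneous of degree $-1$ (that is, $u_0(rx)=r^{-1}u_0(x)$ for $r>0$, $x\neq 0$), and divergence-free in the sense of distributions on $\mathbb{R}^2$. Put $a=e^{\Delta}u_0$, that is, $a(y)=\int_{\mathbb{R}^2}\frac1{4\pi}e^{-|y-x|^2/4}u_0(x)\,dx$, and $\mathcal L W=\Delta W+\frac12\,(W+y\cdot\nabla W)$. Write $\langle y\rangle=\sqrt{1+|y|^2}$ and, for $\alpha\in(0,1)$, $$X_\alpha=\{V\in L^\infty(\mathbb{R}^2;\mathbb{R}^2):\ \langle y\rangle^{1+\alpha}V\in L^\infty,\ \operatorname{div}V=0\},\qquad \|V\|_{X_\alpha}=\|\langle y\rangle^{1+\alpha}V\|_{L^\infty},$$ the divergence being taken in the sense of distributions. For $V\in X_\alpha$ and $U=a+V$, let $U\cdot\nabla U$ be the distribution with components $\sum_j\partial_j(U_jU_i)$, and let $\mathbb P[U\cdot\nabla U]=U\cdot\nabla U-\nabla q$, where $q=\Delta^{-1}\operatorname{div}(U\cdot\nabla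 U)$ is the solution in $L^2(\mathbb{R}^2)$ of $\Delta q=\operatorname{div}(U\cdot\nabla U)$. Then for every $\alpha\in(0,1)$ the nonlinear operator $\mathcal K V=\mathcal L^{-1}\,\mathbb P[(a+V)\cdot\nabla(a+V)]$ is well-defined as a map $X_\alpha\to X_\alpha$: for every $V\in X_\alpha$ there is exactly one $W=\mathcal KV\in X_\alpha$ that solves $\mathcal L W=\mathbb P[(a+V)\cdot\nabla(a+V)]$ in the sense of distributions on $\mathbb{R}^2$. Moreover $\mathcal K:X_\alpha\to X_\alpha$ is continuous, and it is compact: it maps bounded sets to relatively compact sets. -/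

import Mathlib

open MeasureTheory TopologicalSpace
open scoped ENNReal NNReal Distributions LineDeriv

noncomputable section

namespace SelfSimilarNS

/-- The plane `ℝ²` with its Euclidean structure. -/
abbrev Plane : Type := EuclideanSpace ℝ (Fin 2)

/-- Real distributions on the whole plane. -/
abbrev Distr : Type := 𝓓'((⊤ : Opens Plane), ℝ)

/-- Vector-valued distributions on the plane, given by their components. -/
abbrev VecDistr : Type := Fin 2 → Distr

/-- The standard basis vector `eᵢ`. -/
abbrev stdVec (i : Fin 2) : Plane := EuclideanSpace.single i (1 : ℝ)

/-! ### Distributions and their calculus -/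

/-- The regular distribution `φ ↦ ∫ φ f` of a locally integrable function `f`. -/
def ofFun (f : Plane → ℝ) : Distr :=
  (TestFunction.integralAgainstBilinCLM (ContinuousLinearMap.mul ℝ ℝ) volume f :
    𝓓((⊤ : Opens Plane), ℝ) →L[ℝ] ℝ)

/-- The regular vector-valued distribution of a locally integrable vector field. -/
def ofField (f : Plane → Plane) : VecDistr := fun i => ofFun fun y => f y i

theorem ofFun_apply {f : Plane → ℝ} (hf : LocallyIntegrable f volume)
    (φ : 𝓓((⊤ : Opens Plane), ℝ)) : ofFun f φ = ∫ x, φ x * f x := by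
  have h : LocallyIntegrableOn f ((⊤ : Opens Plane) : Set Plane) volume := by
    simpa [locallyIntegrableOn_univ] using hf
  exact TestFunction.integralAgainstBilinCLM_eq_integral h

theorem contDiff_coord (i : Fin 2) : ContDiff ℝ ((⊤ : ℕ∞) : WithTop ℕ∞) fun y : Plane => y i :=
  (EuclideanSpace.proj (𝕜 := ℝ) i : Plane →L[ℝ] ℝ).contDiff

/-- Multiplication `φ ↦ yᵢ φ` of test functions by the `i`-th coordinate. -/
def coordMulTest (i : Fin 2) : 𝓓((⊤ : Opens Plane), ℝ) →L[ℝ] 𝓓((⊤ : Opens Plane), ℝ) :=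
  TestFunction.limitCLM ℝ
    (fun φ => ⟨fun y => φ y * y i, φ.contDiff.mul (contDiff_coord i),
      φ.hasCompactSupport.mul_right, fun _ _ => trivial⟩)
    (fun _ h => TestFunction.ofSupportedInCLM ℝ h ∘L
      ContDiffMapSupportedIn.bilinLeftCLM (ContinuousLinearMap.mul ℝ ℝ) (contDiff_coord i))
    (fun _ _ _ => rfl)

theorem coordMulTest_apply (i : Fin 2) (φ : 𝓓((⊤ : Opens Plane), ℝ)) (y : Plane) :
    coordMulTest i φ y = φ y * y i := rfl

/-- The product `yᵢ T` of a distribution with the `i`-th coordinate function. -/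
def coordMul (i : Fin 2) (T : Distr) : Distr :=
  (coordMulTest i).precompCompactConvergenceCLM ℝ T

theorem coordMul_apply (i : Fin 2) (T : Distr) (φ : 𝓓((⊤ : Opens Plane), ℝ)) :
    coordMul i T φ = T (coordMulTest i φ) := rfl

/-- The divergence `∂₁F₁ + ∂₂F₂`. -/
def div (F : VecDistr) : Distr := ∑ i, ∂_{stdVec i} (F i)

/-- The Laplacian `∂₁²T + ∂₂²T`. -/
def lap (T : Distr) : Distr := ∑ j, ∂_{stdVec j} (∂_{stdVec j} T)

/-- The operator `ℒ T = ΔT + ½ (T + y · ∇T)`, acting componentwise. -/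
def lerayOp (T : VecDistr) : VecDistr := fun i =>
  lap (T i) + (1 / 2 : ℝ) • (T i + ∑ j, coordMul j (∂_{stdVec j} (T i)))

/-- The convection term `U · ∇U` of a divergence-free field `U`, in the divergence form
`(U · ∇U)ᵢ = ∑ⱼ ∂ⱼ (Uⱼ Uᵢ)`. -/
def convection (U : Plane → Plane) : VecDistr := fun i =>
  ∑ j, ∂_{stdVec j} (ofFun fun y => U y j * U y i)

/-- `G = ℙ F` with `ℙ = Id - ∇ Δ⁻¹ div`, where `q = Δ⁻¹ (div F)` is the solution in `L²(ℝ²)` of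
`Δq = div F`; there is at most one, as an `L²` function that is harmonic vanishes. -/
def IsLerayProjection (F G : VecDistr) : Prop :=
  ∃ q : Plane → ℝ, MemLp q 2 volume ∧ lap (ofFun q) = div F ∧
    ∀ i, G i = F i - ∂_{stdVec i} (ofFun q)

/-! ### The space `X_α` -/

/-- `⟨y⟩ = √(1 + |y|²)`. -/
def bracket (y : Plane) : ℝ := Real.sqrt (1 + ‖y‖ ^ 2)

theorem bracket_pos (y : Plane) : 0 < bracket y := Real.sqrt_pos.2 (by positivity)

theorem locallyIntegrable_coord (V : Lp Plane ∞ (volume : Measure Plane)) (i : Fin 2) :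
    LocallyIntegrable (fun y => V y i) volume :=
  (((EuclideanSpace.proj (𝕜 := ℝ) i : Plane →L[ℝ] ℝ).comp_memLp' (Lp.memLp V)
    ).locallyIntegrable le_top)

theorem ofField_add (V W : Lp Plane ∞ (volume : Measure Plane)) :
    ofField (V + W : Lp Plane ∞ (volume : Measure Plane)) = ofField V + ofField W := by
  funext i
  refine DFunLike.ext _ _ fun φ => ?_
  have hV := locallyIntegrable_coord V i
  have hW := locallyIntegrable_coord W i
  have hint : ∀ {f : Plane → ℝ}, LocallyIntegrable f volume →
      Integrable (fun x => φ x * f x) volume := fun {f} hf =>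
    φ.integrable_bilin (ContinuousLinearMap.mul ℝ ℝ) (by simpa [locallyIntegrableOn_univ] using hf)
  change ofFun _ φ = ofFun _ φ + ofFun _ φ
  rw [ofFun_apply (locallyIntegrable_coord (V + W) i), ofFun_apply hV, ofFun_apply hW,
    ← integral_add (hint hV) (hint hW)]
  refine integral_congr_ae ?_
  filter_upwards [Lp.coeFn_add V W] with x hx
  simp only [hx, Pi.add_apply, PiLp.add_apply, mul_add]

theorem ofField_smul (c : ℝ) (V : Lp Plane ∞ (volume : Measure Plane)) :
    ofField (c • V : Lp Plane ∞ (volume : Measure Plane)) = c • ofField V := by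
  funext i
  refine DFunLike.ext _ _ fun φ => ?_
  change ofFun _ φ = c * ofFun _ φ
  rw [ofFun_apply (locallyIntegrable_coord (c • V) i), ofFun_apply (locallyIntegrable_coord V i),
    ← integral_const_mul]
  refine integral_congr_ae ?_
  filter_upwards [Lp.coeFn_smul c V] with x hx
  simp only [hx, Pi.smul_apply, PiLp.smul_apply, smul_eq_mul]
  ring

theorem div_add (F G : VecDistr) : div (F + G) = div F + div G := by
  simp only [div, Pi.add_apply, LineDeriv.lineDerivOp_add, Finset.sum_add_distrib]

theorem div_smul (c : ℝ) (F : VecDistr) : div (c • F) = c • div F := by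
  simp only [div, Pi.smul_apply, LineDeriv.lineDerivOp_smul, Finset.smul_sum]

/-- The weighted field `⟨y⟩^{1+α} V`. -/
def weighted (α : ℝ) (V : Plane → Plane) : Plane → Plane := fun y => bracket y ^ (1 + α) • V y

theorem weighted_add_ae (α : ℝ) (V W : Lp Plane ∞ (volume : Measure Plane)) :
    weighted α (V + W : Lp Plane ∞ (volume : Measure Plane))
      =ᵐ[volume] weighted α V + weighted α W := by
  filter_upwards [Lp.coeFn_add V W] with y hy
  simp only [weighted, hy, Pi.add_apply, smul_add]

theorem weighted_smul_ae (α c : ℝ) (V : Lp Plane ∞ (volume : Measure Plane)) :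
    weighted α (c • V : Lp Plane ∞ (volume : Measure Plane))
      =ᵐ[volume] c • weighted α V := by
  filter_upwards [Lp.coeFn_smul c V] with y hy
  simp only [weighted, hy, Pi.smul_apply, smul_comm c]

/-- `X_α` as a linear subspace of `L^∞(ℝ²; ℝ²)`: the fields `V` with `⟨y⟩^{1+α} V ∈ L^∞` and
`div V = 0` in the sense of distributions. -/
def XSubmodule (α : ℝ) : Submodule ℝ (Lp Plane ∞ (volume : Measure Plane)) where
  carrier := {V | MemLp (weighted α V) ∞ volume ∧ div (ofField V) = 0}
  add_mem' {V W} hV hW :=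
    ⟨(memLp_congr_ae (weighted_add_ae α V W)).2 (hV.1.add hW.1), by
      rw [ofField_add, div_add, hV.2, hW.2, add_zero]⟩
  smul_mem' c V hV :=
    ⟨(memLp_congr_ae (weighted_smul_ae α c V)).2 (hV.1.const_smul c), by
      rw [ofField_smul, div_smul, hV.2, smul_zero]⟩
  zero_mem' := by
    have h0 : weighted α (0 : Lp Plane ∞ (volume : Measure Plane)) =ᵐ[volume] 0 := by
      filter_upwards [Lp.coeFn_zero Plane ∞ (volume : Measure Plane)] with y hy
      simp only [weighted, hy, Pi.zero_apply, smul_zero]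
    refine ⟨(memLp_congr_ae h0).2 MemLp.zero, ?_⟩
    have h := ofField_smul 0 (0 : Lp Plane ∞ (volume : Measure Plane))
    rw [zero_smul, zero_smul] at h
    rw [h]
    have h2 := div_smul 0 (0 : VecDistr)
    rwa [zero_smul, zero_smul] at h2

/-- The space `X_α`. It is a type of its own, so that it carries the weighted norm below and not
the norm of `L^∞`. -/
def XSpace (α : ℝ) : Type := XSubmodule α

instance (α : ℝ) : AddCommGroup (XSpace α) := inferInstanceAs (AddCommGroup (XSubmodule α))

instance (α : ℝ) : Module ℝ (XSpace α) := inferInstanceAs (Module ℝ (XSubmodule α))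

/-- The vector field underlying an element of `X_α`. -/
def XSpace.field {α : ℝ} (V : XSpace α) : Plane → Plane :=
  (V.1 : Lp Plane ∞ (volume : Measure Plane))

/-- The linear map `V ↦ ⟨y⟩^{1+α} V` from `X_α` to `L^∞`. -/
def XSpace.weightMap (α : ℝ) : XSpace α →ₗ[ℝ] Lp Plane ∞ (volume : Measure Plane) :=
  { toFun := fun V => MemLp.toLp (weighted α V.1) V.2.1
    map_add' := fun V W =>
      (MemLp.toLp_congr (V + W).2.1 (V.2.1.add W.2.1) (weighted_add_ae α V.1 W.1)).trans
        (MemLp.toLp_add V.2.1 W.2.1)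
    map_smul' := fun c V =>
      (MemLp.toLp_congr (c • V).2.1 (V.2.1.const_smul c) (weighted_smul_ae α c V.1)).trans
        (MemLp.toLp_const_smul c V.2.1) :
    XSubmodule α →ₗ[ℝ] Lp Plane ∞ (volume : Measure Plane) }

theorem XSpace.weightMap_injective (α : ℝ) : Function.Injective (XSpace.weightMap α) := by
  intro V W h
  have h1 : weighted α V.field =ᵐ[volume] weighted α W.field :=
    (MemLp.toLp_eq_toLp_iff V.2.1 W.2.1).1 h
  refine Subtype.ext (Lp.ext ?_)
  filter_upwards [h1] with y hy
  exact smul_right_injective Plane (Real.rpow_pos_of_pos (bracket_pos y) (1 + α)).ne' hy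

/-- The norm `‖V‖ = ‖⟨y⟩^{1+α} V‖_{L^∞}` of `X_α`. -/
instance (α : ℝ) : NormedAddCommGroup (XSpace α) :=
  NormedAddCommGroup.induced (XSpace α) (Lp Plane ∞ (volume : Measure Plane))
    (XSpace.weightMap α) (XSpace.weightMap_injective α)

instance (α : ℝ) : NormedSpace ℝ (XSpace α) :=
  NormedSpace.induced ℝ (XSpace α) (Lp Plane ∞ (volume : Measure Plane)) (XSpace.weightMap α)

theorem XSpace.norm_def {α : ℝ} (V : XSpace α) :
    ‖V‖ = (eLpNorm (fun y => bracket y ^ (1 + α) • V.field y) ∞ volume).toReal :=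
  Lp.norm_toLp _ V.2.1

/-! ### Initial data and the operator `𝒦` -/

/-- `u` is locally Hölder continuous of exponent `β` on `ℝ² ∖ {0}`. -/
def HolderOffZero (β : ℝ≥0) (u : Plane → Plane) : Prop :=
  ∀ S : Set Plane, IsCompact S → (0 : Plane) ∉ S → ∃ C : ℝ≥0, HolderOnWith C β u S

/-- `u` is homogeneous of degree `-1` on `ℝ² ∖ {0}`. -/
def IsNegOneHomogeneous (u : Plane → Plane) : Prop :=
  ∀ r : ℝ, 0 < r → ∀ x : Plane, x ≠ 0 → u (r • x) = r⁻¹ • u x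

/-- The heat semigroup `e^{tΔ}` on `ℝ²`, for `t > 0`. -/
def heat (t : ℝ) (u : Plane → Plane) : Plane → Plane := fun y =>
  ∫ x, ((4 * Real.pi * t)⁻¹ * Real.exp (-‖y - x‖ ^ 2 / (4 * t))) • u x

/-- `W = ℒ⁻¹ ℙ[(a + V) · ∇(a + V)]` with `a = e^Δ u₀`: the element `W` of `X_α` solves
`ℒ W = ℙ[(a + V) · ∇(a + V)]` in the sense of distributions on `ℝ²`. -/
def IsLInvProjConvection (u₀ : Plane → Plane) {α : ℝ} (V W : XSpace α) : Prop :=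
  IsLerayProjection (convection fun y => heat 1 u₀ y + V.field y) (lerayOp (ofField W.field))

/-- A nonlinear map between normed spaces maps bounded sets to relatively compact sets. -/
def MapsBoundedToRelCompact {X Y : Type*} [NormedAddCommGroup X] [NormedAddCommGroup Y]
    (K : X → Y) : Prop :=
  ∀ B : Set X, Bornology.IsBounded B → IsCompact (closure (K '' B))

end SelfSimilarNS

end

open SelfSimilarNS

noncomputable section

open Filter Topology
open scoped ContDiff

namespace SelfSimilarNS

/-! ### The Japanese bracket -/

/-! Put F = U ⊗ U. The equation ℒW = ℙ div F says that w(x, t) = t^(-1/2) W(x/√t) solves the forced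
Stokes equation ∂ₜw − Δw = −ℙ div (t⁻¹ F(x/√t)). Duhamel's formula with zero initial data, read at t
= 1, suggests W = −∫₀¹ e^((1-s)Δ) ℙ div (s⁻¹ F(·/√s)) ds, which is `solField`. After substituting x
= √s z it becomes an integral over (0, 1) × ℝ² of (1-s)^(-3/2) K((y − √s z)/√(1-s)) F(z), where the
kernel K is `oseen`, smooth and O(⟨x⟩⁻³).

Bounds. Homogeneity gives |u₀| ≤ C/|x|, so a = O(⟨y⟩⁻¹) (`exists_norm_heat_one_le`) and F =
O(⟨y⟩⁻²). The estimate `exists_parab_integral_le` then yields W = O(⟨y⟩^(-γ)) for every γ in (1, 2],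
linearly in the size of F, and interpolation yields a global Hölder bound of exponent 1/4
(`exists_solField_holder`).

Equation. An L² pressure exists by Riesz representation (`exists_isPressure`). Testing the pressure
equation with the gradient of the Newtonian potential of a Gaussian replaces the nonlocal kernel K
by the gradient of the heat kernel, and F by the stress F − q Id (`IsPressure.oseen_eq`). The
pairing of W with a test function then involves only Gaussian means of that function along s ↦
(√(1-s), √s z). On the adjoint operator these means form an exact s-derivative
(`integral_mollify_lerayAdjGrad`), whence ℒW = div (F − q Id). The field is divergence free because
the double divergence of the stress vanishes.

Uniqueness. If ℒf = 0, the pairing of t^(-1/2) f(x/√t) with a backward heat kernel is constant in t.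
Since f decays faster than 1/|y|, it tends to 0 as t → 0. So f is orthogonal to every Gaussian and
vanishes (`ae_eq_zero_of_lerayAdj`).

Continuity and compactness. F is quadratic in V, so the linear bound makes 𝒦 locally Lipschitz.
Images of bounded sets are equi-Hölder and decay with an exponent strictly larger than 1 + α, so
Arzelà–Ascoli on discs together with uniformly small tails gives compactness in the weighted norm
(`isCompact_closure_of_holderBall`). -/

theorem bracket_sq (y : Plane) : bracket y ^ 2 = 1 + ‖y‖ ^ 2 :=
  Real.sq_sqrt (by positivity)

theorem one_le_bracket (y : Plane) : 1 ≤ bracket y :=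
  Real.one_le_sqrt.2 (by nlinarith [sq_nonneg ‖y‖])

theorem norm_le_bracket (y : Plane) : ‖y‖ ≤ bracket y :=
  Real.le_sqrt_of_sq_le (by linarith)

theorem bracket_le_one_add_norm (y : Plane) : bracket y ≤ 1 + ‖y‖ :=
  sqrt_one_add_norm_sq_le y

theorem continuous_bracket : Continuous bracket := by
  unfold bracket; fun_prop

theorem bracket_rpow (y : Plane) (r : ℝ) : bracket y ^ r = (1 + ‖y‖ ^ 2) ^ (r / 2) := by
  rw [bracket, Real.rpow_div_two_eq_sqrt r (by positivity)]

theorem continuous_bracket_rpow (r : ℝ) : Continuous fun y : Plane => bracket y ^ r :=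
  continuous_bracket.rpow_const fun y => Or.inl (bracket_pos y).ne'

theorem integrable_bracket_rpow {r : ℝ} (hr : 2 < r) :
    Integrable fun y : Plane => bracket y ^ (-r) := by
  simp_rw [bracket_rpow]
  exact integrable_rpow_neg_one_add_norm_sq (by simpa using hr)

/-- Peetre's inequality. -/
theorem bracket_add_le (x y : Plane) : bracket (x + y) ≤ 2 * bracket x * bracket y := by
  refine Real.sqrt_le_iff.2 ⟨by have := bracket_pos x; have := bracket_pos y; positivity, ?_⟩
  rw [mul_pow, mul_pow, bracket_sq, bracket_sq]
  have h := norm_add_le x y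
  nlinarith [sq_nonneg (‖x‖ - ‖y‖), norm_nonneg x, norm_nonneg y, norm_nonneg (x + y),
    sq_nonneg (‖x‖ * ‖y‖)]

theorem memLp_two_bracket_rpow {r : ℝ} (hr : 1 < r) :
    MemLp (fun y : Plane => bracket y ^ (-r)) 2 := by
  rw [memLp_two_iff_integrable_sq (continuous_bracket_rpow _).aestronglyMeasurable]
  refine (integrable_bracket_rpow (r := 2 * r) (by linarith)).congr (ae_of_all _ fun y => ?_)
  simp only
  rw [← Real.rpow_natCast, ← Real.rpow_mul (bracket_pos y).le]
  congr 1; push_cast; ring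

theorem bracket_rpow_pos (y : Plane) (r : ℝ) : 0 < bracket y ^ r :=
  Real.rpow_pos_of_pos (bracket_pos y) r

theorem bracket_rpow_le_rpow (y : Plane) {r s : ℝ} (h : r ≤ s) : bracket y ^ r ≤ bracket y ^ s :=
  Real.rpow_le_rpow_of_exponent_le (one_le_bracket y) h

/-! ### Partial derivatives -/

/-- The partial derivative `∂ⱼ f`. -/
def pd (j : Fin 2) (f : Plane → ℝ) : Plane → ℝ := fun x => fderiv ℝ f x (stdVec j)

theorem contDiff_pd {f : Plane → ℝ} (hf : ContDiff ℝ ∞ f) (j : Fin 2) :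
    ContDiff ℝ ∞ (pd j f) :=
  (hf.fderiv_right (m := ∞) (by simp)).clm_apply contDiff_const

theorem differentiable_of_smooth {f : Plane → ℝ} (hf : ContDiff ℝ ∞ f) : Differentiable ℝ f :=
  hf.differentiable (by simp)

theorem hasCompactSupport_pd {f : Plane → ℝ} (hf : HasCompactSupport f) (j : Fin 2) :
    HasCompactSupport (pd j f) :=
  (hf.fderiv ℝ).comp_left (g := fun L : Plane →L[ℝ] ℝ => L (stdVec j)) rfl

theorem pd_add {f g : Plane → ℝ} (hf : Differentiable ℝ f) (hg : Differentiable ℝ g)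
    (j : Fin 2) : pd j (fun x => f x + g x) = fun x => pd j f x + pd j g x := by
  funext x
  simp only [pd]
  rw [fderiv_fun_add (hf x) (hg x)]; rfl

theorem pd_sub {f g : Plane → ℝ} (hf : Differentiable ℝ f) (hg : Differentiable ℝ g)
    (j : Fin 2) : pd j (fun x => f x - g x) = fun x => pd j f x - pd j g x := by
  funext x
  simp only [pd]
  rw [fderiv_fun_sub (hf x) (hg x)]; rfl

theorem pd_mul {f g : Plane → ℝ} (hf : Differentiable ℝ f) (hg : Differentiable ℝ g)
    (j : Fin 2) : pd j (fun x => f x * g x) = fun x => pd j f x * g x + f x * pd j g x := by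
  funext x
  simp only [pd]
  rw [fderiv_fun_mul (hf x) (hg x)]
  simp [mul_comm]; ring

theorem pd_const_mul {f : Plane → ℝ} (hf : Differentiable ℝ f) (c : ℝ)
    (j : Fin 2) : pd j (fun x => c * f x) = fun x => c * pd j f x := by
  funext x
  simp only [pd]
  rw [fderiv_const_mul (hf x)]; rfl

theorem pd_sum {ι : Type*} (s : Finset ι) {f : ι → Plane → ℝ} (hf : ∀ i, Differentiable ℝ (f i))
    (j : Fin 2) : pd j (fun x => ∑ i ∈ s, f i x) = fun x => ∑ i ∈ s, pd j (f i) x := by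
  funext x
  simp only [pd]
  rw [fderiv_fun_sum fun i _ => hf i x]; simp

theorem pd_coord (i j : Fin 2) (x : Plane) : pd j (fun x => x i) x = if i = j then 1 else 0 := by
  simp only [pd]
  have h : fderiv ℝ (fun x : Plane => x i) x = EuclideanSpace.proj (𝕜 := ℝ) i :=
    (EuclideanSpace.proj (𝕜 := ℝ) i : Plane →L[ℝ] ℝ).fderiv
  rw [h]
  simp [stdVec]

theorem differentiable_coord (i : Fin 2) : Differentiable ℝ fun y : Plane => y i :=
  differentiable_of_smooth (contDiff_coord i)

/-- The chain rule for `x ↦ c x + b`. -/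
theorem pd_comp_affine {f : Plane → ℝ} (hf : Differentiable ℝ f) (c : ℝ) (b : Plane)
    (j : Fin 2) : pd j (fun x => f (c • x + b)) = fun x => c * pd j f (c • x + b) := by
  funext x
  simp only [pd]
  have h : HasFDerivAt (fun x : Plane => c • x + b) (c • ContinuousLinearMap.id ℝ Plane) x :=
    ((hasFDerivAt_id x).const_smul c).add_const b
  have h2 := ((hf (c • x + b)).hasFDerivAt.comp x h).fderiv
  simp only [Function.comp_def] at h2
  rw [h2]
  simp

theorem pd_comm {f : Plane → ℝ} (hf : ContDiff ℝ ∞ f) (j k : Fin 2) :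
    pd j (pd k f) = pd k (pd j f) := by
  funext x
  have h2 : Differentiable ℝ (fderiv ℝ f) := (hf.fderiv_right (m := ∞) (by simp)).differentiable
    (by simp)
  have e : ∀ a b : Fin 2, pd a (pd b f) x = fderiv ℝ (fderiv ℝ f) x (stdVec a) (stdVec b) := by
    intro a b
    have := (h2 x).hasFDerivAt.clm_apply (hasFDerivAt_const (stdVec b) x)
    change fderiv ℝ (fun y => fderiv ℝ f y (stdVec b)) x (stdVec a) = _
    rw [this.fderiv]
    simp
  rw [e, e]
  exact second_derivative_symmetric (fun y => (differentiable_of_smooth hf y).hasFDerivAt)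
    (h2 x).hasFDerivAt _ _

theorem fderiv_apply_eq_sum (f : Plane → ℝ) (x v : Plane) :
    fderiv ℝ f x v = ∑ j, v j * pd j f x := by
  have : v = ∑ j, v j • stdVec j := by
    ext i; fin_cases i <;> simp [stdVec, Fin.sum_univ_two]
  conv_lhs => rw [this]
  simp [pd]

/-- Integration by parts against a compactly supported function. -/
theorem integral_mul_pd {u v : Plane → ℝ} (hu : ContDiff ℝ ∞ u) (hv : ContDiff ℝ ∞ v)
    (hc : HasCompactSupport v) (j : Fin 2) :
    ∫ x, u x * pd j v x = -∫ x, pd j u x * v x := by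
  have i1 : ∀ {a b : Plane → ℝ}, Continuous a → Continuous b → HasCompactSupport b →
      Integrable fun x => a x * b x := fun ha hb hcb =>
    (ha.mul hb).integrable_of_hasCompactSupport hcb.mul_left
  exact integral_mul_fderiv_eq_neg_fderiv_mul_of_integrable
    (i1 (contDiff_pd hu j).continuous hv.continuous hc)
    (i1 hu.continuous (contDiff_pd hv j).continuous (hasCompactSupport_pd hc j))
    (i1 hu.continuous hv.continuous hc) (fun x _ => differentiable_of_smooth hu x)
    (fun x _ => differentiable_of_smooth hv x)

/-! ### The Laplacian and the formal adjoint of ℒ on functions -/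

/-- The Laplacian of a function, as a sum of iterated partial derivatives. -/
def lapl (f : Plane → ℝ) : Plane → ℝ := fun x => ∑ j, pd j (pd j f) x

/-- The formal adjoint `φ ↦ Δφ - ½ φ - ½ y · ∇φ` of `ℒ`. -/
def lerayAdj (f : Plane → ℝ) : Plane → ℝ := fun y =>
  lapl f y - (1 / 2) * f y - (1 / 2) * ∑ j, y j * pd j f y

theorem contDiff_lapl {f : Plane → ℝ} (hf : ContDiff ℝ ∞ f) : ContDiff ℝ ∞ (lapl f) :=
  ContDiff.sum fun j _ => contDiff_pd (contDiff_pd hf j) j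

theorem contDiff_lerayAdj {f : Plane → ℝ} (hf : ContDiff ℝ ∞ f) : ContDiff ℝ ∞ (lerayAdj f) :=
  ((contDiff_lapl hf).sub (contDiff_const.mul hf)).sub
    (contDiff_const.mul (ContDiff.sum fun j _ => (contDiff_coord j).mul (contDiff_pd hf j)))

theorem hasCompactSupport_lapl {f : Plane → ℝ} (hf : HasCompactSupport f) :
    HasCompactSupport (lapl f) := by
  have h : lapl f = fun x => pd 0 (pd 0 f) x + pd 1 (pd 1 f) x := by
    funext x; simp [lapl, Fin.sum_univ_two]
  rw [h]
  exact (hasCompactSupport_pd (hasCompactSupport_pd hf 0) 0).add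
    (hasCompactSupport_pd (hasCompactSupport_pd hf 1) 1)

theorem hasCompactSupport_lerayAdj {f : Plane → ℝ} (hf : HasCompactSupport f) :
    HasCompactSupport (lerayAdj f) := by
  have h1 := hasCompactSupport_lapl hf
  have h2 : HasCompactSupport fun y : Plane => (1 / 2 : ℝ) * f y := hf.mul_left
  have h3 : HasCompactSupport fun y : Plane => (1 / 2 : ℝ) * ∑ j, y j * pd j f y := by
    have a : ∀ j, HasCompactSupport fun y : Plane => y j * pd j f y := fun j =>
      (hasCompactSupport_pd hf j).mul_left
    simp only [Fin.sum_univ_two]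
    exact ((a 0).add (a 1)).mul_left
  exact (h1.sub h2).sub h3

/-! ### Distributions tested on smooth functions of compact support -/

/-- Test functions on the plane. -/
abbrev Test : Type := 𝓓((⊤ : Opens Plane), ℝ)

/-- The test function given by a smooth function of compact support. -/
def mkTest (f : Plane → ℝ) (hf : ContDiff ℝ ∞ f) (hc : HasCompactSupport f) : Test :=
  ⟨f, hf, hc, fun _ _ => trivial⟩

theorem smooth_test (φ : Test) : ContDiff ℝ ∞ φ := φ.contDiff

theorem lineDeriv_test (φ : Test) (j : Fin 2) (x : Plane) :
    (∂_{stdVec j} φ : Test) x = pd j φ x := by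
  rw [TestFunction.lineDerivOp_eq_lineDerivCLM ℝ, TestFunction.lineDerivCLM_apply_of_le (by simp),
    (differentiable_of_smooth (smooth_test φ) x).lineDeriv_eq_fderiv]; rfl

theorem coe_lineDeriv_test (φ : Test) (j : Fin 2) : ⇑(∂_{stdVec j} φ : Test) = pd j φ :=
  funext (lineDeriv_test φ j)

theorem lineDeriv_distr (T : Distr) (φ : Test) (j : Fin 2) :
    (∂_{stdVec j} T) φ = -T (∂_{stdVec j} φ) := by
  rw [Distribution.lineDerivOp_apply_apply, map_neg]

theorem distr_sum_apply {ι : Type*} (s : Finset ι) (T : ι → Distr) (φ : Test) :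
    (∑ i ∈ s, T i) φ = ∑ i ∈ s, T i φ := by
  classical
  induction s using Finset.induction_on with
  | empty => simp only [Finset.sum_empty]; rfl
  | insert a s ha ih => rw [Finset.sum_insert ha, Finset.sum_insert ha, ← ih]; rfl

theorem lap_ofFun_apply {f : Plane → ℝ} (hf : LocallyIntegrable f) (φ : Test) :
    lap (ofFun f) φ = ∫ x, f x * lapl φ x := by
  have hi : ∀ χ : Test, Integrable fun x => f x * χ x := fun χ => by
    have := χ.integrable_bilin (ContinuousLinearMap.mul ℝ ℝ) (μ := volume) (φ := f)
      (by simpa [locallyIntegrableOn_univ] using hf)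
    exact this.congr (ae_of_all _ fun x => mul_comm _ _)
  rw [lap, distr_sum_apply]
  simp only [lineDeriv_distr, neg_neg, ofFun_apply hf, coe_lineDeriv_test, lapl, Finset.mul_sum]
  rw [integral_finsetSum]
  · simp only [mul_comm]
  · intro j _
    have := hi (∂_{stdVec j} (∂_{stdVec j} φ))
    simpa only [coe_lineDeriv_test] using this

theorem div_ofField_apply {f : Plane → Plane} (hf : ∀ i, LocallyIntegrable fun y => f y i)
    (φ : Test) : div (ofField f) φ = -∑ i, ∫ x, f x i * pd i φ x := by
  rw [div, distr_sum_apply, ← Finset.sum_neg_distrib]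
  simp only [lineDeriv_distr, ofField, ofFun_apply (hf _), coe_lineDeriv_test, mul_comm]

/-- Transposing y · ∇ gives −y · ∇ − 2 in the plane, so the zeroth-order term ½(1 − 2) = −½ of the
adjoint has the opposite sign to that of ℒ. -/
theorem lerayOp_ofField_apply {f : Plane → Plane} (hf : ∀ i, LocallyIntegrable fun y => f y i)
    (i : Fin 2) (φ : Test) :
    lerayOp (ofField f) i φ = ∫ x, f x i * lerayAdj φ x := by
  have hi : ∀ χ : Plane → ℝ, Continuous χ → HasCompactSupport χ →
      Integrable fun x => f x i * χ x := fun χ hχ hc => by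
    have := (hf i).integrable_smul_left_of_hasCompactSupport hχ hc
    exact this.congr (ae_of_all _ fun x => mul_comm _ _)
  have hs := smooth_test φ
  have hc := φ.hasCompactSupport
  have e : lerayOp (ofField f) i φ = lap (ofFun fun y => f y i) φ + (1 / 2) *
      ((ofFun fun y => f y i) φ + (∑ j, coordMul j (∂_{stdVec j} (ofFun fun y => f y i))) φ) := rfl
  rw [e, lap_ofFun_apply (hf i), distr_sum_apply]
  have e2 : ∀ j, coordMul j (∂_{stdVec j} (ofFun fun y => f y i)) φ =
      -∫ x, f x i * (φ x + x j * pd j φ x) := by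
    intro j
    rw [coordMul_apply, lineDeriv_distr, ofFun_apply (hf i), coe_lineDeriv_test]
    congr 1
    refine integral_congr_ae (ae_of_all _ fun x => ?_)
    have : ⇑(coordMulTest j φ) = fun y => φ y * y j := rfl
    simp only [this]
    rw [pd_mul (differentiable_of_smooth hs) (differentiable_coord j)]
    simp only [pd_coord, if_true]
    ring
  have hcl := hasCompactSupport_lapl hc
  have i0 := hi φ hs.continuous hc
  have i1 := hi _ (contDiff_lapl hs).continuous hcl
  have i2 : ∀ j, Integrable fun x => f x i * (φ x + x j * pd j φ x) := fun j =>
    hi _ (hs.add ((contDiff_coord j).mul (contDiff_pd hs j))).continuous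
      (hc.add (hasCompactSupport_pd hc j).mul_left)
  simp only [e2, Fin.sum_univ_two, ofFun_apply (hf i), mul_comm (φ _)]
  rw [← integral_neg', ← integral_neg', ← integral_add' (i2 0).neg (i2 1).neg,
    ← integral_add' i0 ((i2 0).neg.add (i2 1).neg), ← integral_const_mul,
    ← integral_add i1 ((i0.add ((i2 0).neg.add (i2 1).neg)).const_mul _)]
  refine integral_congr_ae (ae_of_all _ fun x => ?_)
  simp only [Pi.add_apply, Pi.neg_apply, lerayAdj, Fin.sum_univ_two]
  ring

/-! ### Symbol classes -/

/-- `f = O(⟨x⟩^a)`. -/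
def Decays (a : ℝ) (f : Plane → ℝ) : Prop := ∃ C, ∀ x, |f x| ≤ C * bracket x ^ a

namespace Decays

variable {a b : ℝ} {f g : Plane → ℝ}

theorem add (hf : Decays a f) (hg : Decays a g) : Decays a fun x => f x + g x := by
  obtain ⟨C, hC⟩ := hf
  obtain ⟨D, hD⟩ := hg
  refine ⟨C + D, fun x => ?_⟩
  calc |f x + g x| ≤ |f x| + |g x| := abs_add_le _ _
    _ ≤ (C + D) * bracket x ^ a := by linarith [hC x, hD x]

theorem mul (hf : Decays a f) (hg : Decays b g) : Decays (a + b) fun x => f x * g x := by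
  obtain ⟨C, hC⟩ := hf
  obtain ⟨D, hD⟩ := hg
  refine ⟨C * D, fun x => ?_⟩
  rw [abs_mul, Real.rpow_add (bracket_pos x)]
  calc |f x| * |g x| ≤ (C * bracket x ^ a) * (D * bracket x ^ b) :=
        mul_le_mul (hC x) (hD x) (abs_nonneg _) ((abs_nonneg _).trans (hC x))
    _ = _ := by ring

theorem const_mul (hf : Decays a f) (c : ℝ) : Decays a fun x => c * f x := by
  obtain ⟨C, hC⟩ := hf
  refine ⟨|c| * C, fun x => ?_⟩
  rw [abs_mul, mul_assoc]
  exact mul_le_mul_of_nonneg_left (hC x) (abs_nonneg c)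

theorem mono (hf : Decays a f) (h : a ≤ b) : Decays b f := by
  obtain ⟨C, hC⟩ := hf
  have hC0 : 0 ≤ C := by
    have := (abs_nonneg _).trans (hC 0)
    exact nonneg_of_mul_nonneg_left this (bracket_rpow_pos 0 a)
  exact ⟨C, fun x => (hC x).trans (mul_le_mul_of_nonneg_left (bracket_rpow_le_rpow x h) hC0)⟩

theorem exists_pos (hf : Decays a f) : ∃ C, 0 < C ∧ ∀ x, |f x| ≤ C * bracket x ^ a := by
  obtain ⟨C, hC⟩ := hf
  exact ⟨|C| + 1, by positivity, fun x => (hC x).trans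
    (mul_le_mul_of_nonneg_right (by linarith [le_abs_self C]) (bracket_rpow_pos x a).le)⟩

theorem integrable (hf : Decays a f) (hm : Continuous f) (ha : a < -2) : Integrable f := by
  obtain ⟨C, hC⟩ := hf
  refine Integrable.mono' ((integrable_bracket_rpow (r := -a) (by linarith)).const_mul C)
    hm.aestronglyMeasurable (ae_of_all _ fun x => ?_)
  simpa using hC x

theorem memLp_two (hf : Decays a f) (hm : Continuous f) (ha : a < -1) : MemLp f 2 := by
  obtain ⟨C, hC⟩ := hf
  refine MemLp.mono' ((memLp_two_bracket_rpow (r := -a) (by linarith)).const_mul C)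
    hm.aestronglyMeasurable (ae_of_all _ fun x => ?_)
  simpa using hC x

/-- Decay is preserved under nondegenerate dilations and translations. -/
theorem comp_affine (hf : Decays a f) {c : ℝ} (hc : c ≠ 0) (b : Plane) :
    Decays a fun x => f (c • x + b) := by
  obtain ⟨C, hC0, hC⟩ := hf.exists_pos
  have key : ∀ (c : ℝ) (b : Plane), ∃ D, 1 ≤ D ∧ ∀ x, bracket (c • x + b) ≤ D * bracket x := by
    intro c b
    refine ⟨1 + |c| + ‖b‖, by linarith [abs_nonneg c, norm_nonneg b], fun x => ?_⟩
    have h1 := bracket_le_one_add_norm (c • x + b)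
    have h2 := norm_add_le (c • x) b
    rw [norm_smul, Real.norm_eq_abs] at h2
    nlinarith [one_le_bracket x, norm_le_bracket x, abs_nonneg c, norm_nonneg b]
  obtain ⟨D, hD1, hD⟩ := key c b
  obtain ⟨E, hE1, hE⟩ := key c⁻¹ (-(c⁻¹ • b))
  have hE' : ∀ x, bracket x ≤ E * bracket (c • x + b) := fun x => by
    have := hE (c • x + b)
    rwa [smul_add, smul_smul, inv_mul_cancel₀ hc, one_smul, add_neg_cancel_right] at this
  rcases le_total 0 a with ha | ha
  · refine ⟨C * D ^ a, fun x => (hC _).trans ?_⟩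
    rw [mul_assoc, ← Real.mul_rpow (by linarith) (bracket_pos x).le]
    exact mul_le_mul_of_nonneg_left (Real.rpow_le_rpow (bracket_pos _).le (hD x) ha) hC0.le
  · refine ⟨C * (E⁻¹) ^ a, fun x => (hC _).trans ?_⟩
    rw [mul_assoc, ← Real.mul_rpow (inv_nonneg.2 (by linarith)) (bracket_pos x).le]
    refine mul_le_mul_of_nonneg_left (Real.rpow_le_rpow_of_nonpos ?_ ?_ ha) hC0.le
    · have := bracket_pos x; positivity
    · rw [inv_mul_le_iff₀ (by linarith)]; exact hE' x

end Decays

theorem decays_coord (i : Fin 2) : Decays 1 fun x => x i :=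
  ⟨1, fun x => by
    simpa using (PiLp.norm_apply_le x i).trans (norm_le_bracket x)⟩

/-- Symbols of order `a`, with control of `n` derivatives. -/
def IsSymbol : ℕ → ℝ → (Plane → ℝ) → Prop
  | 0, a, f => Decays a f
  | n + 1, a, f => Decays a f ∧ ∀ j, IsSymbol n (a - 1) (pd j f)

namespace IsSymbol

variable {n : ℕ} {a b : ℝ} {f g : Plane → ℝ}

theorem decays (h : IsSymbol n a f) : Decays a f := by
  cases n with
  | zero => exact h
  | succ n => exact h.1

theorem mono (h : IsSymbol n a f) (hab : a ≤ b) : IsSymbol n b f := by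
  induction n generalizing a b f with
  | zero => exact Decays.mono h hab
  | succ n ih => exact ⟨h.1.mono hab, fun j => ih (h.2 j) (by linarith)⟩

theorem pred (h : IsSymbol (n + 1) a f) : IsSymbol n a f := by
  induction n generalizing a f with
  | zero => exact h.1
  | succ n ih => exact ⟨h.1, fun j => ih (h.2 j)⟩

theorem pd (h : IsSymbol (n + 1) a f) (j : Fin 2) : IsSymbol n (a - 1) (pd j f) := h.2 j

theorem add (hf : IsSymbol n a f) (hg : IsSymbol n a g) (sf : ContDiff ℝ ∞ f)
    (sg : ContDiff ℝ ∞ g) : IsSymbol n a fun x => f x + g x := by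
  induction n generalizing a f g with
  | zero => exact Decays.add hf hg
  | succ n ih =>
    refine ⟨hf.1.add hg.1, fun j => ?_⟩
    rw [pd_add (differentiable_of_smooth sf) (differentiable_of_smooth sg)]
    exact ih (hf.2 j) (hg.2 j) (contDiff_pd sf j) (contDiff_pd sg j)

theorem const_mul (hf : IsSymbol n a f) (sf : ContDiff ℝ ∞ f) (c : ℝ) :
    IsSymbol n a fun x => c * f x := by
  induction n generalizing a f with
  | zero => exact Decays.const_mul hf c
  | succ n ih =>
    refine ⟨hf.1.const_mul c, fun j => ?_⟩
    rw [pd_const_mul (differentiable_of_smooth sf)]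
    exact ih (hf.2 j) (contDiff_pd sf j)

theorem mul (hf : IsSymbol n a f) (hg : IsSymbol n b g) (sf : ContDiff ℝ ∞ f)
    (sg : ContDiff ℝ ∞ g) : IsSymbol n (a + b) fun x => f x * g x := by
  induction n generalizing a b f g with
  | zero => exact Decays.mul hf hg
  | succ n ih =>
    refine ⟨hf.1.mul hg.1, fun j => ?_⟩
    rw [pd_mul (differentiable_of_smooth sf) (differentiable_of_smooth sg)]
    have h1 := ih (hf.2 j) hg.pred (contDiff_pd sf j) sg
    have h2 := ih hf.pred (hg.2 j) sf (contDiff_pd sg j)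
    exact add (h1.mono (by linarith)) (h2.mono (by linarith)) ((contDiff_pd sf j).mul sg)
      (sf.mul (contDiff_pd sg j))

theorem comp_affine (hf : IsSymbol n a f) (sf : ContDiff ℝ ∞ f) {c : ℝ} (hc : c ≠ 0)
    (b : Plane) : IsSymbol n a fun x => f (c • x + b) := by
  induction n generalizing a f with
  | zero => exact Decays.comp_affine hf hc b
  | succ n ih =>
    refine ⟨hf.1.comp_affine hc b, fun j => ?_⟩
    rw [pd_comp_affine (differentiable_of_smooth sf)]
    refine const_mul (ih (hf.2 j) (contDiff_pd sf j)) ?_ c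
    have ha : ContDiff ℝ ∞ fun x : Plane => c • x + b := by fun_prop
    exact (contDiff_pd sf j).comp ha

theorem zero (n : ℕ) (a : ℝ) : IsSymbol n a fun _ => 0 := by
  have h0 : ∀ a, Decays a fun _ => (0 : ℝ) := fun a => ⟨0, fun x => by simp⟩
  induction n generalizing a with
  | zero => exact h0 a
  | succ n ih =>
    refine ⟨h0 a, fun j => ?_⟩
    have : SelfSimilarNS.pd j (fun _ => 0) = fun _ => 0 := by funext x; simp [SelfSimilarNS.pd]
    rw [this]; exact ih _

theorem const (n : ℕ) (c : ℝ) : IsSymbol n 0 fun _ => c := by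
  have h0 : Decays 0 fun _ => c := ⟨|c|, fun x => by simp⟩
  cases n with
  | zero => exact h0
  | succ n =>
    refine ⟨h0, fun j => ?_⟩
    have : SelfSimilarNS.pd j (fun _ => c) = fun _ => 0 := by funext x; simp [SelfSimilarNS.pd]
    rw [this]; exact zero n _

theorem coord (n : ℕ) (i : Fin 2) : IsSymbol n 1 fun x => x i := by
  cases n with
  | zero => exact decays_coord i
  | succ n =>
    refine ⟨decays_coord i, fun j => ?_⟩
    have : SelfSimilarNS.pd j (fun x : Plane => x i) = fun _ => if i = j then 1 else 0 :=
      funext (pd_coord i j)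
    rw [this, sub_self]; exact const n _

end IsSymbol

/-- A function with bounded partial derivatives is Lipschitz. -/
theorem lipschitz_of_pd_bounded {f : Plane → ℝ} (sf : ContDiff ℝ ∞ f)
    (h : ∀ j, Decays 0 (pd j f)) : ∃ L, 0 < L ∧ ∀ x y, |f x - f y| ≤ L * ‖x - y‖ := by
  obtain ⟨C0, p0, h0⟩ := (h 0).exists_pos
  obtain ⟨C1, p1, h1⟩ := (h 1).exists_pos
  simp only [Real.rpow_zero, mul_one] at h0 h1
  refine ⟨C0 + C1, by positivity, fun x y => ?_⟩
  refine (convex_univ (𝕜 := ℝ)).norm_image_sub_le_of_norm_fderiv_le (f := f) (C := C0 + C1)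
    (fun z _ => differentiable_of_smooth sf z) (fun z _ => ?_) (Set.mem_univ y) (Set.mem_univ x)
  refine ContinuousLinearMap.opNorm_le_bound _ (by positivity) fun v => ?_
  rw [fderiv_apply_eq_sum, Fin.sum_univ_two]
  have a0 : |v 0| ≤ ‖v‖ := PiLp.norm_apply_le v 0
  have a1 : |v 1| ≤ ‖v‖ := PiLp.norm_apply_le v 1
  calc |v 0 * pd 0 f z + v 1 * pd 1 f z| ≤ |v 0| * |pd 0 f z| + |v 1| * |pd 1 f z| := by
        rw [← abs_mul, ← abs_mul]; exact abs_add_le _ _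
    _ ≤ ‖v‖ * C0 + ‖v‖ * C1 := by
        gcongr
        · exact h0 z
        · exact h1 z
    _ = (C0 + C1) * ‖v‖ := by ring

/-! ### The moments `∫₀¹ θᵐ e^{-rθ} dθ` -/

/-- `∫₀¹ θᵐ e^{-rθ} dθ`. -/
def expMoment (m : ℕ) (r : ℝ) : ℝ := ∫ θ in (0 : ℝ)..1, θ ^ m * Real.exp (-r * θ)

theorem hasDerivAt_expMoment (m : ℕ) (r : ℝ) :
    HasDerivAt (expMoment m) (-expMoment (m + 1) r) r := by
  have h := intervalIntegral.hasDerivAt_integral_of_dominated_loc_of_deriv_le (μ := volume)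
    (a := 0) (b := 1) (F := fun r θ => θ ^ m * Real.exp (-r * θ))
    (F' := fun r θ => -(θ ^ (m + 1) * Real.exp (-r * θ))) (x₀ := r) (s := Metric.ball r 1)
    (bound := fun _ => Real.exp (|r| + 1)) (Metric.ball_mem_nhds r one_pos)
    (Eventually.of_forall fun s => (by fun_prop : Continuous _).aestronglyMeasurable)
    ((by fun_prop : Continuous _).intervalIntegrable _ _)
    (by fun_prop : Continuous _).aestronglyMeasurable
    (ae_of_all _ fun θ hθ s hs => ?_) (by simp) (ae_of_all _ fun θ _ s _ => ?_)
  · have := h.2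
    rw [intervalIntegral.integral_neg] at this
    exact this
  · rw [Set.uIoc_of_le zero_le_one] at hθ
    rw [Metric.mem_ball, Real.dist_eq] at hs
    rw [norm_neg, norm_mul, norm_pow, Real.norm_eq_abs, Real.norm_eq_abs, Real.abs_exp,
      abs_of_pos hθ.1]
    have h1 : θ ^ (m + 1) ≤ 1 := pow_le_one₀ hθ.1.le hθ.2
    have h2 : -s * θ ≤ |r| + 1 := by
      have : |s| ≤ |r| + 1 := by
        have := abs_sub_abs_le_abs_sub s r; linarith
      calc -s * θ ≤ |s| * 1 := by
            have := neg_abs_le s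
            nlinarith [hθ.1, hθ.2, abs_nonneg s]
        _ ≤ _ := by linarith
    calc θ ^ (m + 1) * Real.exp (-s * θ) ≤ 1 * Real.exp (|r| + 1) := by
          gcongr
      _ = _ := one_mul _
  · have h1 : HasDerivAt (fun s : ℝ => -s * θ) (-1 * θ) s := (hasDerivAt_id s).neg.mul_const θ
    exact (h1.exp.const_mul (θ ^ m)).congr_deriv (by ring)

/-- Differentiation only raises `m`, so an induction over all `m` at once gives smoothness. This
includes r = 0, where the closed form (1 − e^(-r))/r would have a removable singularity. -/
theorem contDiff_expMoment (m : ℕ) : ContDiff ℝ ∞ (expMoment m) := by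
  rw [contDiff_infty]
  intro n
  induction n generalizing m with
  | zero =>
    exact contDiff_zero.2 (continuous_iff_continuousAt.2 fun r =>
      (hasDerivAt_expMoment m r).continuousAt)
  | succ n ih =>
    have hd : deriv (expMoment m) = fun r => -expMoment (m + 1) r :=
      funext fun r => (hasDerivAt_expMoment m r).deriv
    push_cast
    rw [contDiff_succ_iff_deriv, hd]
    exact ⟨fun r => (hasDerivAt_expMoment m r).differentiableAt, by simp, (ih (m + 1)).neg⟩

/-- Integrate the derivative of θ^(m+1) e^(-rθ) over [0, 1]. This single recursion later gives the
decay of the moments, the decay of the Gaussian, and the Laplacian of `potGrad`. -/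
theorem expMoment_rec (m : ℕ) (r : ℝ) :
    (m + 1) * expMoment m r - r * expMoment (m + 1) r = Real.exp (-r) := by
  have h : ∀ θ : ℝ, HasDerivAt (fun θ : ℝ => θ ^ (m + 1) * Real.exp (-r * θ))
      ((m + 1) * (θ ^ m * Real.exp (-r * θ)) - r * (θ ^ (m + 1) * Real.exp (-r * θ))) θ := by
    intro θ
    have h1 : HasDerivAt (fun θ : ℝ => -r * θ) (-r * 1) θ := (hasDerivAt_id θ).const_mul (-r)
    refine ((hasDerivAt_pow (m + 1) θ).mul h1.exp).congr_deriv ?_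
    rw [Nat.add_sub_cancel]
    push_cast
    ring
  have h2 := intervalIntegral.integral_eq_sub_of_hasDerivAt (a := 0) (b := 1) (fun θ _ => h θ)
    ((by fun_prop : Continuous _).intervalIntegrable _ _)
  rw [intervalIntegral.integral_sub ((by fun_prop : Continuous _).intervalIntegrable _ _)
    ((by fun_prop : Continuous _).intervalIntegrable _ _), intervalIntegral.integral_const_mul,
    intervalIntegral.integral_const_mul] at h2
  simpa [expMoment] using h2

theorem expMoment_nonneg (m : ℕ) (r : ℝ) : 0 ≤ expMoment m r :=
  intervalIntegral.integral_nonneg zero_le_one fun _ hθ =>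
    mul_nonneg (pow_nonneg hθ.1 m) (Real.exp_pos _).le

theorem expMoment_succ_le (m : ℕ) (r : ℝ) : expMoment (m + 1) r ≤ expMoment m r := by
  refine intervalIntegral.integral_mono_on zero_le_one
    ((by fun_prop : Continuous _).intervalIntegrable _ _)
    ((by fun_prop : Continuous _).intervalIntegrable _ _) fun θ hθ => ?_
  exact mul_le_mul_of_nonneg_right (pow_le_pow_of_le_one hθ.1 hθ.2 (Nat.le_succ m))
    (Real.exp_pos _).le

theorem expMoment_zero_mul (r : ℝ) : r * expMoment 0 r = 1 - Real.exp (-r) := by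
  have h : ∀ θ : ℝ, HasDerivAt (fun θ : ℝ => -Real.exp (-r * θ)) (r * Real.exp (-r * θ)) θ := by
    intro θ
    have h1 : HasDerivAt (fun θ : ℝ => -r * θ) (-r * 1) θ := (hasDerivAt_id θ).const_mul (-r)
    exact h1.exp.neg.congr_deriv (by ring)
  have h2 := intervalIntegral.integral_eq_sub_of_hasDerivAt (a := 0) (b := 1) (fun θ _ => h θ)
    ((by fun_prop : Continuous _).intervalIntegrable _ _)
  rw [intervalIntegral.integral_const_mul] at h2
  simp only [expMoment, pow_zero, one_mul, h2]
  simp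
  ring

/-- Write Mₘ for the moment. The recursion gives r Mₘ₊₁ ≤ (m + 1) Mₘ, and Mₘ₊₁ ≤ Mₘ; adding them,
each further power of θ gains one power of 1 + r. -/
theorem expMoment_decay (m : ℕ) {r : ℝ} (hr : 0 ≤ r) :
    (1 + r) ^ (m + 1) * expMoment m r ≤ 2 * (m + 1).factorial := by
  induction m with
  | zero =>
    have h1 : expMoment 0 r ≤ 1 := by
      have : expMoment 0 r ≤ ∫ θ in (0 : ℝ)..1, (1 : ℝ) := by
        refine intervalIntegral.integral_mono_on zero_le_one
          ((by fun_prop : Continuous _).intervalIntegrable _ _) (by simp) fun θ hθ => ?_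
        simp only [pow_zero, one_mul]
        exact Real.exp_le_one_iff.2 (by nlinarith [hθ.1])
      simpa using this
    have h2 := expMoment_zero_mul r
    have h3 := Real.exp_pos (-r)
    simp; linarith
  | succ m ih =>
    have h1 := expMoment_rec m r
    have h2 := expMoment_succ_le m r
    have h3 := Real.exp_pos (-r)
    have h4 : (1 + r) * expMoment (m + 1) r ≤ (m + 2) * expMoment m r := by linarith
    calc (1 + r) ^ (m + 1 + 1) * expMoment (m + 1) r
        = (1 + r) ^ (m + 1) * ((1 + r) * expMoment (m + 1) r) := by ring
      _ ≤ (1 + r) ^ (m + 1) * ((m + 2) * expMoment m r) := by gcongr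
      _ = (m + 2) * ((1 + r) ^ (m + 1) * expMoment m r) := by ring
      _ ≤ (m + 2) * (2 * (m + 1).factorial) := by gcongr
      _ = 2 * (m + 1 + 1).factorial := by
        rw [Nat.factorial_succ (m + 1)]; push_cast; ring

/-! ### The Gaussian and the gradient of its Newtonian potential -/

/-- The radial function `∫₀¹ θᵐ e^{-θ|x|²/4} dθ`. -/
def radial (m : ℕ) (x : Plane) : ℝ := expMoment m (‖x‖ ^ 2 / 4)

theorem hasFDerivAt_norm_sq_div (x : Plane) :
    HasFDerivAt (fun x : Plane => ‖x‖ ^ 2 / 4) ((1 / 2 : ℝ) • innerSL ℝ x) x := by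
  have h := ((hasStrictFDerivAt_norm_sq x).hasFDerivAt).mul_const (4 : ℝ)⁻¹
  simp only [← div_eq_mul_inv] at h
  refine h.congr_fderiv ?_
  ext v
  simp
  ring

theorem inner_stdVec (x : Plane) (j : Fin 2) : inner ℝ x (stdVec j) = x j := by
  simp [stdVec, EuclideanSpace.inner_single_right]

theorem contDiff_radial (m : ℕ) : ContDiff ℝ ∞ (radial m) :=
  (contDiff_expMoment m).comp ((contDiff_norm_sq ℝ).div_const 4)

theorem pd_radial (m : ℕ) (j : Fin 2) :
    pd j (radial m) = fun x => (-1 / 2) * (x j * radial (m + 1) x) := by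
  funext x
  have h := (hasDerivAt_expMoment m (‖x‖ ^ 2 / 4)).comp_hasFDerivAt x (hasFDerivAt_norm_sq_div x)
  have h2 : fderiv ℝ (radial m) x = _ := h.fderiv
  simp only [pd, h2]
  simp [inner_stdVec, radial]
  ring

theorem one_add_norm_sq_div_four (x : Plane) : bracket x ^ 2 / 4 ≤ 1 + ‖x‖ ^ 2 / 4 := by
  rw [bracket_sq]; linarith

theorem radial_nonneg (m : ℕ) (x : Plane) : 0 ≤ radial m x := expMoment_nonneg _ _

theorem decays_radial (m : ℕ) : Decays (-(2 * m + 2)) (radial m) := by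
  refine ⟨4 ^ (m + 1) * (2 * (m + 1).factorial), fun x => ?_⟩
  rw [abs_of_nonneg (radial_nonneg m x)]
  have h := expMoment_decay m (r := ‖x‖ ^ 2 / 4) (by positivity)
  have h1 : (bracket x ^ 2 / 4) ^ (m + 1) * radial m x ≤ 2 * (m + 1).factorial :=
    (mul_le_mul_of_nonneg_right (pow_le_pow_left₀ (by positivity) (one_add_norm_sq_div_four x) _)
      (radial_nonneg m x)).trans h
  have e : bracket x ^ (-(2 * (m : ℝ) + 2)) = ((bracket x ^ 2) ^ (m + 1))⁻¹ := by
    rw [Real.rpow_neg (bracket_pos x).le, ← pow_mul, ← Real.rpow_natCast]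
    push_cast; ring_nf
  have hb : 0 < (bracket x ^ 2) ^ (m + 1) := by have := bracket_pos x; positivity
  rw [e, ← div_eq_mul_inv, le_div_iff₀ hb]
  rw [div_pow, div_mul_eq_mul_div, div_le_iff₀ (by positivity)] at h1
  linarith

/-- A derivative produces xⱼ times the next radial function, of order 1 − (2m + 4): exactly one less
than before. -/
theorem isSymbol_radial (n m : ℕ) : IsSymbol n (-(2 * m + 2)) (radial m) := by
  induction n generalizing m with
  | zero => exact decays_radial m
  | succ n ih =>
    refine ⟨decays_radial m, fun j => ?_⟩
    rw [pd_radial]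
    refine IsSymbol.const_mul ?_ ((contDiff_coord j).mul (contDiff_radial _)) _
    refine ((IsSymbol.coord n j).mul (ih (m + 1)) (contDiff_coord j) (contDiff_radial _)).mono ?_
    push_cast; linarith

/-- The heat kernel `e^{-|x|²/4} / 4π` at time `1`. -/
def gauss (x : Plane) : ℝ := (4 * Real.pi)⁻¹ * Real.exp (-(‖x‖ ^ 2 / 4))

theorem contDiff_gauss : ContDiff ℝ ∞ gauss :=
  contDiff_const.mul (((contDiff_norm_sq ℝ).div_const 4).neg.exp)

theorem gauss_pos (x : Plane) : 0 < gauss x := by unfold gauss; positivity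

theorem pd_gauss (j : Fin 2) : pd j gauss = fun x => (-1 / 2) * (x j * gauss x) := by
  funext x
  have h := ((hasFDerivAt_norm_sq_div x).neg.exp).const_mul (4 * Real.pi)⁻¹
  have h2 : fderiv ℝ gauss x = _ := h.fderiv
  simp only [pd, h2]
  simp [inner_stdVec, gauss]
  ring

/-- Drop the nonnegative subtracted term in `expMoment_rec`. As `m` is arbitrary, this gives the
Gaussian decay of every polynomial order. -/
theorem gauss_le_radial (m : ℕ) (x : Plane) :
    gauss x ≤ (4 * Real.pi)⁻¹ * ((m + 1) * radial m x) := by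
  have h := expMoment_rec m (‖x‖ ^ 2 / 4)
  have h2 : 0 ≤ ‖x‖ ^ 2 / 4 * expMoment (m + 1) (‖x‖ ^ 2 / 4) :=
    mul_nonneg (by positivity) (expMoment_nonneg _ _)
  unfold gauss radial
  gcongr
  linarith

theorem decays_gauss (a : ℝ) : Decays a gauss := by
  obtain ⟨m, hm⟩ := exists_nat_ge (-a)
  refine Decays.mono (a := -(2 * m + 2)) ?_ (by
    have : (0 : ℝ) ≤ m := Nat.cast_nonneg m
    linarith)
  obtain ⟨C, hC⟩ := ((decays_radial m).const_mul (m + 1)).const_mul (4 * Real.pi)⁻¹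
  refine ⟨C, fun x => ?_⟩
  rw [abs_of_pos (gauss_pos x)]
  exact (gauss_le_radial m x).trans ((le_abs_self _).trans (hC x))

theorem isSymbol_gauss (n : ℕ) (a : ℝ) : IsSymbol n a gauss := by
  induction n generalizing a with
  | zero => exact decays_gauss a
  | succ n ih =>
    refine ⟨decays_gauss a, fun j => ?_⟩
    rw [pd_gauss]
    refine IsSymbol.const_mul ?_ ((contDiff_coord j).mul contDiff_gauss) _
    exact ((IsSymbol.coord n j).mul (ih (a - 2)) (contDiff_coord j) contDiff_gauss).mono
      (by linarith)

/-- The `i`-th component of the gradient of the Newtonian potential of `gauss`. -/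
def potGrad (i : Fin 2) (x : Plane) : ℝ := (8 * Real.pi)⁻¹ * (x i * radial 0 x)

theorem contDiff_potGrad (i : Fin 2) : ContDiff ℝ ∞ (potGrad i) :=
  contDiff_const.mul ((contDiff_coord i).mul (contDiff_radial 0))

theorem isSymbol_potGrad (n : ℕ) (i : Fin 2) : IsSymbol n (-1) (potGrad i) := by
  refine IsSymbol.const_mul ?_ ((contDiff_coord i).mul (contDiff_radial 0)) _
  refine ((IsSymbol.coord n i).mul (isSymbol_radial n 0) (contDiff_coord i)
    (contDiff_radial 0)).mono ?_
  norm_num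

/-- After differentiating twice, everything reduces to the recursion at m = 1, namely 2 `radial 1` −
(|x|²/4) `radial 2` = e^(-|x|²/4). Thus the explicit function `potGrad i` serves as ∂ᵢΔ⁻¹G and no
singular integral is needed. -/
theorem lapl_potGrad (i : Fin 2) : lapl (potGrad i) = pd i gauss := by
  have d0 := differentiable_of_smooth (contDiff_radial 0)
  have d1 := differentiable_of_smooth (contDiff_radial 1)
  have dc := differentiable_coord
  have e1 : ∀ j, pd j (potGrad i) = fun x => (8 * Real.pi)⁻¹ *
      ((if i = j then 1 else 0) * radial 0 x + (-1 / 2) * (x i * (x j * radial 1 x))) := by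
    intro j
    unfold potGrad
    rw [pd_const_mul (f := fun x => x i * radial 0 x) ((dc i).mul d0), pd_mul (dc i) d0]
    funext x
    simp only [pd_coord, pd_radial]; ring
  have e2 : ∀ j x, pd j (pd j (potGrad i)) x = (8 * Real.pi)⁻¹ *
      ((if i = j then 1 else 0) * (-1 / 2 * (x j * radial 1 x)) + (-1 / 2) *
      ((if i = j then 1 else 0) * (x j * radial 1 x) +
        x i * (radial 1 x + x j * (-1 / 2 * (x j * radial 2 x))))) := by
    intro j x
    have da : Differentiable ℝ fun x => (if i = j then 1 else 0) * radial 0 x := d0.const_mul _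
    have db : Differentiable ℝ fun x : Plane => x j * radial 1 x := (dc j).mul d1
    have dd : Differentiable ℝ fun x : Plane => x i * (x j * radial 1 x) := (dc i).mul db
    rw [e1, pd_const_mul (f := fun x => (if i = j then 1 else 0) * radial 0 x +
      (-1 / 2) * (x i * (x j * radial 1 x))) (da.add (dd.const_mul _)), pd_add da (dd.const_mul _),
      pd_const_mul d0, pd_const_mul dd, pd_mul (dc i) db, pd_mul (dc j) d1]
    simp only [pd_coord, pd_radial, if_true]
    ring
  funext x
  have hrec := expMoment_rec 1 (‖x‖ ^ 2 / 4)
  have hn : ‖x‖ ^ 2 = x 0 ^ 2 + x 1 ^ 2 := by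
    rw [EuclideanSpace.norm_sq_eq, Fin.sum_univ_two]; simp
  have hrec' : 2 * radial 1 x - (x 0 ^ 2 + x 1 ^ 2) / 4 * radial 2 x =
      Real.exp (-(‖x‖ ^ 2 / 4)) := by
    rw [← hrec, ← hn, radial, radial]; push_cast; ring
  simp only [lapl, pd_gauss]
  simp only [gauss, ← hrec', e2, Fin.sum_univ_two]
  have hpi := Real.pi_ne_zero
  fin_cases i <;> simp <;> field_simp <;> ring

/-- The kernel `δᵢₖ ∂ⱼ G - ∂ᵢ∂ⱼ∂ₖ Δ⁻¹ G` of `ℙ ∂ⱼ e^Δ` at time `1`. -/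
def oseen (i j k : Fin 2) (x : Plane) : ℝ :=
  (if i = k then 1 else 0) * pd j gauss x + (-1) * pd j (pd k (potGrad i)) x

theorem contDiff_oseen (i j k : Fin 2) : ContDiff ℝ ∞ (oseen i j k) :=
  (contDiff_const.mul (contDiff_pd contDiff_gauss j)).add
    (contDiff_const.mul (contDiff_pd (contDiff_pd (contDiff_potGrad i) k) j))

/-- The order −3 comes from the nonlocal term alone: two derivatives of `potGrad`, which has order
−1. The Gaussian term decays faster than any power. -/
theorem isSymbol_oseen (n : ℕ) (i j k : Fin 2) : IsSymbol n (-3) (oseen i j k) := by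
  have sg := contDiff_pd contDiff_gauss j
  have sp := contDiff_pd (contDiff_pd (contDiff_potGrad i) k) j
  refine IsSymbol.add (IsSymbol.const_mul ?_ sg _) (IsSymbol.const_mul ?_ sp _)
    (contDiff_const.mul sg) (contDiff_const.mul sp)
  · exact ((isSymbol_gauss (n + 1) (-2)).pd j).mono (by norm_num)
  · exact (((isSymbol_potGrad (n + 2) i).pd k).pd j).mono (by norm_num)

/-! ### Cutting off smooth functions -/

theorem decays_of_hasCompactSupport {f : Plane → ℝ} (hf : Continuous f)
    (hc : HasCompactSupport f) (a : ℝ) : Decays a f := by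
  have hcont : Continuous fun x => f x * bracket x ^ (-a) := hf.mul (continuous_bracket_rpow _)
  obtain ⟨C, hC⟩ := hcont.bounded_above_of_compact_support hc.mul_right
  refine ⟨C, fun x => ?_⟩
  have h := hC x
  rw [Real.norm_eq_abs, abs_mul, abs_of_pos (bracket_rpow_pos x _),
    Real.rpow_neg (bracket_pos x).le, ← div_eq_mul_inv, div_le_iff₀ (bracket_rpow_pos x a)] at h
  exact h

/-- A smooth symbol is the pointwise limit of test functions, with uniform symbol bounds. -/
theorem exists_test_approx {a : ℝ} {φ : Plane → ℝ} (sφ : ContDiff ℝ ∞ φ)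
    (hφ : IsSymbol 2 a φ) : ∃ (χ : ℕ → Test) (C : ℝ),
      (∀ n x, |χ n x| ≤ C * bracket x ^ a) ∧
      (∀ j n x, |pd j (χ n) x| ≤ C * bracket x ^ (a - 1)) ∧
      (∀ j k n x, |pd j (pd k (χ n)) x| ≤ C * bracket x ^ (a - 2)) ∧
      (∀ x, Tendsto (fun n => χ n x) atTop (𝓝 (φ x))) ∧
      (∀ j x, Tendsto (fun n => pd j (χ n) x) atTop (𝓝 (pd j φ x))) ∧
      (∀ j k x, Tendsto (fun n => pd j (pd k (χ n)) x) atTop (𝓝 (pd j (pd k φ) x))) := by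
  obtain ⟨b⟩ : Nonempty (ContDiffBump (0 : Plane)) := inferInstance
  have sb : ContDiff ℝ ∞ b := b.contDiff
  have db := differentiable_of_smooth sb
  have hcb : HasCompactSupport b := b.hasCompactSupport
  set r : ℕ → ℝ := fun n => ((n : ℝ) + 1)⁻¹ with hr
  have r0 : ∀ n, 0 < r n := fun n => by simp only [hr]; positivity
  have r1 : ∀ n, r n ≤ 1 := fun n => inv_le_one_of_one_le₀ (by
    have : (0 : ℝ) ≤ n := Nat.cast_nonneg n
    linarith)
  have rt : Tendsto r atTop (𝓝 0) := by
    simpa [hr, one_div] using tendsto_one_div_add_atTop_nhds_zero_nat (𝕜 := ℝ)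
  let β : ℕ → Plane → ℝ := fun n x => b (r n • x + 0)
  have aff : ∀ n, ContDiff ℝ ∞ fun x : Plane => r n • x + (0 : Plane) := fun n => by fun_prop
  have sβ : ∀ n, ContDiff ℝ ∞ (β n) := fun n => sb.comp (aff n)
  have cβ : ∀ n, HasCompactSupport (β n) := fun n => by
    have : HasCompactSupport fun x : Plane => b (r n • x) := hcb.comp_smul (r0 n).ne'
    simpa [β] using this
  have arg : ∀ x : Plane, Tendsto (fun n => r n • x + (0 : Plane)) atTop (𝓝 0) := fun x => by
    simpa using (rt.smul_const x).add_const (0 : Plane)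
  have pβ : ∀ j n, pd j (β n) = fun x => r n * pd j b (r n • x + 0) := fun j n =>
    pd_comp_affine db (r n) 0 j
  have ppβ : ∀ j k n, pd j (pd k (β n)) = fun x => r n * (r n * pd j (pd k b) (r n • x + 0)) := by
    intro j k n
    have d1 := differentiable_of_smooth (contDiff_pd sb k)
    have d2 : Differentiable ℝ fun x : Plane => pd k b (r n • x + 0) :=
      differentiable_of_smooth ((contDiff_pd sb k).comp (aff n))
    rw [pβ, pd_const_mul d2, pd_comp_affine d1]
  -- This makes the bounds uniform in n. Each derivative of b(r x) produces a factor r, and r⟨r x⟩⁻¹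
  -- ≤ ⟨x⟩⁻¹ for r ≤ 1 turns it into one power of decay. The cutoffs therefore satisfy symbol bounds
  -- of order 0 uniformly.
  have scale : ∀ n x, r n * (bracket (r n • x + 0))⁻¹ ≤ (bracket x)⁻¹ := by
    intro n x
    rw [← div_eq_mul_inv, div_le_iff₀ (bracket_pos _), ← div_eq_inv_mul,
      le_div_iff₀ (bracket_pos _), add_zero]
    refine abs_le_of_sq_le_sq' ?_ (bracket_pos _).le |>.2
    rw [mul_pow, bracket_sq, bracket_sq, norm_smul, mul_pow, Real.norm_eq_abs, sq_abs]
    nlinarith [r0 n, r1 n, sq_nonneg ‖x‖, mul_pos (r0 n) (r0 n)]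
  obtain ⟨C1, hC1, h1⟩ : ∃ C, 0 < C ∧ ∀ j n x, |pd j (β n) x| ≤ C * bracket x ^ (-1 : ℝ) := by
    have h : ∀ j, ∃ C, 0 < C ∧ ∀ x, |pd j b x| ≤ C * bracket x ^ (-1 : ℝ) := fun j =>
      (decays_of_hasCompactSupport (contDiff_pd sb j).continuous
        (hasCompactSupport_pd hcb j) _).exists_pos
    choose C hC0 hC using h
    refine ⟨C 0 + C 1, add_pos (hC0 0) (hC0 1), fun j n x => ?_⟩
    have hj : C j ≤ C 0 + C 1 := by
      fin_cases j
      · simpa using (hC0 1).le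
      · simpa using (hC0 0).le
    rw [pβ]
    simp only [abs_mul, abs_of_pos (r0 n)]
    have h2 := hC j (r n • x + 0)
    have h3 := scale n x
    rw [Real.rpow_neg_one] at h2 ⊢
    calc r n * |pd j b (r n • x + 0)| ≤ r n * (C j * (bracket (r n • x + 0))⁻¹) :=
          mul_le_mul_of_nonneg_left h2 (r0 n).le
      _ = C j * (r n * (bracket (r n • x + 0))⁻¹) := by ring
      _ ≤ C j * (bracket x)⁻¹ := mul_le_mul_of_nonneg_left h3 (hC0 j).le
      _ ≤ _ := mul_le_mul_of_nonneg_right hj (inv_nonneg.2 (bracket_pos x).le)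
  obtain ⟨C2, hC2, h2⟩ : ∃ C, 0 < C ∧
      ∀ j k n x, |pd j (pd k (β n)) x| ≤ C * bracket x ^ (-2 : ℝ) := by
    have h : ∀ j k, ∃ C, 0 < C ∧ ∀ x, |pd j (pd k b) x| ≤ C * bracket x ^ (-2 : ℝ) := fun j k =>
      (decays_of_hasCompactSupport (contDiff_pd (contDiff_pd sb k) j).continuous
        (hasCompactSupport_pd (hasCompactSupport_pd hcb k) j) _).exists_pos
    choose C hC0 hC using h
    refine ⟨∑ j, ∑ k, C j k, Finset.sum_pos (fun j _ => Finset.sum_pos (fun k _ => hC0 j k)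
      ⟨0, Finset.mem_univ _⟩) ⟨0, Finset.mem_univ _⟩, fun j k n x => ?_⟩
    have hj : C j k ≤ ∑ j, ∑ k, C j k :=
      (Finset.single_le_sum (f := fun k => C j k) (fun k _ => (hC0 j k).le)
        (Finset.mem_univ k)).trans
      (Finset.single_le_sum (f := fun j => ∑ k, C j k)
        (fun j _ => Finset.sum_nonneg fun k _ => (hC0 j k).le) (Finset.mem_univ j))
    have e : ∀ y, bracket y ^ (-2 : ℝ) = (bracket y)⁻¹ ^ 2 := fun y => by
      rw [Real.rpow_neg (bracket_pos y).le, inv_pow]; norm_cast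
    rw [ppβ]
    simp only [abs_mul, abs_of_pos (r0 n)]
    have h2 := hC j k (r n • x + 0)
    have h3 := scale n x
    rw [e] at h2 ⊢
    have hp : 0 ≤ r n * (bracket (r n • x + 0))⁻¹ :=
      mul_nonneg (r0 n).le (inv_nonneg.2 (bracket_pos _).le)
    calc r n * (r n * |pd j (pd k b) (r n • x + 0)|)
        ≤ r n * (r n * (C j k * (bracket (r n • x + 0))⁻¹ ^ 2)) := by
          have := (r0 n).le
          gcongr
      _ = C j k * (r n * (bracket (r n • x + 0))⁻¹) ^ 2 := by ring
      _ ≤ C j k * (bracket x)⁻¹ ^ 2 :=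
          mul_le_mul_of_nonneg_left (pow_le_pow_left₀ hp h3 2) (hC0 j k).le
      _ ≤ _ := mul_le_mul_of_nonneg_right hj (sq_nonneg _)
  have h0 : ∀ n x, |β n x| ≤ 1 := fun n x => by
    rw [abs_of_nonneg b.nonneg]; exact b.le_one
  have t0 : ∀ x, Tendsto (fun n => β n x) atTop (𝓝 1) := fun x => by
    have hb0 : b (0 : Plane) = 1 := b.one_of_mem_closedBall (by simp [b.rIn_pos.le])
    have := (sb.continuous.tendsto (0 : Plane)).comp (arg x)
    rwa [hb0] at this
  have t1 : ∀ j x, Tendsto (fun n => pd j (β n) x) atTop (𝓝 0) := fun j x => by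
    have := rt.mul (((contDiff_pd sb j).continuous.tendsto (0 : Plane)).comp (arg x))
    simp only [pβ]
    simpa using this
  have t2 : ∀ j k x, Tendsto (fun n => pd j (pd k (β n)) x) atTop (𝓝 0) := fun j k x => by
    have := rt.mul (rt.mul
      (((contDiff_pd (contDiff_pd sb k) j).continuous.tendsto (0 : Plane)).comp (arg x)))
    simp only [ppβ]
    simpa using this
  have dφ := differentiable_of_smooth sφ
  have dpφ := fun j => differentiable_of_smooth (contDiff_pd sφ j)
  have dβ := fun n => differentiable_of_smooth (sβ n)
  have dpβ := fun j n => differentiable_of_smooth (contDiff_pd (sβ n) j)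
  let χ : ℕ → Test := fun n => mkTest (fun x => β n x * φ x) ((sβ n).mul sφ) (cβ n).mul_right
  have eχ : ∀ n, ⇑(χ n) = fun x => β n x * φ x := fun n => rfl
  have eχ1 : ∀ j n, pd j (χ n) = fun x => pd j (β n) x * φ x + β n x * pd j φ x := fun j n => by
    rw [eχ, pd_mul (dβ n) dφ]
  have eχ2 : ∀ j k n, pd j (pd k (χ n)) = fun x =>
      (pd j (pd k (β n)) x * φ x + pd k (β n) x * pd j φ x) +
      (pd j (β n) x * pd k φ x + β n x * pd j (pd k φ) x) := fun j k n => by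
    rw [eχ1, pd_add (f := fun x => pd k (β n) x * φ x) (g := fun x => β n x * pd k φ x)
      ((dpβ k n).mul dφ) ((dβ n).mul (dpφ k)), pd_mul (dpβ k n) dφ,
      pd_mul (dβ n) (dpφ k)]
  obtain ⟨D0, hD0, k0⟩ := hφ.decays.exists_pos
  obtain ⟨D1, hD1, k1⟩ : ∃ C, 0 < C ∧ ∀ j x, |pd j φ x| ≤ C * bracket x ^ (a - 1) := by
    choose C hC0 hC using fun j => (hφ.pd j).decays.exists_pos
    refine ⟨C 0 + C 1, add_pos (hC0 0) (hC0 1), fun j x => (hC j x).trans ?_⟩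
    refine mul_le_mul_of_nonneg_right ?_ (bracket_rpow_pos x _).le
    fin_cases j
    · simpa using (hC0 1).le
    · simpa using (hC0 0).le
  obtain ⟨D2, hD2, k2⟩ : ∃ C, 0 < C ∧ ∀ j k x, |pd j (pd k φ) x| ≤ C * bracket x ^ (a - 2) := by
    choose C hC0 hC using fun j k => ((hφ.pd k).pd j).decays.exists_pos
    refine ⟨∑ j, ∑ k, C j k, Finset.sum_pos (fun j _ => Finset.sum_pos (fun k _ => hC0 j k)
      ⟨0, Finset.mem_univ _⟩) ⟨0, Finset.mem_univ _⟩, fun j k x => (hC j k x).trans ?_⟩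
    rw [show a - 1 - 1 = a - 2 by ring]
    refine mul_le_mul_of_nonneg_right ?_ (bracket_rpow_pos x _).le
    exact (Finset.single_le_sum (f := fun k => C j k) (fun k _ => (hC0 j k).le)
        (Finset.mem_univ k)).trans
      (Finset.single_le_sum (f := fun j => ∑ k, C j k)
        (fun j _ => Finset.sum_nonneg fun k _ => (hC0 j k).le) (Finset.mem_univ j))
  have pm : ∀ {u v A B c d e : ℝ} {x : Plane}, |u| ≤ A * bracket x ^ c → |v| ≤ B * bracket x ^ d →
      c + d = e → |u * v| ≤ A * B * bracket x ^ e := by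
    intro u v A B c d e x hu hv he
    rw [← he, Real.rpow_add (bracket_pos x), abs_mul]
    calc |u| * |v| ≤ (A * bracket x ^ c) * (B * bracket x ^ d) :=
          mul_le_mul hu hv (abs_nonneg _) ((abs_nonneg _).trans hu)
      _ = _ := by ring
  have h0' : ∀ n x, |β n x| ≤ 1 * bracket x ^ (0 : ℝ) := fun n x => by simpa using h0 n x
  refine ⟨χ, 1 * D0 + (C1 * D0 + 1 * D1) + ((C2 * D0 + C1 * D1) + (C1 * D1 + 1 * D2)),
    fun n x => ?_, fun j n x => ?_, fun j k n x => ?_, fun x => ?_, fun j x => ?_, fun j k x => ?_⟩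
  · rw [eχ]
    refine (pm (h0' n x) (k0 x) (zero_add a)).trans ?_
    refine mul_le_mul_of_nonneg_right ?_ (bracket_rpow_pos x _).le
    have : 0 ≤ (C1 * D0 + 1 * D1) + ((C2 * D0 + C1 * D1) + (C1 * D1 + 1 * D2)) := by positivity
    linarith
  · rw [eχ1]
    refine (abs_add_le _ _).trans ((add_le_add (pm (h1 j n x) (k0 x) (by ring : _ = a - 1))
      (pm (h0' n x) (k1 j x) (by ring : _ = a - 1))).trans ?_)
    rw [← add_mul]
    refine mul_le_mul_of_nonneg_right ?_ (bracket_rpow_pos x _).le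
    have : 0 ≤ 1 * D0 + ((C2 * D0 + C1 * D1) + (C1 * D1 + 1 * D2)) := by positivity
    linarith
  · rw [eχ2]
    have g1 := pm (h2 j k n x) (k0 x) (by ring : _ = a - 2)
    have g2 := pm (h1 k n x) (k1 j x) (by ring : _ = a - 2)
    have g3 := pm (h1 j n x) (k1 k x) (by ring : _ = a - 2)
    have g4 := pm (h0' n x) (k2 j k x) (by ring : _ = a - 2)
    refine (abs_add_le _ _).trans ((add_le_add (abs_add_le _ _) (abs_add_le _ _)).trans ?_)
    refine (add_le_add (add_le_add g1 g2) (add_le_add g3 g4)).trans ?_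
    rw [← add_mul, ← add_mul, ← add_mul]
    refine mul_le_mul_of_nonneg_right ?_ (bracket_rpow_pos x _).le
    have : 0 ≤ 1 * D0 + (C1 * D0 + 1 * D1) := by positivity
    linarith
  · simpa [eχ] using (t0 x).mul_const (φ x)
  · simp only [eχ1]
    simpa using ((t1 j x).mul_const (φ x)).add ((t0 x).mul_const (pd j φ x))
  · simp only [eχ2]
    simpa using (((t2 j k x).mul_const (φ x)).add ((t1 k x).mul_const (pd j φ x))).add
      (((t1 j x).mul_const (pd k φ x)).add ((t0 x).mul_const (pd j (pd k φ) x)))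

/-! ### Testing L² functions against symbols without compact support -/

/-- Dominated convergence for the pairing of an `L²` function with decaying functions. -/
theorem tendsto_integral_mul {f : Plane → ℝ} (hf : MemLp f 2) {g : ℕ → Plane → ℝ}
    {G : Plane → ℝ} (hg : ∀ n, Continuous (g n)) {C r : ℝ} (hr : r < -1)
    (hC : ∀ n x, |g n x| ≤ C * bracket x ^ r)
    (hG : ∀ x, Tendsto (fun n => g n x) atTop (𝓝 (G x))) :
    Tendsto (fun n => ∫ x, f x * g n x) atTop (𝓝 (∫ x, f x * G x)) := by
  have hB : MemLp (fun x : Plane => C * bracket x ^ r) 2 := by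
    have := memLp_two_bracket_rpow (r := -r) (by linarith)
    rw [neg_neg] at this
    exact this.const_mul C
  refine tendsto_integral_of_dominated_convergence (fun x => |f x| * (C * bracket x ^ r))
    (fun n => hf.1.mul (hg n).aestronglyMeasurable) (hf.abs.integrable_mul hB)
    (fun n => ae_of_all _ fun x => ?_) (ae_of_all _ fun x => (hG x).const_mul (f x))
  rw [Real.norm_eq_abs, abs_mul]
  exact mul_le_mul_of_nonneg_left (hC n x) (abs_nonneg _)

/-- The distributional equation `ℒ f = 0` can be tested on decaying smooth functions. -/
theorem integral_mul_lerayAdj_eq_zero {f : Plane → ℝ} (hf : MemLp f 2)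
    (h : ∀ φ : Test, ∫ x, f x * lerayAdj φ x = 0) {φ : Plane → ℝ} (sφ : ContDiff ℝ ∞ φ)
    (hφ : IsSymbol 2 (-2) φ) : ∫ x, f x * lerayAdj φ x = 0 := by
  obtain ⟨χ, C, h0, h1, h2, t0, t1, t2⟩ := exists_test_approx sφ hφ
  have key := tendsto_integral_mul (r := -2) hf (g := fun n => lerayAdj (χ n))
    (G := lerayAdj φ) (C := 2 * C + 1 / 2 * C + 1 / 2 * (2 * C))
    (fun n => (contDiff_lerayAdj (smooth_test (χ n))).continuous) (by norm_num)
    (fun n x => ?_) (fun x => ?_)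
  · simp only [h] at key
    exact (tendsto_nhds_unique key tendsto_const_nhds)
  · have hC : 0 ≤ C := by
      have := (abs_nonneg _).trans (h0 n x)
      exact nonneg_of_mul_nonneg_left this (bracket_rpow_pos x _)
    have b1 : ∀ j, |pd j (pd j (χ n)) x| ≤ C * bracket x ^ (-2 : ℝ) := fun j =>
      (h2 j j n x).trans (mul_le_mul_of_nonneg_left (bracket_rpow_le_rpow x (by norm_num)) hC)
    have b2 : ∀ j, |x j * pd j (χ n) x| ≤ C * bracket x ^ (-2 : ℝ) := fun j => by
      rw [abs_mul]
      have e : bracket x ^ (-2 : ℝ) = bracket x * bracket x ^ (-2 - 1 : ℝ) := by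
        rw [← Real.rpow_one_add' (bracket_pos x).le (by norm_num)]; norm_num
      have hx : |x j| ≤ bracket x := (PiLp.norm_apply_le x j).trans (norm_le_bracket x)
      calc |x j| * |pd j (χ n) x| ≤ bracket x * (C * bracket x ^ (-2 - 1 : ℝ)) :=
            mul_le_mul hx (h1 j n x) (abs_nonneg _) (bracket_pos x).le
        _ = _ := by rw [e]; ring
    have c1 := b1 0
    have c2 := b1 1
    have c3 := b2 0
    have c4 := b2 1
    have c5 := h0 n x
    simp only [lerayAdj, lapl, Fin.sum_univ_two]
    rw [abs_le] at *
    constructor <;> linarith [c1.1, c1.2, c2.1, c2.2, c3.1, c3.2, c4.1, c4.2, c5.1, c5.2]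
  · exact ((tendsto_finsetSum _ fun j _ => t2 j j x).sub ((t0 x).const_mul _)).sub
      ((tendsto_finsetSum _ fun j _ => (t1 j x).const_mul (x j)).const_mul _)

/-! ### The pressure equation and the total stress -/

/-- A very weak form of `Δq = ∑ⱼₖ ∂ⱼ∂ₖ Fⱼₖ` in `L²`. -/
structure IsPressure (F : Fin 2 → Fin 2 → Plane → ℝ) (q : Plane → ℝ) : Prop where
  memLp : MemLp q 2
  memLp_stress : ∀ j k, MemLp (F j k) 2
  eq : ∀ φ : Test, ∫ x, q x * lapl φ x = ∑ j, ∑ k, ∫ x, F j k x * pd j (pd k φ) x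

/-- Order 0 suffices because only second derivatives of φ occur. They are O(⟨x⟩⁻²), hence square
integrable in the plane, and the cutoffs keep this bound. The case needed is `potGrad`, which is not
compactly supported. -/
theorem IsPressure.eq_of_isSymbol {F : Fin 2 → Fin 2 → Plane → ℝ} {q : Plane → ℝ}
    (h : IsPressure F q) {φ : Plane → ℝ} (sφ : ContDiff ℝ ∞ φ) (hφ : IsSymbol 2 0 φ) :
    ∫ x, q x * lapl φ x = ∑ j, ∑ k, ∫ x, F j k x * pd j (pd k φ) x := by
  obtain ⟨χ, C, h0, h1, h2, t0, t1, t2⟩ := exists_test_approx sφ hφ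
  have key1 := tendsto_integral_mul (r := 0 - 2) h.memLp (g := fun n => lapl (χ n))
    (G := lapl φ) (C := 2 * C)
    (fun n => (contDiff_lapl (smooth_test (χ n))).continuous) (by norm_num)
    (fun n x => ?_) (fun x => tendsto_finsetSum _ fun j _ => t2 j j x)
  · have key2 : Tendsto (fun n => ∑ j, ∑ k, ∫ x, F j k x * pd j (pd k (χ n)) x) atTop
        (𝓝 (∑ j, ∑ k, ∫ x, F j k x * pd j (pd k φ) x)) :=
      tendsto_finsetSum _ fun j _ => tendsto_finsetSum _ fun k _ =>
        tendsto_integral_mul (r := 0 - 2) (h.memLp_stress j k) (fun n =>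
          (contDiff_pd (contDiff_pd (smooth_test (χ n)) k) j).continuous) (by norm_num)
          (fun n x => h2 j k n x) (fun x => t2 j k x)
    simp only [h.eq] at key1
    exact tendsto_nhds_unique key1 key2
  · have c1 := h2 0 0 n x
    have c2 := h2 1 1 n x
    simp only [lapl, Fin.sum_univ_two]
    refine (abs_add_le _ _).trans ?_
    linarith

theorem lapl_comp_affine {f : Plane → ℝ} (sf : ContDiff ℝ ∞ f) (c : ℝ) (b : Plane) :
    lapl (fun x => f (c • x + b)) = fun x => c ^ 2 * lapl f (c • x + b) := by
  have aff : ContDiff ℝ ∞ fun x : Plane => c • x + b := by fun_prop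
  funext x
  simp only [lapl, Finset.mul_sum]
  refine Finset.sum_congr rfl fun j _ => ?_
  rw [pd_comp_affine (differentiable_of_smooth sf), pd_const_mul
    (f := fun x => pd j f (c • x + b)) (differentiable_of_smooth ((contDiff_pd sf j).comp aff)),
    pd_comp_affine (differentiable_of_smooth (contDiff_pd sf j))]
  ring

theorem pd_pd_comp_affine {f : Plane → ℝ} (sf : ContDiff ℝ ∞ f) (c : ℝ) (b : Plane)
    (j k : Fin 2) : pd j (pd k fun x => f (c • x + b)) =
      fun x => c ^ 2 * pd j (pd k f) (c • x + b) := by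
  have aff : ContDiff ℝ ∞ fun x : Plane => c • x + b := by fun_prop
  funext x
  rw [pd_comp_affine (differentiable_of_smooth sf), pd_const_mul
    (f := fun x => pd k f (c • x + b)) (differentiable_of_smooth ((contDiff_pd sf k).comp aff)),
    pd_comp_affine (differentiable_of_smooth (contDiff_pd sf k))]
  ring

/-- Both sides are of second order, so the same factor c² appears on each and cancels. -/
theorem IsPressure.eq_comp_affine {F : Fin 2 → Fin 2 → Plane → ℝ} {q : Plane → ℝ}
    (h : IsPressure F q) {φ : Plane → ℝ} (sφ : ContDiff ℝ ∞ φ) (hφ : IsSymbol 2 0 φ)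
    {c : ℝ} (hc : c ≠ 0) (b : Plane) :
    ∫ x, q x * lapl φ (c • x + b) = ∑ j, ∑ k, ∫ x, F j k x * pd j (pd k φ) (c • x + b) := by
  have aff : ContDiff ℝ ∞ fun x : Plane => c • x + b := by fun_prop
  have := h.eq_of_isSymbol (sφ.comp aff) (hφ.comp_affine sφ hc b)
  simp only [Function.comp_def, lapl_comp_affine sφ, pd_pd_comp_affine sφ, mul_left_comm _ (c ^ 2),
    integral_const_mul, ← Finset.mul_sum] at this
  exact mul_left_cancel₀ (pow_ne_zero 2 hc) this

/-- The total stress `Fᵢⱼ - q δᵢⱼ`. -/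
def stress (F : Fin 2 → Fin 2 → Plane → ℝ) (q : Plane → ℝ) (i j : Fin 2) (x : Plane) : ℝ :=
  F j i x - (if i = j then 1 else 0) * q x

theorem IsPressure.memLp_total {F : Fin 2 → Fin 2 → Plane → ℝ} {q : Plane → ℝ}
    (h : IsPressure F q) (i j : Fin 2) : MemLp (stress F q i j) 2 :=
  (h.memLp_stress j i).sub (h.memLp.const_mul _)

theorem memLp_two_pd_gauss_comp (j : Fin 2) {c : ℝ} (hc : c ≠ 0) (b : Plane) :
    MemLp (fun x => pd j gauss (c • x + b)) 2 := by
  have aff : Continuous fun x : Plane => c • x + b := by fun_prop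
  exact (((isSymbol_gauss 1 (-2)).pd j).decays.comp_affine hc b).memLp_two
    ((contDiff_pd contDiff_gauss j).continuous.comp aff) (by norm_num)

/-- Pairing the stress `F` with the Oseen kernel amounts to pairing the total stress with the
gradient of the heat kernel. -/
theorem IsPressure.oseen_eq {F : Fin 2 → Fin 2 → Plane → ℝ} {q : Plane → ℝ}
    (h : IsPressure F q) (i : Fin 2) {c : ℝ} (hc : c ≠ 0) (b : Plane) :
    ∑ j, ∑ k, ∫ x, F j k x * oseen i j k (c • x + b) =
      ∑ j, ∫ x, stress F q i j x * pd j gauss (c • x + b) := by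
  have aff : Continuous fun x : Plane => c • x + b := by fun_prop
  -- Testing with `potGrad i` turns the pairing of F with ∂ⱼ∂ₖ∂ᵢΔ⁻¹G into the pairing of q with ∂ᵢG.
  -- This is exactly the pressure part of the total stress.
  have h1 := h.eq_comp_affine (contDiff_potGrad i)
    ((isSymbol_potGrad 2 i).mono (by norm_num)) hc b
  rw [lapl_potGrad] at h1
  have e1 : ∀ j k, ∫ x, F j k x * oseen i j k (c • x + b) =
      (if i = k then 1 else 0) * (∫ x, F j k x * pd j gauss (c • x + b)) -
      ∫ x, F j k x * pd j (pd k (potGrad i)) (c • x + b) := by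
    intro j k
    have i1 : Integrable fun x => F j k x * pd j gauss (c • x + b) :=
      (h.memLp_stress j k).integrable_mul (memLp_two_pd_gauss_comp j hc b)
    have i2 : Integrable fun x => F j k x * pd j (pd k (potGrad i)) (c • x + b) :=
      (h.memLp_stress j k).integrable_mul
        (((((isSymbol_potGrad 2 i).pd k).pd j).decays.comp_affine hc b).memLp_two
          ((contDiff_pd (contDiff_pd (contDiff_potGrad i) k) j).continuous.comp aff)
            (by norm_num))
    rw [← integral_const_mul, ← integral_sub (i1.const_mul _) i2]
    refine integral_congr_ae (ae_of_all _ fun x => ?_)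
    simp only [oseen]
    ring
  have e2 : ∀ j, ∫ x, stress F q i j x * pd j gauss (c • x + b) =
      (∫ x, F j i x * pd j gauss (c • x + b)) -
      (if i = j then 1 else 0) * ∫ x, q x * pd j gauss (c • x + b) := by
    intro j
    rw [← integral_const_mul, ← integral_sub]
    · refine integral_congr_ae (ae_of_all _ fun x => ?_)
      simp only [stress]
      ring
    · exact (h.memLp_stress j i).integrable_mul (memLp_two_pd_gauss_comp j hc b)
    · exact (h.memLp.integrable_mul (memLp_two_pd_gauss_comp j hc b)).const_mul _
  simp only [e1, e2, Finset.sum_sub_distrib, ← h1]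
  simp

/-- Pairing the total stress with the Hessian of a heat kernel gives zero. -/
theorem IsPressure.hessian_eq_zero {F : Fin 2 → Fin 2 → Plane → ℝ} {q : Plane → ℝ}
    (h : IsPressure F q) {c : ℝ} (hc : c ≠ 0) (b : Plane) :
    ∑ i, ∑ j, ∫ x, stress F q i j x * pd i (pd j gauss) (c • x + b) = 0 := by
  have aff : Continuous fun x : Plane => c • x + b := by fun_prop
  have h1 := h.eq_comp_affine contDiff_gauss (isSymbol_gauss 2 0) hc b
  have m : ∀ i j, MemLp (fun x => pd i (pd j gauss) (c • x + b)) 2 := fun i j =>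
    ((((isSymbol_gauss 2 0).pd j).pd i).decays.comp_affine hc b).memLp_two
      ((contDiff_pd (contDiff_pd contDiff_gauss j) i).continuous.comp aff) (by norm_num)
  have e2 : ∀ i j, ∫ x, stress F q i j x * pd i (pd j gauss) (c • x + b) =
      (∫ x, F j i x * pd j (pd i gauss) (c • x + b)) -
      (if i = j then 1 else 0) * ∫ x, q x * pd i (pd j gauss) (c • x + b) := by
    intro i j
    rw [pd_comm contDiff_gauss j i, ← integral_const_mul, ← integral_sub]
    · refine integral_congr_ae (ae_of_all _ fun x => ?_)
      simp only [stress]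
      ring
    · exact (h.memLp_stress j i).integrable_mul (m i j)
    · exact (h.memLp.integrable_mul (m i j)).const_mul _
  have e3 : ∫ x, q x * lapl gauss (c • x + b) =
      ∑ j, ∫ x, q x * pd j (pd j gauss) (c • x + b) := by
    simp only [lapl, Finset.mul_sum]
    exact integral_finsetSum _ fun j _ => h.memLp.integrable_mul (m j j)
  simp only [e2, Finset.sum_sub_distrib]
  rw [Finset.sum_comm, ← h1, e3]
  simp

/-! ### Existence of the pressure -/

/-- A linear functional bounded by `‖Λ v‖` is represented as `⟪q, Λ v⟫`. -/
theorem exists_inner_eq_of_le {E V : Type*} [NormedAddCommGroup E] [InnerProductSpace ℝ E]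
    [CompleteSpace E] [AddCommGroup V] [Module ℝ V] (Λ : V →ₗ[ℝ] E) (ℓ : V →ₗ[ℝ] ℝ) (C : ℝ)
    (h : ∀ v, |ℓ v| ≤ C * ‖Λ v‖) : ∃ q : E, ∀ v, ℓ v = inner ℝ q (Λ v) := by
  have hker : LinearMap.ker Λ ≤ LinearMap.ker ℓ := fun v hv => by
    have := h v
    rw [LinearMap.mem_ker.1 hv, norm_zero, mul_zero] at this
    exact LinearMap.mem_ker.2 (abs_nonpos_iff.1 this)
  let f : LinearMap.range Λ →ₗ[ℝ] ℝ :=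
    ((LinearMap.ker Λ).liftQ ℓ hker).comp Λ.quotKerEquivRange.symm.toLinearMap
  have hf : ∀ v, f ⟨Λ v, LinearMap.mem_range_self Λ v⟩ = ℓ v := fun v => by
    have : Λ.quotKerEquivRange.symm ⟨Λ v, LinearMap.mem_range_self Λ v⟩ =
        (LinearMap.ker Λ).mkQ v := by
      rw [LinearEquiv.symm_apply_eq]; rfl
    simp [f, this]
  let g : StrongDual ℝ (LinearMap.range Λ) := f.mkContinuous C (by
    rintro ⟨_, v, rfl⟩
    rw [hf]
    exact h v)
  -- The range of Λ need not be closed, so the functional is extended by Hahn–Banach to the whole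
  -- Hilbert space before it is represented.
  obtain ⟨G, hG, -⟩ := exists_extension_norm_eq (LinearMap.range Λ) g
  refine ⟨(InnerProductSpace.toDual ℝ E).symm G, fun v => ?_⟩
  rw [InnerProductSpace.toDual_symm_apply, ← hf v]
  exact (hG ⟨Λ v, LinearMap.mem_range_self Λ v⟩).symm

theorem memLp_two_test (φ : Test) : MemLp φ 2 :=
  φ.continuous.memLp_of_hasCompactSupport φ.hasCompactSupport

/-- The inclusion of the test functions in `L²`. -/
def testToL2 : Test →ₗ[ℝ] Lp ℝ 2 (volume : Measure Plane) where
  toFun φ := (memLp_two_test φ).toLp φ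
  map_add' _ _ := rfl
  map_smul' _ _ := rfl

theorem inner_toLp_toLp {f g : Plane → ℝ} (hf : MemLp f 2) (hg : MemLp g 2) :
    inner ℝ (hf.toLp f) (hg.toLp g) = ∫ x, f x * g x := by
  rw [L2.inner_def]
  refine integral_congr_ae ?_
  filter_upwards [hf.coeFn_toLp, hg.coeFn_toLp] with x h1 h2
  rw [h1, h2]
  simp [mul_comm]

theorem inner_testToL2 {f : Plane → ℝ} (hf : MemLp f 2) (φ : Test) :
    inner ℝ (hf.toLp f) (testToL2 φ) = ∫ x, f x * φ x :=
  inner_toLp_toLp hf (memLp_two_test φ)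

theorem norm_testToL2_sq (φ : Test) : ‖testToL2 φ‖ ^ 2 = ∫ x, φ x * φ x := by
  rw [← real_inner_self_eq_norm_sq]
  exact inner_testToL2 (memLp_two_test φ) φ

/-- The line derivative on test functions, as a linear map. -/
def testDeriv (j : Fin 2) : Test →ₗ[ℝ] Test :=
  (LineDeriv.lineDerivOpCLM ℝ Test (stdVec j) : Test →L[ℝ] Test)

theorem testDeriv_coe (j : Fin 2) (φ : Test) : ⇑(testDeriv j φ) = pd j φ := coe_lineDeriv_test φ j

/-- The Laplacian on test functions, as a linear map. -/
def testLap : Test →ₗ[ℝ] Test := ∑ j, testDeriv j ∘ₗ testDeriv j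

theorem testLap_coe (φ : Test) : ⇑(testLap φ) = lapl φ := by
  funext x
  have : testLap φ = testDeriv 0 (testDeriv 0 φ) + testDeriv 1 (testDeriv 1 φ) := by
    simp [testLap, Fin.sum_univ_two]
  rw [this]
  change testDeriv 0 (testDeriv 0 φ) x + testDeriv 1 (testDeriv 1 φ) x = _
  simp only [testDeriv_coe, lapl, Fin.sum_univ_two]

/-- Two integrations by parts give ∫ φ₀₀ φ₁₁ = ∫ φ₀₁². Hence ‖Δφ‖² in L² is the sum of the squared
norms of all four second derivatives. -/
theorem integral_hessian_sq_le (φ : Test) (j k : Fin 2) :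
    ∫ x, pd j (pd k φ) x * pd j (pd k φ) x ≤ ∫ x, lapl φ x * lapl φ x := by
  have s := smooth_test φ
  have hc := φ.hasCompactSupport
  have s1 := fun j => contDiff_pd s j
  have s2 := fun j k => contDiff_pd (s1 k) j
  have c1 := fun j => hasCompactSupport_pd hc j
  have c2 := fun j k => hasCompactSupport_pd (c1 k) j
  have hi : ∀ i j k l : Fin 2, Integrable fun x => pd i (pd j φ) x * pd k (pd l φ) x :=
    fun i j k l => ((s2 i j).continuous.mul (s2 k l).continuous).integrable_of_hasCompactSupport
      (c2 i j).mul_right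
  have e1 : ∫ x, pd 0 (pd 0 φ) x * pd 1 (pd 1 φ) x = ∫ x, pd 0 (pd 1 φ) x * pd 0 (pd 1 φ) x := by
    rw [integral_mul_pd (s2 0 0) (s1 1) (c1 1) 1, pd_comm (s1 0) 1 0, pd_comm s 1 0]
    have := integral_mul_pd (s1 1) (s2 0 1) (c2 0 1) 0
    simp only [mul_comm (pd 0 (pd 0 (pd 1 φ)) _)]
    rw [this, neg_neg]
  have e2 : ∫ x, lapl φ x * lapl φ x = (∫ x, pd 0 (pd 0 φ) x * pd 0 (pd 0 φ) x) +
      (∫ x, pd 1 (pd 1 φ) x * pd 1 (pd 1 φ) x) +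
      2 * ∫ x, pd 0 (pd 1 φ) x * pd 0 (pd 1 φ) x := by
    rw [← e1, ← integral_const_mul, ← integral_add (hi 0 0 0 0) (hi 1 1 1 1), ← integral_add
      (f := fun x => pd 0 (pd 0 φ) x * pd 0 (pd 0 φ) x + pd 1 (pd 1 φ) x * pd 1 (pd 1 φ) x)
      ((hi 0 0 0 0).add (hi 1 1 1 1)) ((hi 0 0 1 1).const_mul 2)]
    refine integral_congr_ae (ae_of_all _ fun x => ?_)
    simp only [lapl, Fin.sum_univ_two]
    ring
  have n0 : 0 ≤ ∫ x, pd 0 (pd 0 φ) x * pd 0 (pd 0 φ) x :=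
    integral_nonneg fun x => mul_self_nonneg _
  have n1 : 0 ≤ ∫ x, pd 1 (pd 1 φ) x * pd 1 (pd 1 φ) x :=
    integral_nonneg fun x => mul_self_nonneg _
  have n2 : 0 ≤ ∫ x, pd 0 (pd 1 φ) x * pd 0 (pd 1 φ) x :=
    integral_nonneg fun x => mul_self_nonneg _
  have hs : pd 1 (pd 0 φ) = pd 0 (pd 1 φ) := pd_comm s 1 0
  rw [e2]
  fin_cases j <;> fin_cases k <;> simp only [Fin.zero_eta, Fin.mk_one, hs] <;> linarith

/-- The Hessian estimate bounds φ ↦ ∑ ∫ Fⱼₖ ∂ⱼ∂ₖφ by a multiple of ‖Δφ‖ in L², so the functional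
factors through Δφ and is represented there by some q in L². -/
theorem exists_isPressure {F : Fin 2 → Fin 2 → Plane → ℝ} (hF : ∀ j k, MemLp (F j k) 2) :
    ∃ q, IsPressure F q := by
  let ℓ : Test →ₗ[ℝ] ℝ := ∑ j, ∑ k, (innerSL ℝ ((hF j k).toLp (F j k))).toLinearMap ∘ₗ
    testToL2 ∘ₗ testDeriv j ∘ₗ testDeriv k
  have hℓ : ∀ φ, ℓ φ = ∑ j, ∑ k,
      inner ℝ ((hF j k).toLp (F j k)) (testToL2 (testDeriv j (testDeriv k φ))) := fun φ => by
    simp [ℓ]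
  have hℓ' : ∀ φ, ℓ φ = ∑ j, ∑ k, ∫ x, F j k x * pd j (pd k φ) x := fun φ => by
    rw [hℓ]
    simp only [inner_testToL2, testDeriv_coe]
  have hn : ∀ j k φ, ‖testToL2 (testDeriv j (testDeriv k φ))‖ ≤ ‖testToL2 (testLap φ)‖ := by
    intro j k φ
    refine abs_le_of_sq_le_sq' ?_ (norm_nonneg _) |>.2
    rw [norm_testToL2_sq, norm_testToL2_sq, testLap_coe, testDeriv_coe, testDeriv_coe]
    exact integral_hessian_sq_le φ j k
  obtain ⟨q, hq⟩ := exists_inner_eq_of_le (testToL2 ∘ₗ testLap) ℓ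
    (∑ j, ∑ k, ‖(hF j k).toLp (F j k)‖) (fun φ => by
      rw [hℓ, Finset.sum_mul]
      refine (Finset.abs_sum_le_sum_abs _ _).trans (Finset.sum_le_sum fun j _ => ?_)
      rw [Finset.sum_mul]
      refine (Finset.abs_sum_le_sum_abs _ _).trans (Finset.sum_le_sum fun k _ => ?_)
      exact (abs_real_inner_le_norm _ _).trans
        (mul_le_mul_of_nonneg_left (hn j k φ) (norm_nonneg _)))
  refine ⟨q, Lp.memLp q, hF, fun φ => ?_⟩
  rw [← hℓ', hq, ← testLap_coe]
  have := inner_testToL2 (Lp.memLp q) (testLap φ)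
  rw [Lp.toLp_coeFn] at this
  exact this.symm

/-! ### Mollification by Gaussians -/

theorem integral_gauss : ∫ x, gauss x = 1 := by
  have h := GaussianFourier.integral_rexp_neg_mul_sq_norm (V := Plane) (b := 1 / 4) (by norm_num)
  have e : ∀ x : Plane, gauss x = (4 * Real.pi)⁻¹ * Real.exp (-(1 / 4) * ‖x‖ ^ 2) := fun x => by
    rw [gauss]; ring_nf
  simp only [e, integral_const_mul]
  rw [h]
  have hpi := Real.pi_pos
  simp
  field_simp

theorem integrable_gauss : Integrable gauss :=
  (decays_gauss (-3)).integrable contDiff_gauss.continuous (by norm_num)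

theorem bracket_neg (x : Plane) : bracket (-x) = bracket x := by simp [bracket]

/-- Peetre's inequality for negative powers. -/
theorem bracket_add_rpow_neg_le (x y : Plane) {r : ℝ} (hr : 0 ≤ r) :
    bracket (x + y) ^ (-r) ≤ 2 ^ r * bracket x ^ (-r) * bracket y ^ r := by
  have h : bracket x ≤ 2 * bracket (x + y) * bracket y := by
    have := bracket_add_le (x + y) (-y)
    rwa [add_neg_cancel_right, bracket_neg] at this
  have px := bracket_pos x
  have py := bracket_pos y
  have pxy := bracket_pos (x + y)
  have h2 := Real.rpow_le_rpow px.le h hr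
  rw [Real.mul_rpow (by positivity) py.le, Real.mul_rpow zero_le_two pxy.le] at h2
  rw [Real.rpow_neg pxy.le, Real.rpow_neg px.le, inv_le_iff_one_le_mul₀ (bracket_rpow_pos _ _)]
  have := bracket_rpow_pos x r
  calc (1 : ℝ) = bracket x ^ r * (bracket x ^ r)⁻¹ := (mul_inv_cancel₀ this.ne').symm
    _ ≤ (2 ^ r * bracket (x + y) ^ r * bracket y ^ r) * (bracket x ^ r)⁻¹ := by gcongr
    _ = _ := by ring

theorem bracket_smul_le {r : ℝ} (h0 : 0 ≤ r) (h1 : r ≤ 1) (x : Plane) :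
    bracket (r • x) ≤ bracket x := by
  refine Real.sqrt_le_sqrt ?_
  rw [norm_smul, mul_pow, Real.norm_eq_abs, sq_abs]
  nlinarith [sq_nonneg ‖x‖, mul_nonneg h0 (sub_nonneg.2 h1)]

/-- The Gaussian mean `∫ G(w) ψ(x + r w) dw`. -/
def mollify (r : ℝ) (ψ : Plane → ℝ) (x : Plane) : ℝ := ∫ w, gauss w * ψ (x + r • w)

theorem mollify_zero (ψ : Plane → ℝ) (x : Plane) : mollify 0 ψ x = ψ x := by
  simp [mollify, integral_mul_const, integral_gauss]

/-- The scale r = 0 is included, where the mean is ψ itself. This covers both the limit of vanishing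
scale and the endpoint s = 1 of the flow. -/
theorem continuous_mollify {ψ : Plane → ℝ} (hψ : Continuous ψ) (hb : Decays 0 ψ) :
    Continuous fun p : ℝ × Plane => mollify p.1 ψ p.2 := by
  obtain ⟨C, hC⟩ := hb
  refine continuous_of_dominated (bound := fun w => gauss w * C) (fun p => ?_)
    (fun p => ae_of_all _ fun w => ?_) (integrable_gauss.mul_const C) (ae_of_all _ fun w => ?_)
  · exact (contDiff_gauss.continuous.mul (hψ.comp (by fun_prop))).aestronglyMeasurable
  · rw [Real.norm_eq_abs, abs_mul, abs_of_pos (gauss_pos w)]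
    refine mul_le_mul_of_nonneg_left ?_ (gauss_pos w).le
    simpa using hC (p.2 + p.1 • w)
  · exact continuous_const.mul (hψ.comp (by fun_prop))

/-- A shift by r w with r ≤ 1 costs at most a factor ⟨w⟩^a by Peetre's inequality, and the Gaussian
absorbs it. The constant is therefore uniform in the scale. -/
theorem exists_mollify_le {ψ : Plane → ℝ} {a : ℝ} (ha : 0 ≤ a) (hψ : Decays (-a) ψ) :
    ∃ C, 0 < C ∧ ∀ r, 0 ≤ r → r ≤ 1 → ∀ x, |mollify r ψ x| ≤ C * bracket x ^ (-a) := by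
  obtain ⟨C, hC0, hC⟩ := hψ.exists_pos
  have hi : Integrable fun w => gauss w * bracket w ^ a := by
    refine Decays.integrable (a := -3 - a + a) ?_
      (contDiff_gauss.continuous.mul (continuous_bracket_rpow a)) (by linarith)
    exact (decays_gauss (-3 - a)).mul ⟨1, fun x => by
      rw [one_mul, abs_of_pos (bracket_rpow_pos x a)]⟩
  refine ⟨C * 2 ^ a * ((∫ w : Plane, gauss w * bracket w ^ a) + 1), ?_, fun r h0 h1 x => ?_⟩
  · have : 0 ≤ ∫ w, gauss w * bracket w ^ a :=
      integral_nonneg fun w => mul_nonneg (gauss_pos w).le (bracket_rpow_pos w a).le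
    positivity
  · have h2 : |mollify r ψ x| ≤ ∫ w, (C * 2 ^ a * bracket x ^ (-a)) * (gauss w * bracket w ^ a) := by
      rw [← Real.norm_eq_abs, mollify]
      refine norm_integral_le_of_norm_le (hi.const_mul _) (ae_of_all _ fun w => ?_)
      rw [Real.norm_eq_abs, abs_mul, abs_of_pos (gauss_pos w)]
      have h3 : bracket (x + r • w) ^ (-a) ≤ 2 ^ a * bracket x ^ (-a) * bracket w ^ a :=
        (bracket_add_rpow_neg_le x (r • w) ha).trans (by
          have := Real.rpow_le_rpow (bracket_pos _).le (bracket_smul_le h0 h1 w) ha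
          have := (bracket_rpow_pos x (-a)).le
          gcongr)
      calc gauss w * |ψ (x + r • w)|
          ≤ gauss w * (C * (2 ^ a * bracket x ^ (-a) * bracket w ^ a)) :=
            mul_le_mul_of_nonneg_left ((hC _).trans (mul_le_mul_of_nonneg_left h3 hC0.le))
              (gauss_pos w).le
        _ = _ := by ring
    rw [integral_const_mul] at h2
    refine h2.trans ?_
    have : 0 ≤ C * 2 ^ a * bracket x ^ (-a) := by
      have := (bracket_rpow_pos x (-a)).le; positivity
    nlinarith

/-- Change of variables `y = x + r w`. -/
theorem integral_comp_scaled (f : Plane → ℝ) {r : ℝ} (hr : 0 < r) (x : Plane) :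
    ∫ y : Plane, f (r⁻¹ • (y - x)) = r ^ 2 * ∫ w, f w := by
  rw [integral_sub_right_eq_self (fun y : Plane => f (r⁻¹ • y)) x, Measure.integral_comp_smul]
  simp [abs_of_pos hr]

theorem integral_gauss_scaled_mul (ψ : Plane → ℝ) {r : ℝ} (hr : 0 < r) (x : Plane) :
    ∫ y, gauss (r⁻¹ • (y - x)) * ψ y = r ^ 2 * mollify r ψ x := by
  rw [mollify, ← integral_comp_scaled _ hr x]
  refine integral_congr_ae (ae_of_all _ fun y => ?_)
  simp only [smul_smul, mul_inv_cancel₀ hr.ne', one_smul, add_sub_cancel]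

theorem gauss_neg (x : Plane) : gauss (-x) = gauss x := by simp [gauss]

/-- A square integrable function that is orthogonal to all Gaussians vanishes. -/
theorem ae_eq_zero_of_gauss {f : Plane → ℝ} (hf : MemLp f 2)
    (h : ∀ r : ℝ, 0 < r → ∀ x : Plane, ∫ z, f z * gauss (r⁻¹ • (z - x)) = 0) :
    f =ᵐ[volume] 0 := by
  refine ae_eq_zero_of_integral_contDiff_smul_eq_zero
    (hf.locallyIntegrable (by norm_num)) fun ψ sψ cψ => ?_
  have hd : ∀ a, Decays a ψ := fun a => decays_of_hasCompactSupport sψ.continuous cψ a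
  -- Fubini moves the averaging from f to ψ; evenness of the Gaussian makes the averaged function a
  -- Gaussian mean of ψ, which tends to ψ as r → 0.
  have key : ∀ r : ℝ, 0 < r → ∫ z, f z * mollify r ψ z = 0 := by
    intro r hr
    have hm : Integrable (Function.uncurry fun x z : Plane =>
        ψ x * (f z * gauss (r⁻¹ • (z - x)))) (volume.prod volume) := by
      obtain ⟨C, hC0, hC⟩ := ((decays_gauss (-2)).comp_affine (inv_pos.2 hr).ne' 0).exists_pos
      have i1 : Integrable fun x : Plane => |ψ x| * bracket x ^ (2 : ℝ) :=
        (sψ.continuous.abs.mul (continuous_bracket_rpow 2)).integrable_of_hasCompactSupport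
          cψ.norm.mul_right
      have i2 : Integrable fun z : Plane => |f z| * bracket z ^ (-2 : ℝ) :=
        hf.abs.integrable_mul (memLp_two_bracket_rpow (by norm_num))
      refine ((i1.mul_prod i2).const_mul (C * 2 ^ (2 : ℝ))).mono' ?_ (ae_of_all _ fun p => ?_)
      · refine (sψ.continuous.comp continuous_fst).aestronglyMeasurable.mul
          ((hf.1.comp_snd).mul ?_)
        exact (contDiff_gauss.continuous.comp (by fun_prop)).aestronglyMeasurable
      · have h1 := hC (p.2 - p.1)
        rw [add_zero, abs_of_pos (gauss_pos _)] at h1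
        have h2 : bracket (p.2 - p.1) ^ (-2 : ℝ) ≤
            2 ^ (2 : ℝ) * bracket p.2 ^ (-2 : ℝ) * bracket p.1 ^ (2 : ℝ) := by
          have := bracket_add_rpow_neg_le p.2 (-p.1) (r := 2) (by norm_num)
          rwa [← sub_eq_add_neg, bracket_neg] at this
        simp only [Function.uncurry, norm_mul, Real.norm_eq_abs, abs_of_pos (gauss_pos _)]
        calc |ψ p.1| * (|f p.2| * gauss (r⁻¹ • (p.2 - p.1)))
            ≤ |ψ p.1| * (|f p.2| *
              (C * (2 ^ (2 : ℝ) * bracket p.2 ^ (-2 : ℝ) * bracket p.1 ^ (2 : ℝ)))) := by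
              gcongr
              exact h1.trans (mul_le_mul_of_nonneg_left h2 hC0.le)
          _ = _ := by ring
    have h0 : ∫ x, ∫ z, ψ x * (f z * gauss (r⁻¹ • (z - x))) = 0 := by
      simp only [integral_const_mul, h r hr, mul_zero, integral_zero]
    rw [integral_integral_swap hm] at h0
    have e : ∀ z, ∫ x, ψ x * (f z * gauss (r⁻¹ • (z - x))) = r ^ 2 * (f z * mollify r ψ z) := by
      intro z
      rw [mul_left_comm, ← integral_gauss_scaled_mul ψ hr z, ← integral_const_mul]
      refine integral_congr_ae (ae_of_all _ fun x => ?_)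
      simp only
      rw [← gauss_neg, ← smul_neg, neg_sub]
      ring
    simp only [e, integral_const_mul] at h0
    exact (mul_eq_zero.1 h0).resolve_left (by positivity)
  obtain ⟨C, hC0, hC⟩ := exists_mollify_le (a := 2) (by norm_num) (hd _)
  have hcont := continuous_mollify sψ.continuous (hd 0)
  have rt : Tendsto (fun n : ℕ => ((n : ℝ) + 1)⁻¹) atTop (𝓝 0) := by
    simpa [one_div] using tendsto_one_div_add_atTop_nhds_zero_nat (𝕜 := ℝ)
  have lim := tendsto_integral_mul hf (g := fun n : ℕ => mollify ((n : ℝ) + 1)⁻¹ ψ) (G := ψ)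
    (C := C) (r := -2) (fun n => hcont.comp (continuous_const.prodMk continuous_id)) (by norm_num)
    (fun n x => hC _ (by positivity) (inv_le_one_of_one_le₀ (by
      have : (0 : ℝ) ≤ n := Nat.cast_nonneg n
      linarith)) x)
    (fun x => by
      have := (hcont.tendsto (0, x)).comp (rt.prodMk_nhds (tendsto_const_nhds (x := x)))
      simpa only [mollify_zero, Function.comp_def] using this)
  have hz : ∀ n : ℕ, ∫ x, f x * mollify ((n : ℝ) + 1)⁻¹ ψ x = 0 := fun n => key _ (by positivity)
  simp only [hz] at lim
  simpa only [smul_eq_mul, mul_comm] using (tendsto_nhds_unique lim tendsto_const_nhds)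

/-! ### Families of Gaussians -/

theorem inner_eq_sum (u v : Plane) : inner ℝ u v = ∑ j, u j * v j := by
  simp [PiLp.inner_apply, mul_comm]

theorem lapl_gauss : lapl gauss = fun x => (‖x‖ ^ 2 / 4 - 1) * gauss x := by
  funext x
  have hn : ‖x‖ ^ 2 = x 0 ^ 2 + x 1 ^ 2 := by
    rw [EuclideanSpace.norm_sq_eq, Fin.sum_univ_two]; simp
  have d := differentiable_of_smooth contDiff_gauss
  simp only [lapl, pd_gauss, Fin.sum_univ_two]
  rw [pd_const_mul (f := fun x => x 0 * gauss x) ((differentiable_coord 0).mul d),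
    pd_const_mul (f := fun x => x 1 * gauss x) ((differentiable_coord 1).mul d),
    pd_mul (differentiable_coord 0) d, pd_mul (differentiable_coord 1) d]
  simp only [pd_coord, pd_gauss, if_true, hn]
  ring

theorem lerayAdj_gauss_affine (A c : ℝ) (b z : Plane) :
    lerayAdj (fun z => A * gauss (c • z + b)) z =
      A * (c ^ 2 * (‖c • z + b‖ ^ 2 / 4 - 1) - 1 / 2 + 1 / 4 * c * inner ℝ (c • z + b) z) *
        gauss (c • z + b) := by
  have aff : ContDiff ℝ ∞ fun x : Plane => c • x + b := by fun_prop
  have s : ContDiff ℝ ∞ fun z : Plane => gauss (c • z + b) := contDiff_gauss.comp aff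
  have e1 : ∀ j, pd j (fun z => A * gauss (c • z + b)) = fun z =>
      A * (c * ((-1 / 2) * ((c • z + b) j * gauss (c • z + b)))) := fun j => by
    rw [pd_const_mul (differentiable_of_smooth s),
      pd_comp_affine (differentiable_of_smooth contDiff_gauss), pd_gauss]
  have e2 : lapl (fun z => A * gauss (c • z + b)) z = A * lapl (fun z => gauss (c • z + b)) z := by
    simp only [lapl, Finset.mul_sum]
    refine Finset.sum_congr rfl fun j _ => ?_
    rw [pd_const_mul (differentiable_of_smooth s),
      pd_const_mul (differentiable_of_smooth (contDiff_pd s j))]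
  rw [lerayAdj, e2, lapl_comp_affine contDiff_gauss, lapl_gauss, inner_eq_sum]
  simp only [e1, Fin.sum_univ_two]
  ring

theorem hasDerivAt_gauss_affine {A c : ℝ → ℝ} {b : ℝ → Plane} {A' c' : ℝ} {b' : Plane} {s : ℝ}
    (hA : HasDerivAt A A' s) (hc : HasDerivAt c c' s) (hb : HasDerivAt b b' s) (z : Plane) :
    HasDerivAt (fun s => A s * gauss (c s • z + b s))
      ((A' - 1 / 2 * A s * inner ℝ (c s • z + b s) (c' • z + b')) * gauss (c s • z + b s)) s := by
  have hu : HasDerivAt (fun s => c s • z + b s) (c' • z + b') s := (hc.smul_const z).add hb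
  have hg := ((hasFDerivAt_norm_sq_div (c s • z + b s)).neg.exp).const_mul (4 * Real.pi)⁻¹
  have h := hA.mul (hg.comp_hasDerivAt s hu)
  refine h.congr_deriv ?_
  simp only [Function.comp_apply, gauss, _root_.smul_apply,
    _root_.neg_apply, innerSL_apply_apply, smul_eq_mul, Pi.neg_apply]
  ring

theorem bracket_le_affine {c₀ B c : ℝ} (h0 : 0 < c₀) (hc : c₀ ≤ |c|) {b : Plane} (hb : ‖b‖ ≤ B)
    (z : Plane) : bracket z ≤ (1 + (1 + B) / c₀) * bracket (c • z + b) := by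
  have hB : 0 ≤ B := (norm_nonneg b).trans hb
  have h1 := bracket_le_one_add_norm z
  have h2 : c₀ * ‖z‖ ≤ bracket (c • z + b) + B := by
    calc c₀ * ‖z‖ ≤ |c| * ‖z‖ := by gcongr
      _ = ‖c • z + b - b‖ := by rw [add_sub_cancel_right, norm_smul, Real.norm_eq_abs]
      _ ≤ ‖c • z + b‖ + ‖b‖ := norm_sub_le _ _
      _ ≤ _ := add_le_add (norm_le_bracket _) hb
  have h3 := one_le_bracket (c • z + b)
  have h4 : ‖z‖ ≤ ((1 + B) * bracket (c • z + b)) / c₀ := by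
    rw [le_div_iff₀ h0]
    nlinarith
  rw [add_mul, one_mul, div_mul_eq_mul_div]
  linarith

/-- Differentiation of the pairing with a `C¹` family of Gaussians. -/
theorem hasDerivAt_integral_gauss {f : Plane → ℝ} (hf : MemLp f 2) {A c : ℝ → ℝ} {b : ℝ → Plane}
    {A' c' : ℝ → ℝ} {b' : ℝ → Plane} {s₀ : ℝ} (hA : ∀ᶠ s in 𝓝 s₀, HasDerivAt A (A' s) s)
    (hc : ∀ᶠ s in 𝓝 s₀, HasDerivAt c (c' s) s) (hb : ∀ᶠ s in 𝓝 s₀, HasDerivAt b (b' s) s)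
    (hA' : ContinuousAt A' s₀) (hc' : ContinuousAt c' s₀) (hb' : ContinuousAt b' s₀)
    (hc0 : c s₀ ≠ 0) :
    HasDerivAt (fun s => ∫ z, f z * (A s * gauss (c s • z + b s)))
      (∫ z, f z * ((A' s₀ - 1 / 2 * A s₀ * inner ℝ (c s₀ • z + b s₀) (c' s₀ • z + b' s₀)) *
        gauss (c s₀ • z + b s₀))) s₀ := by
  have hcont : ∀ {E : Type} [NormedAddCommGroup E] {g : ℝ → E}, ContinuousAt g s₀ →
      ∃ M, 0 < M ∧ ∀ᶠ s in 𝓝 s₀, ‖g s‖ ≤ M := fun {E} _ {g} hg =>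
    ⟨‖g s₀‖ + 1, by positivity,
      (hg.norm.eventually_lt_const (by linarith : ‖g s₀‖ < ‖g s₀‖ + 1)).mono fun s h => h.le⟩
  obtain ⟨M1, p1, m1⟩ := hcont hA'
  obtain ⟨M2, p2, m2⟩ := hcont hc'
  obtain ⟨M3, p3, m3⟩ := hcont hb'
  obtain ⟨M4, p4, m4⟩ := hcont hA.self_of_nhds.continuousAt
  obtain ⟨M5, p5, m5⟩ := hcont hb.self_of_nhds.continuousAt
  have hc1 : ∀ᶠ s in 𝓝 s₀, |c s₀| / 2 ≤ |c s| :=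
    (hc.self_of_nhds.continuousAt.abs.eventually_const_lt
      (half_lt_self (abs_pos.2 hc0))).mono fun s h => h.le
  set E := 1 + (1 + M5) / (|c s₀| / 2) with hE
  have hc2 : 0 < |c s₀| / 2 := half_pos (abs_pos.2 hc0)
  have hE1 : 1 ≤ E := by
    have : 0 ≤ (1 + M5) / (|c s₀| / 2) := by positivity
    linarith
  -- Order −4: the coefficient produced by differentiation grows like ⟨u⟩², and order −2 has to
  -- remain for the pairing with an L² function.
  obtain ⟨C, hC0, hC⟩ := (decays_gauss (-4)).exists_pos
  set K := M1 + 1 / 2 * M4 * (M2 * E + M3) with hK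
  have hK0 : 0 ≤ K := by positivity
  obtain ⟨ε, hε, hball⟩ := Metric.eventually_nhds_iff_ball.1
    (hA.and (hc.and (hb.and (m1.and (m2.and (m3.and (m4.and (m5.and hc1))))))))
  have gcont : ∀ s, Continuous fun z : Plane => gauss (c s • z + b s) := fun s =>
    contDiff_gauss.continuous.comp (by fun_prop)
  refine (hasDerivAt_integral_of_dominated_loc_of_deriv_le (μ := volume)
    (F := fun s z => f z * (A s * gauss (c s • z + b s)))
    (F' := fun s z => f z * ((A' s - 1 / 2 * A s * inner ℝ (c s • z + b s) (c' s • z + b' s)) *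
        gauss (c s • z + b s)))
    (bound := fun z => |f z| * (K * C * E ^ (2 : ℝ) * bracket z ^ (-2 : ℝ)))
    (Metric.ball_mem_nhds s₀ hε) (Eventually.of_forall fun s =>
      hf.1.mul ((gcont s).const_mul _).aestronglyMeasurable) ?_ ?_
    (ae_of_all _ fun z s hs => ?_) ?_ (ae_of_all _ fun z s hs => ?_)).2
  · refine hf.integrable_mul (q := 2)
      (MemLp.const_mul (f := fun z => gauss (c s₀ • z + b s₀)) ?_ (A s₀))
    exact ((decays_gauss (-2)).comp_affine hc0 (b s₀)).memLp_two (gcont s₀) (by norm_num)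
  · exact hf.1.mul ((Continuous.mul (by fun_prop) (gcont s₀)).aestronglyMeasurable)
  · obtain ⟨-, -, -, k1, k2, k3, k4, k5, k6⟩ := hball s hs
    simp only [Real.norm_eq_abs] at k1 k2 k4
    rw [Real.norm_eq_abs, abs_mul]
    refine mul_le_mul_of_nonneg_left ?_ (abs_nonneg _)
    set u := c s • z + b s with hu
    have hz : bracket z ≤ E * bracket u := bracket_le_affine hc2 k6 k5 z
    have hu1 := one_le_bracket u
    have hin : |inner ℝ u (c' s • z + b' s)| ≤ (M2 * E + M3) * bracket u ^ 2 := by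
      refine (abs_real_inner_le_norm _ _).trans ?_
      have h1 : ‖c' s • z + b' s‖ ≤ (M2 * E + M3) * bracket u := by
        calc ‖c' s • z + b' s‖ ≤ |c' s| * ‖z‖ + ‖b' s‖ := by
              rw [← Real.norm_eq_abs, ← norm_smul]; exact norm_add_le _ _
          _ ≤ M2 * (E * bracket u) + M3 * bracket u := by
              refine add_le_add (mul_le_mul k2 ((norm_le_bracket z).trans hz) (norm_nonneg _)
                p2.le) ?_
              nlinarith
          _ = _ := by ring
      calc ‖u‖ * ‖c' s • z + b' s‖ ≤ bracket u * ((M2 * E + M3) * bracket u) :=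
            mul_le_mul (norm_le_bracket u) h1 (norm_nonneg _) (bracket_pos u).le
        _ = _ := by ring
    have hco : |A' s - 1 / 2 * A s * inner ℝ u (c' s • z + b' s)| ≤ K * bracket u ^ 2 := by
      refine (abs_sub _ _).trans ?_
      rw [abs_mul, abs_mul, abs_of_pos (by norm_num : (0 : ℝ) < 1 / 2)]
      have h2 : M1 ≤ M1 * bracket u ^ 2 := le_mul_of_one_le_right p1.le (one_le_pow₀ hu1)
      have h3 : 1 / 2 * |A s| * |inner ℝ u (c' s • z + b' s)| ≤
          1 / 2 * M4 * ((M2 * E + M3) * bracket u ^ 2) := by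
        gcongr
      calc _ ≤ M1 * bracket u ^ 2 + 1 / 2 * M4 * ((M2 * E + M3) * bracket u ^ 2) :=
            add_le_add (k1.trans h2) h3
        _ = _ := by ring
    have hg := hC u
    rw [abs_mul]
    have e4 : bracket u ^ 2 * bracket u ^ (-4 : ℝ) = bracket u ^ (-2 : ℝ) := by
      rw [← Real.rpow_natCast, ← Real.rpow_add (bracket_pos u)]; norm_num
    have h5 : bracket u ^ (-2 : ℝ) ≤ E ^ (2 : ℝ) * bracket z ^ (-2 : ℝ) := by
      have hE0 : 0 < E := by linarith
      have h6 : E⁻¹ * bracket z ≤ bracket u := by rw [inv_mul_le_iff₀ hE0]; exact hz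
      have := Real.rpow_le_rpow_of_nonpos (mul_pos (inv_pos.2 hE0) (bracket_pos z)) h6
        (by norm_num : (-2 : ℝ) ≤ 0)
      rwa [Real.mul_rpow (inv_pos.2 hE0).le (bracket_pos z).le, Real.inv_rpow hE0.le,
        ← Real.rpow_neg hE0.le, neg_neg] at this
    calc _ ≤ (K * bracket u ^ 2) * (C * bracket u ^ (-4 : ℝ)) :=
          mul_le_mul hco hg (abs_nonneg _) (by positivity)
      _ = K * C * (bracket u ^ 2 * bracket u ^ (-4 : ℝ)) := by ring
      _ ≤ K * C * (E ^ (2 : ℝ) * bracket z ^ (-2 : ℝ)) := by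
          rw [e4]; gcongr
      _ = _ := by ring
  · exact hf.abs.integrable_mul
      ((memLp_two_bracket_rpow (by norm_num)).const_mul (K * C * E ^ (2 : ℝ)))
  · obtain ⟨hA, hc, hb, -⟩ := hball s hs
    exact (hasDerivAt_gauss_affine hA hc hb z).const_mul (f z)

theorem eq_zero_of_deriv_eq_zero {h : ℝ → ℝ} {L : ℝ} (hL : 0 < L)
    (hd : ∀ s ∈ Set.Ioc 0 L, HasDerivAt h 0 s) (h0 : Tendsto h (𝓝[>] 0) (𝓝 0)) : h L = 0 := by
  have hconst : ∀ s ∈ Set.Ioc 0 L, h s = h L := by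
    intro s hs
    have hcont : ContinuousOn h (Set.Icc s L) := fun x hx =>
      (hd x ⟨hs.1.trans_le hx.1, hx.2⟩).continuousAt.continuousWithinAt
    exact (constant_of_has_deriv_right_zero hcont (fun x hx =>
      (hd x ⟨hs.1.trans_le hx.1, hx.2.le⟩).hasDerivWithinAt) L ⟨hs.2, le_rfl⟩).symm
  have h1 : Tendsto h (𝓝[>] 0) (𝓝 (h L)) := by
    refine tendsto_const_nhds.congr' ?_
    filter_upwards [Ioc_mem_nhdsGT hL] with s hs
    exact (hconst s hs).symm
  exact tendsto_nhds_unique h1 h0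

/-! ### Uniqueness -/

/-- The dependence on the lower bound c₀ of the dilation is kept explicit. In the uniqueness proof
c₀ is proportional to s, and the power c₀^(-m) must be beaten as s → 0. -/
theorem exists_gauss_affine_le {m : ℝ} (hm : 0 ≤ m) : ∃ C, 0 < C ∧ ∀ (c₀ B c : ℝ) (b z : Plane),
    0 < c₀ → c₀ ≤ 1 → c₀ ≤ c → ‖b‖ ≤ B →
      gauss (c • z + b) ≤ C * ((2 + B) / c₀) ^ m * bracket z ^ (-m) := by
  obtain ⟨C, hC0, hC⟩ := (decays_gauss (-m)).exists_pos
  refine ⟨C, hC0, fun c₀ B c b z h0 h1 hc hb => ?_⟩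
  have hB : 0 ≤ B := (norm_nonneg b).trans hb
  set u := c • z + b
  have h2 : bracket z ≤ (2 + B) / c₀ * bracket u := by
    refine (bracket_le_affine h0 (hc.trans (le_abs_self c)) hb z).trans ?_
    refine mul_le_mul_of_nonneg_right ?_ (bracket_pos _).le
    rw [le_div_iff₀ h0, add_mul, div_mul_cancel₀ _ h0.ne']
    linarith
  have hE0 : 0 < (2 + B) / c₀ := by positivity
  have h6 : ((2 + B) / c₀)⁻¹ * bracket z ≤ bracket u := by rw [inv_mul_le_iff₀ hE0]; exact h2
  have h7 := Real.rpow_le_rpow_of_nonpos (mul_pos (inv_pos.2 hE0) (bracket_pos z)) h6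
    (neg_nonpos.2 hm)
  rw [Real.mul_rpow (inv_pos.2 hE0).le (bracket_pos z).le, Real.inv_rpow hE0.le,
    ← Real.rpow_neg hE0.le, neg_neg] at h7
  have h8 := hC u
  rw [abs_of_pos (gauss_pos u)] at h8
  rw [mul_assoc]
  exact h8.trans (mul_le_mul_of_nonneg_left h7 hC0.le)

/-- A distributional solution of `ℒ f = 0` that decays faster than `1/|y|` vanishes. -/
theorem ae_eq_zero_of_lerayAdj {f : Plane → ℝ} {α K : ℝ} (hα0 : 0 < α) (hα1 : α < 1)
    (hm : AEStronglyMeasurable f) (hK : ∀ᵐ y, |f y| ≤ K * bracket y ^ (-(1 + α)))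
    (h : ∀ φ : Test, ∫ x, f x * lerayAdj φ x = 0) : f =ᵐ[volume] 0 := by
  have hf : MemLp f 2 :=
    MemLp.mono' ((memLp_two_bracket_rpow (r := 1 + α) (by linarith)).const_mul K) hm hK
  refine ae_eq_zero_of_gauss hf fun r hr x => ?_
  -- At time s² the function s⁻¹ f(·/s) is paired with the heat kernel of age 1 + r² − s² centred at
  -- x. Substituting s z for the space variable gives the family s κ² G(κ(s z − x)) below. At s = 1
  -- the age is r², which is the Gaussian required by `ae_eq_zero_of_gauss`.
  set κ : ℝ → ℝ := fun s => (√(1 + r ^ 2 - s ^ 2))⁻¹ with hκ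
  have hpos : ∀ s : ℝ, s ^ 2 < 1 + r ^ 2 → 0 < κ s := fun s hs =>
    inv_pos.2 (Real.sqrt_pos.2 (by linarith))
  have hdκ : ∀ s : ℝ, s ^ 2 < 1 + r ^ 2 → HasDerivAt κ (s * κ s ^ 3) s := by
    intro s hs
    have h0 : 0 < 1 + r ^ 2 - s ^ 2 := by linarith
    have h1 : HasDerivAt (fun s : ℝ => 1 + r ^ 2 - s ^ 2) (-(2 * s)) s := by
      simpa using (hasDerivAt_pow 2 s).const_sub (1 + r ^ 2)
    have h2 := (h1.sqrt h0.ne').inv (Real.sqrt_pos.2 h0).ne'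
    refine h2.congr_deriv ?_
    have h3 : √(1 + r ^ 2 - s ^ 2) ≠ 0 := (Real.sqrt_pos.2 h0).ne'
    simp only [hκ]
    field_simp
  have hev : ∀ {s : ℝ}, s ∈ Set.Ioc (0 : ℝ) 1 → ∀ᶠ t in 𝓝 s, t ^ 2 < 1 + r ^ 2 := fun {s} hs =>
    (continuous_pow 2).continuousAt.eventually_lt_const (by nlinarith [hs.1, hs.2, pow_pos hr 2])
  have key := eq_zero_of_deriv_eq_zero
    (h := fun s => ∫ z, f z * ((s * κ s ^ 2) * gauss ((κ s * s) • z + -(κ s • x)))) one_pos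
    (fun s hs => ?_) ?_
  · have h1 : κ 1 = r⁻¹ := by simp [hκ, Real.sqrt_sq hr.le]
    have e : ∀ z, (r⁻¹ * 1) • z + -(r⁻¹ • x) = r⁻¹ • (z - x) := fun z => by
      rw [mul_one, smul_sub, sub_eq_add_neg]
    simp only [h1, e, mul_left_comm (f _), integral_const_mul] at key
    exact (mul_eq_zero.1 key).resolve_left (by positivity)
  · have hs2 := (hev hs).self_of_nhds
    have hκc : ContinuousAt κ s := (hdκ s hs2).continuousAt
    have hd := hasDerivAt_integral_gauss hf (A := fun s => s * κ s ^ 2) (c := fun s => κ s * s)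
      (b := fun s => -(κ s • x)) (A' := fun s => κ s ^ 2 + 2 * s ^ 2 * κ s ^ 4)
      (c' := fun s => s ^ 2 * κ s ^ 3 + κ s) (b' := fun s => -((s * κ s ^ 3) • x)) (s₀ := s)
      ((hev hs).mono fun t ht => by
        refine ((hasDerivAt_id t).mul ((hdκ t ht).pow 2)).congr_deriv ?_
        simp; ring)
      ((hev hs).mono fun t ht => by
        refine ((hdκ t ht).mul (hasDerivAt_id t)).congr_deriv ?_
        simp; ring)
      ((hev hs).mono fun t ht => ((hdκ t ht).smul_const x).neg)
      (by fun_prop) (by fun_prop) (by fun_prop) (mul_pos (hpos s hs2) hs.1).ne'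
    refine hd.congr_deriv ?_
    have aff : ContDiff ℝ ∞ fun z : Plane => (κ s * s) • z + -(κ s • x) := by fun_prop
    have hz := integral_mul_lerayAdj_eq_zero hf h
      (φ := fun z => (s * κ s ^ 2) * gauss ((κ s * s) • z + -(κ s • x)))
      (contDiff_const.mul (contDiff_gauss.comp aff))
      (IsSymbol.const_mul ((isSymbol_gauss 2 (-2)).comp_affine contDiff_gauss
        (mul_pos (hpos s hs2) hs.1).ne' _) (contDiff_gauss.comp aff) _)
    -- Pointwise in z, the s-derivative of the family is −2/s times its image under `lerayAdj`. This
    -- is the backward heat equation in self-similar variables, and the pairing is therefore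
    -- stationary.
    rw [← mul_zero (-(2 / s)), ← hz, ← integral_const_mul]
    refine integral_congr_ae (ae_of_all _ fun z => ?_)
    simp only [lerayAdj_gauss_affine]
    set u := (κ s * s) • z + -(κ s • x) with hu
    have e : (s ^ 2 * κ s ^ 3 + κ s) • z + -((s * κ s ^ 3) • x) =
        (s * κ s ^ 2) • u + κ s • z := by
      rw [hu]; module
    rw [e, inner_add_right, inner_smul_right, inner_smul_right, real_inner_self_eq_norm_sq]
    have hs0 := hs.1.ne'
    field_simp
    ring
  -- The exponent 1 − α/2 balances two needs: together with the decay 1 + α of f it exceeds 2, so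
  -- the z-integral converges, and s · s^(-(1 - α/2)) = s^(α/2) still tends to 0.
  · obtain ⟨C, hC0, hC⟩ := exists_gauss_affine_le (m := 1 - α / 2) (by linarith)
    have hi : Integrable fun z : Plane => K * (bracket z ^ (-(1 + α)) * bracket z ^ (-(1 - α / 2))) := by
      refine (integrable_bracket_rpow (r := 2 + α / 2) (by linarith)).const_mul K |>.congr
        (ae_of_all _ fun z => ?_)
      simp only
      rw [← Real.rpow_add (bracket_pos z)]
      congr 2; ring
    set κ₀ := (√(1 + r ^ 2))⁻¹ with hκ₀
    have hκ₀0 : 0 < κ₀ := by positivity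
    have hκ₀1 : κ₀ ≤ 1 := inv_le_one_of_one_le₀ (Real.one_le_sqrt.2 (by nlinarith [sq_nonneg r]))
    have hκb : ∀ s ∈ Set.Ioc (0 : ℝ) 1, κ₀ ≤ κ s ∧ κ s ≤ r⁻¹ := by
      intro s hs
      have hs2 : s ^ 2 ≤ 1 := by nlinarith [hs.1, hs.2]
      refine ⟨inv_anti₀ (Real.sqrt_pos.2 ?_) (Real.sqrt_le_sqrt ?_), inv_anti₀ hr ?_⟩
      · nlinarith [pow_pos hr 2]
      · nlinarith [sq_nonneg s]
      · exact Real.le_sqrt_of_sq_le (by linarith)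
    set B := r⁻¹ * ‖x‖ with hB
    set D := r⁻¹ ^ 2 * C * ((2 + B) / κ₀) ^ (1 - α / 2) *
      ∫ z, K * (bracket z ^ (-(1 + α)) * bracket z ^ (-(1 - α / 2)))
    have hb : ∀ᶠ s in 𝓝[>] (0 : ℝ),
        |∫ z, f z * ((s * κ s ^ 2) * gauss ((κ s * s) • z + -(κ s • x)))| ≤ s ^ (α / 2) * D := by
      filter_upwards [Ioc_mem_nhdsGT one_pos] with s hs
      obtain ⟨hk1, hk2⟩ := hκb s hs
      have hk0 : 0 < κ s := hκ₀0.trans_le hk1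
      have hle : |∫ z, f z * ((s * κ s ^ 2) * gauss ((κ s * s) • z + -(κ s • x)))| ≤
          ∫ z, (s * r⁻¹ ^ 2 * (C * ((2 + B) / (κ₀ * s)) ^ (1 - α / 2))) *
            (K * (bracket z ^ (-(1 + α)) * bracket z ^ (-(1 - α / 2)))) := by
        rw [← Real.norm_eq_abs]
        refine norm_integral_le_of_norm_le (hi.const_mul _) ?_
        filter_upwards [hK] with z hz
        have := hC (κ₀ * s) B (κ s * s) (-(κ s • x)) z (mul_pos hκ₀0 hs.1)
          (mul_le_one₀ hκ₀1 hs.1.le hs.2) (mul_le_mul_of_nonneg_right hk1 hs.1.le) (by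
            rw [norm_neg, norm_smul, Real.norm_eq_abs, abs_of_pos hk0]
            exact mul_le_mul_of_nonneg_right hk2 (norm_nonneg x))
        have hs0 := hs.1
        rw [norm_mul, norm_mul, Real.norm_eq_abs, Real.norm_eq_abs, Real.norm_eq_abs,
          abs_of_pos (gauss_pos _), abs_of_pos (by positivity : 0 < s * κ s ^ 2)]
        have g0 := gauss_pos ((κ s * s) • z + -(κ s • x))
        calc |f z| * (s * κ s ^ 2 * gauss ((κ s * s) • z + -(κ s • x)))
            ≤ (K * bracket z ^ (-(1 + α))) * (s * r⁻¹ ^ 2 *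
              (C * ((2 + B) / (κ₀ * s)) ^ (1 - α / 2) * bracket z ^ (-(1 - α / 2)))) := by
              have := (abs_nonneg _).trans hz
              gcongr
          _ = _ := by ring
      rw [integral_const_mul] at hle
      refine hle.trans (le_of_eq ?_)
      have e : s ^ (α / 2) * s ^ (1 - α / 2) = s := by
        rw [← Real.rpow_add hs.1, add_sub_cancel, Real.rpow_one]
      have h32 : s ^ (1 - α / 2) ≠ 0 := (Real.rpow_pos_of_pos hs.1 _).ne'
      have hB0 : 0 ≤ B := by positivity
      rw [← div_div, Real.div_rpow (by positivity) hs.1.le]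
      simp only [D]
      generalize ((2 + B) / κ₀) ^ (1 - α / 2) = P
      generalize (∫ z : Plane, K * (bracket z ^ (-(1 + α)) * bracket z ^ (-(1 - α / 2)))) = J
      nth_rewrite 1 [← e]
      generalize s ^ (1 - α / 2) = S at h32 ⊢
      field_simp
    have hlim : Tendsto (fun s : ℝ => s ^ (α / 2) * D) (𝓝[>] 0) (𝓝 0) := by
      have h1 : ContinuousAt (fun c : ℝ => c ^ (α / 2)) 0 :=
        Real.continuousAt_rpow_const _ _ (Or.inr (by positivity))
      have h2 := (h1.tendsto.mono_left (nhdsWithin_le_nhds (s := Set.Ioi 0))).mul_const D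
      rwa [Real.zero_rpow (by positivity), zero_mul] at h2
    exact squeeze_zero_norm' (by simpa only [Real.norm_eq_abs] using hb) hlim

/-! ### Self-similar space-time integrals -/

/-- The product of Lebesgue measure on `(0, 1)` and on the plane. -/
def stMeasure : Measure (ℝ × Plane) := (volume.restrict (Set.Ioo (0 : ℝ) 1)).prod volume

instance : SFinite stMeasure := inferInstanceAs (SFinite (Measure.prod _ _))

/-- The parabolic variable `(y - √s z) / √(1 - s)`. -/
def parab (s : ℝ) (y z : Plane) : Plane := (√(1 - s))⁻¹ • (y - √s • z)

theorem measurable_parab (y : Plane) : Measurable fun p : ℝ × Plane => parab p.1 y p.2 := by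
  unfold parab; fun_prop

theorem measurable_parab' :
    Measurable fun p : Plane × ℝ × Plane => parab p.2.1 p.1 p.2.2 := by
  unfold parab; fun_prop

theorem ae_stMeasure {P : ℝ × Plane → Prop} (h : ∀ s ∈ Set.Ioo (0 : ℝ) 1, ∀ z, P (s, z)) :
    ∀ᵐ p ∂stMeasure, P p := by
  have h1 : ∀ᵐ s ∂(volume.restrict (Set.Ioo (0 : ℝ) 1)), s ∈ Set.Ioo (0 : ℝ) 1 :=
    ae_restrict_mem measurableSet_Ioo
  have h2 : ∀ᵐ p ∂stMeasure, p.1 ∈ Set.Ioo (0 : ℝ) 1 := Measure.quasiMeasurePreserving_fst.ae h1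
  exact h2.mono fun p hp => h p.1 hp p.2

theorem ae_stMeasure_snd {P : Plane → Prop} (h : ∀ᵐ z, P z) : ∀ᵐ p ∂stMeasure, P p.2 :=
  Measure.quasiMeasurePreserving_snd.ae h

/-- As a function of z, `parab` scales lengths by √s/√(1-s); the factor is the inverse of the square
of this ratio. -/
theorem integral_parab (f : Plane → ℝ) {s : ℝ} (hs : s ∈ Set.Ioo (0 : ℝ) 1) (y : Plane) :
    ∫ z, f (parab s y z) = (1 - s) / s * ∫ w, f w := by
  have h1 : 0 < √s := Real.sqrt_pos.2 hs.1
  have h2 : 0 < √(1 - s) := Real.sqrt_pos.2 (by linarith [hs.2])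
  have e : ∀ z, parab s y z = (√(1 - s))⁻¹ • (y - √s • z) := fun z => rfl
  simp only [e]
  rw [Measure.integral_comp_smul (μ := volume) (fun w : Plane => f ((√(1 - s))⁻¹ • (y - w))) (√s),
    integral_sub_left_eq_self (fun w : Plane => f ((√(1 - s))⁻¹ • w)) volume y,
    Measure.integral_comp_smul]
  have e1 : √(1 - s) ^ 2 = 1 - s := Real.sq_sqrt (by linarith [hs.2])
  have e2 : √s ^ 2 = s := Real.sq_sqrt hs.1.le
  have hs0 := hs.1.ne'
  simp [e1, e2, abs_of_pos hs.1,
    abs_of_pos (by linarith [hs.2] : 0 < 1 - s)]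
  field_simp

theorem integrable_parab {f : Plane → ℝ} (hf : Integrable f) {s : ℝ} (hs : s ∈ Set.Ioo (0 : ℝ) 1)
    (y : Plane) : Integrable fun z => f (parab s y z) := by
  have h1 : 0 < √s := Real.sqrt_pos.2 hs.1
  have h2 : 0 < √(1 - s) := Real.sqrt_pos.2 (by linarith [hs.2])
  have i1 : Integrable fun w : Plane => f ((√(1 - s))⁻¹ • w) := hf.comp_smul (inv_pos.2 h2).ne'
  exact (i1.comp_sub_left y).comp_smul h1.ne'

/-- Decompose y = √(1-s) `parab s y z` + √s z and split 1 = (1-s) + s. The factor 2 comes from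
squaring the triangle inequality. -/
theorem bracket_sq_le_parab {s : ℝ} (hs : s ∈ Set.Ioo (0 : ℝ) 1) (y z : Plane) :
    bracket y ^ 2 ≤ 2 * ((1 - s) * bracket (parab s y z) ^ 2 + s * bracket z ^ 2) := by
  have h1 : 0 < 1 - s := by linarith [hs.2]
  have e1 : (1 - s) * bracket (parab s y z) ^ 2 = (1 - s) + ‖y - √s • z‖ ^ 2 := by
    rw [bracket_sq, parab, norm_smul, mul_pow, norm_inv, Real.norm_eq_abs, inv_pow, sq_abs,
      Real.sq_sqrt h1.le]
    field_simp
  have e2 : s * ‖z‖ ^ 2 = ‖√s • z‖ ^ 2 := by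
    rw [norm_smul, mul_pow, Real.norm_eq_abs, sq_abs, Real.sq_sqrt hs.1.le]
  have h2 : ‖y‖ ≤ ‖y - √s • z‖ + ‖√s • z‖ := by
    simpa using norm_add_le (y - √s • z) (√s • z)
  rw [e1, bracket_sq, bracket_sq, mul_add s, e2]
  nlinarith [norm_nonneg y, sq_nonneg (‖y - √s • z‖ - ‖√s • z‖), norm_nonneg (y - √s • z),
    norm_nonneg (√s • z)]

theorem rpow_mul_rpow_le {u v a b : ℝ} (hu : 0 < u) (hv : 0 < v) (ha : 0 ≤ a) (hb : 0 ≤ b) :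
    u ^ (-a) * v ^ (-b) ≤ u ^ (-(a + b)) + v ^ (-(a + b)) := by
  have pu := (Real.rpow_pos_of_pos hu (-(a + b))).le
  have pv := (Real.rpow_pos_of_pos hv (-(a + b))).le
  rcases le_total u v with h | h
  · have := Real.rpow_le_rpow_of_nonpos hu h (neg_nonpos.2 hb)
    calc u ^ (-a) * v ^ (-b) ≤ u ^ (-a) * u ^ (-b) :=
          mul_le_mul_of_nonneg_left this (Real.rpow_pos_of_pos hu _).le
      _ = u ^ (-(a + b)) := by rw [← Real.rpow_add hu]; congr 1; ring
      _ ≤ _ := by linarith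
  · have := Real.rpow_le_rpow_of_nonpos hv h (neg_nonpos.2 ha)
    calc u ^ (-a) * v ^ (-b) ≤ v ^ (-a) * v ^ (-b) :=
          mul_le_mul_of_nonneg_right this (Real.rpow_pos_of_pos hv _).le
      _ = v ^ (-(a + b)) := by rw [← Real.rpow_add hv]; congr 1; ring
      _ ≤ _ := by linarith

/-- The weight is absorbed by the larger of A and B, leaving a power of the larger one that is still
nonpositive: when B is larger this needs γ ≤ 2, when A is larger γ ≤ m. Replacing the larger by the
smaller there leaves a single variable, and the estimate decouples. -/
theorem weight_mul_rpow_le {w A B m γ : ℝ} (hw : 0 < w) (hA : 0 < A) (hB : 0 < B)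
    (h : w ^ 2 ≤ 2 * (A + B)) (hγ0 : 0 ≤ γ) (hγm : γ ≤ m) (hγ2 : γ ≤ 2) :
    w ^ γ * (A ^ (-(m / 2)) * B ^ (-1 : ℝ)) ≤
      4 ^ (γ / 2) * (A ^ (-((m + 2 - γ) / 2)) + B ^ (-((m + 2 - γ) / 2))) := by
  have ew : w ^ γ = (w ^ 2) ^ (γ / 2) := by
    rw [← Real.rpow_natCast, ← Real.rpow_mul hw.le]; congr 1; push_cast; ring
  have p4 : (0 : ℝ) ≤ 4 ^ (γ / 2) := by positivity
  have pA := (Real.rpow_pos_of_pos hA (-((m + 2 - γ) / 2))).le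
  have pB := (Real.rpow_pos_of_pos hB (-((m + 2 - γ) / 2))).le
  rcases le_total A B with hAB | hAB
  · have h1 : w ^ γ ≤ 4 ^ (γ / 2) * B ^ (γ / 2) := by
      rw [ew, ← Real.mul_rpow (by norm_num) hB.le]
      exact Real.rpow_le_rpow (by positivity) (by linarith) (by linarith)
    have h2 : B ^ (γ / 2 - 1) ≤ A ^ (γ / 2 - 1) :=
      Real.rpow_le_rpow_of_nonpos hA hAB (by linarith)
    calc w ^ γ * (A ^ (-(m / 2)) * B ^ (-1 : ℝ))
        ≤ 4 ^ (γ / 2) * B ^ (γ / 2) * (A ^ (-(m / 2)) * B ^ (-1 : ℝ)) := by gcongr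
      _ = 4 ^ (γ / 2) * (A ^ (-(m / 2)) * B ^ (γ / 2 - 1)) := by
          rw [sub_eq_add_neg, Real.rpow_add hB]; ring
      _ ≤ 4 ^ (γ / 2) * (A ^ (-(m / 2)) * A ^ (γ / 2 - 1)) := by gcongr
      _ = 4 ^ (γ / 2) * A ^ (-((m + 2 - γ) / 2)) := by
          rw [← Real.rpow_add hA]; ring_nf
      _ ≤ _ := mul_le_mul_of_nonneg_left (by linarith) p4
  · have h1 : w ^ γ ≤ 4 ^ (γ / 2) * A ^ (γ / 2) := by
      rw [ew, ← Real.mul_rpow (by norm_num) hA.le]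
      exact Real.rpow_le_rpow (by positivity) (by linarith) (by linarith)
    have h2 : A ^ (γ / 2 - m / 2) ≤ B ^ (γ / 2 - m / 2) :=
      Real.rpow_le_rpow_of_nonpos hB hAB (by linarith)
    calc w ^ γ * (A ^ (-(m / 2)) * B ^ (-1 : ℝ))
        ≤ 4 ^ (γ / 2) * A ^ (γ / 2) * (A ^ (-(m / 2)) * B ^ (-1 : ℝ)) := by gcongr
      _ = 4 ^ (γ / 2) * (A ^ (γ / 2 - m / 2) * B ^ (-1 : ℝ)) := by
          rw [sub_eq_add_neg, Real.rpow_add hA]; ring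
      _ ≤ 4 ^ (γ / 2) * (B ^ (γ / 2 - m / 2) * B ^ (-1 : ℝ)) := by gcongr
      _ = 4 ^ (γ / 2) * B ^ (-((m + 2 - γ) / 2)) := by
          rw [← Real.rpow_add hB]; ring_nf
      _ ≤ _ := mul_le_mul_of_nonneg_left (by linarith) p4

theorem integrableOn_rpow_Ioo {κ : ℝ} (hκ : κ < 1) :
    IntegrableOn (fun s : ℝ => s ^ (-κ)) (Set.Ioo 0 1) := by
  have h := intervalIntegral.intervalIntegrable_rpow' (a := 0) (b := 1) (r := -κ) (by linarith)
  rw [intervalIntegrable_iff_integrableOn_Ioo_of_le zero_le_one] at h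
  exact h

theorem integrableOn_one_sub_rpow_Ioo {κ : ℝ} (hκ : κ < 1) :
    IntegrableOn (fun s : ℝ => (1 - s) ^ (-κ)) (Set.Ioo 0 1) := by
  have h := (intervalIntegral.intervalIntegrable_rpow' (a := 0) (b := 1) (r := -κ)
    (by linarith)).comp_sub_left 1
  simp only [sub_zero, sub_self] at h
  replace h := h.symm
  rw [intervalIntegrable_iff_integrableOn_Ioo_of_le zero_le_one] at h
  exact h

theorem integrableOn_beta {a b : ℝ} (ha : 0 ≤ a) (hb : 0 ≤ b) (hab : a + b < 1) :
    IntegrableOn (fun s : ℝ => (1 - s) ^ (-a) * s ^ (-b)) (Set.Ioo 0 1) := by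
  refine ((integrableOn_one_sub_rpow_Ioo hab).add (integrableOn_rpow_Ioo hab)).mono'
    (by fun_prop : Measurable _).aestronglyMeasurable ?_
  filter_upwards [ae_restrict_mem measurableSet_Ioo] with s hs
  have h1 : 0 < 1 - s := by linarith [hs.2]
  rw [Real.norm_eq_abs, abs_of_pos (mul_pos (Real.rpow_pos_of_pos h1 _)
    (Real.rpow_pos_of_pos hs.1 _))]
  exact rpow_mul_rpow_le h1 hs.1 ha hb

/-- The basic decay estimate for self-similar space-time potentials. -/
theorem exists_parab_integral_le {m e γ : ℝ} (hγ0 : 0 ≤ γ) (hγm : γ < m) (hγ2 : γ ≤ 2)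
    (hσ : m / 2 ≤ e) (hp : e - m / 2 + (m + 2 - γ) / 2 < 2) :
    ∃ C, 0 < C ∧ ∀ y : Plane,
      Integrable (fun p : ℝ × Plane =>
        (1 - p.1) ^ (-e) * bracket (parab p.1 y p.2) ^ (-m) * bracket p.2 ^ (-2 : ℝ)) stMeasure ∧
      ∫ p, (1 - p.1) ^ (-e) * bracket (parab p.1 y p.2) ^ (-m) * bracket p.2 ^ (-2 : ℝ) ∂stMeasure
        ≤ C * bracket y ^ (-γ) := by
  -- With A = (1-s)⟨`parab`⟩² and B = s⟨z⟩², the weighted integrand is at most a constant times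
  -- (1-s)^(-σ) s (A^(-p) + B^(-p)). The z-integrals converge because p > 1, which is γ < m. What
  -- remains in s is (1-s)^(1-σ-p) for the first term and (1-s)^(-σ) s^(1-p) for the second; both
  -- are integrable on (0, 1) because σ + p < 2.
  set p := (m + 2 - γ) / 2 with hpdef
  set σ := e - m / 2 with hσdef
  have hp1 : 1 < p := by rw [hpdef]; linarith
  have hσ0 : 0 ≤ σ := by linarith
  have hb := bracket_pos
  have hjap : Integrable fun w : Plane => bracket w ^ (-(2 * p)) :=
    integrable_bracket_rpow (by linarith)
  set c := ∫ w : Plane, bracket w ^ (-(2 * p)) with hc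
  have hc0 : 0 ≤ c := integral_nonneg fun w => (bracket_rpow_pos w _).le
  -- the two dominating functions
  set f1 : Plane → ℝ × Plane → ℝ := fun y q =>
    (1 - q.1) ^ (-σ - p) * q.1 * bracket (parab q.1 y q.2) ^ (-(2 * p)) with hf1
  set f2 : ℝ × Plane → ℝ := fun q =>
    ((1 - q.1) ^ (-σ) * q.1 ^ (-(p - 1))) * bracket q.2 ^ (-(2 * p)) with hf2
  have m1 : ∀ y, AEStronglyMeasurable (f1 y) stMeasure := fun y => by
    have h1 := (continuous_bracket_rpow (-(2 * p))).measurable.comp (measurable_parab y)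
    exact (((measurable_const.sub measurable_fst).pow_const _).mul measurable_fst
      |>.mul h1).aestronglyMeasurable
  have i2 : Integrable f2 stMeasure :=
    Integrable.mul_prod (integrableOn_beta hσ0 (by linarith) (by linarith)) hjap
  have slice : ∀ y, ∀ s ∈ Set.Ioo (0 : ℝ) 1, ∫ z, f1 y (s, z) = (1 - s) ^ (-(σ + p - 1)) * c := by
    intro y s hs
    have h1 : 0 < 1 - s := by linarith [hs.2]
    simp only [hf1, integral_const_mul]
    rw [integral_parab (fun w => bracket w ^ (-(2 * p))) hs, ← hc]
    have e1 : (1 - s) ^ (-(σ + p - 1)) = (1 - s) ^ (-σ - p) * (1 - s) := by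
      rw [← Real.rpow_add_one h1.ne']; ring_nf
    rw [e1]
    have := hs.1.ne'
    field_simp
  have f1nn : ∀ y, ∀ s ∈ Set.Ioo (0 : ℝ) 1, ∀ z, 0 ≤ f1 y (s, z) := fun y s hs z => by
    have h1 : 0 < 1 - s := by linarith [hs.2]
    have := hs.1
    exact mul_nonneg (mul_nonneg (Real.rpow_pos_of_pos h1 _).le this.le)
      (bracket_rpow_pos _ _).le
  have i3 : IntegrableOn (fun s : ℝ => (1 - s) ^ (-(σ + p - 1)) * c) (Set.Ioo 0 1) :=
    (integrableOn_one_sub_rpow_Ioo (by linarith)).mul_const c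
  have i1 : ∀ y, Integrable (f1 y) stMeasure := fun y => by
    rw [stMeasure, integrable_prod_iff (m1 y)]
    refine ⟨?_, ?_⟩
    · filter_upwards [ae_restrict_mem measurableSet_Ioo] with s hs
      exact (integrable_parab hjap hs y).const_mul ((1 - s) ^ (-σ - p) * s)
    · refine i3.congr ?_
      filter_upwards [ae_restrict_mem measurableSet_Ioo] with s hs
      rw [← slice y s hs]
      exact integral_congr_ae (ae_of_all _ fun z => (abs_of_nonneg (f1nn y s hs z)).symm)
  have v1 : ∀ y, ∫ q, f1 y q ∂stMeasure =
      ∫ s in Set.Ioo (0 : ℝ) 1, (1 - s) ^ (-(σ + p - 1)) * c := fun y => by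
    rw [stMeasure, integral_prod _ (i1 y)]
    exact setIntegral_congr_fun measurableSet_Ioo fun s hs => slice y s hs
  set I1 := ∫ s in Set.Ioo (0 : ℝ) 1, (1 - s) ^ (-(σ + p - 1)) * c
  set I2 := ∫ q, f2 q ∂stMeasure
  have key : ∀ y, ∀ s ∈ Set.Ioo (0 : ℝ) 1, ∀ z,
      (1 - s) ^ (-e) * bracket (parab s y z) ^ (-m) * bracket z ^ (-2 : ℝ) ≤
        bracket y ^ (-γ) * (4 ^ (γ / 2) * (f1 y (s, z) + f2 (s, z))) := by
    intro y s hs z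
    have h1 : 0 < 1 - s := by linarith [hs.2]
    have hs0 := hs.1
    set u := bracket (parab s y z) with hu
    have pu : 0 < u := hb _
    have pz := hb z
    have pow_e : ∀ {a w r : ℝ}, 0 < a → 0 < w → (a * w ^ 2) ^ r = a ^ r * w ^ (2 * r) := by
      intro a w r ha hw
      rw [Real.mul_rpow ha.le (by positivity), ← Real.rpow_natCast, ← Real.rpow_mul hw.le]
      norm_num
    have hw := weight_mul_rpow_le (hb y) (A := (1 - s) * u ^ 2) (B := s * bracket z ^ 2)
      (by positivity) (by positivity) (bracket_sq_le_parab hs y z) hγ0 hγm.le hγ2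
    rw [← hpdef, pow_e h1 pu, pow_e hs0 pz, pow_e h1 pu, pow_e hs0 pz] at hw
    have e1 : (1 - s) ^ (-e) = (1 - s) ^ (-σ) * (1 - s) ^ (-(m / 2)) := by
      rw [← Real.rpow_add h1]; congr 1; rw [hσdef]; ring
    have e2 : (1 - s) ^ (-σ - p) = (1 - s) ^ (-σ) * (1 - s) ^ (-p) := by
      rw [← Real.rpow_add h1]; ring_nf
    have e3 : s ^ (-(p - 1)) = s * s ^ (-p) := by
      rw [← Real.rpow_one_add' hs0.le (by linarith)]; ring_nf
    have e4 : s ^ (-1 : ℝ) = s⁻¹ := Real.rpow_neg_one s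
    rw [e4, show 2 * -(m / 2) = -m by ring, show 2 * -p = -(2 * p) by ring,
      show (2 : ℝ) * -1 = -2 by norm_num] at hw
    rw [Real.rpow_neg (hb y).le γ, inv_mul_eq_div, le_div_iff₀ (bracket_rpow_pos y γ)]
    simp only [hf1, hf2, e1, e2, e3, ← hu]
    have pt := (Real.rpow_pos_of_pos h1 (-σ)).le
    calc (1 - s) ^ (-σ) * (1 - s) ^ (-(m / 2)) * u ^ (-m) * bracket z ^ (-2 : ℝ) * bracket y ^ γ
        = ((1 - s) ^ (-σ) * s) * (bracket y ^ γ *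
          ((1 - s) ^ (-(m / 2)) * u ^ (-m) * (s⁻¹ * bracket z ^ (-2 : ℝ)))) := by
          field_simp
      _ ≤ ((1 - s) ^ (-σ) * s) * (4 ^ (γ / 2) * ((1 - s) ^ (-p) * u ^ (-(2 * p)) +
          s ^ (-p) * bracket z ^ (-(2 * p)))) :=
          mul_le_mul_of_nonneg_left hw (mul_nonneg pt hs0.le)
      _ = _ := by ring
  have hI1 : 0 ≤ I1 := setIntegral_nonneg measurableSet_Ioo fun s hs =>
    mul_nonneg (Real.rpow_pos_of_pos (by linarith [hs.2]) _).le hc0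
  have hI2 : 0 ≤ I2 := integral_nonneg_of_ae (ae_stMeasure fun s hs z => by
    have h1 : 0 < 1 - s := by linarith [hs.2]
    exact mul_nonneg (mul_nonneg (Real.rpow_pos_of_pos h1 _).le (Real.rpow_pos_of_pos hs.1 _).le)
      (bracket_rpow_pos _ _).le)
  refine ⟨4 ^ (γ / 2) * (I1 + I2) + 1, by positivity, fun y => ?_⟩
  have idom : Integrable (fun q => bracket y ^ (-γ) * (4 ^ (γ / 2) * (f1 y q + f2 q))) stMeasure :=
    (((i1 y).add i2).const_mul _).const_mul _
  have hint : Integrable (fun p : ℝ × Plane =>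
        (1 - p.1) ^ (-e) * bracket (parab p.1 y p.2) ^ (-m) * bracket p.2 ^ (-2 : ℝ))
        stMeasure := by
    refine idom.mono' ?_ (ae_stMeasure fun s hs z => ?_)
    · have h1 := (continuous_bracket_rpow (-m)).measurable.comp (measurable_parab y)
      have h2 := (continuous_bracket_rpow (-2)).measurable.comp
        (measurable_snd : Measurable fun p : ℝ × Plane => p.2)
      exact (((measurable_const.sub measurable_fst).pow_const _).mul h1
        |>.mul h2).aestronglyMeasurable
    · have h1 : 0 < 1 - s := by linarith [hs.2]
      rw [Real.norm_eq_abs, abs_of_nonneg]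
      · exact key y s hs z
      · exact mul_nonneg (mul_nonneg (Real.rpow_pos_of_pos h1 _).le (bracket_rpow_pos _ _).le)
          (bracket_rpow_pos _ _).le
  refine ⟨hint, (integral_mono_ae hint idom (ae_stMeasure fun s hs z => key y s hs z)).trans ?_⟩
  rw [integral_const_mul, integral_const_mul, integral_add (i1 y) i2, v1]
  have := (bracket_rpow_pos y (-γ)).le
  rw [mul_comm]
  exact mul_le_mul_of_nonneg_right (by linarith) this

/-! ### Potentials with kernels of order `-3` -/

/-- `f` is measurable and `|f| ≤ M ⟨z⟩⁻²` almost everywhere. -/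
structure QuadDecay (M : ℝ) (f : Plane → ℝ) : Prop where
  aesm : AEStronglyMeasurable f
  le : ∀ᵐ z, |f z| ≤ M * bracket z ^ (-2 : ℝ)

theorem QuadDecay.sub {M N : ℝ} {f g : Plane → ℝ} (hf : QuadDecay M f) (hg : QuadDecay N g) :
    QuadDecay (M + N) fun z => f z - g z :=
  ⟨hf.aesm.sub hg.aesm, by
    filter_upwards [hf.le, hg.le] with z h1 h2
    refine (abs_sub _ _).trans ?_
    rw [add_mul]; exact add_le_add h1 h2⟩

theorem QuadDecay.memLp {M : ℝ} {f : Plane → ℝ} (hf : QuadDecay M f) : MemLp f 2 :=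
  MemLp.mono' ((memLp_two_bracket_rpow (r := 2) (by norm_num)).const_mul M) hf.aesm hf.le

theorem QuadDecay.nonneg {M : ℝ} {f : Plane → ℝ} (hf : QuadDecay M f) : 0 ≤ M := by
  obtain ⟨z, hz⟩ := hf.le.exists
  exact nonneg_of_mul_nonneg_left ((abs_nonneg _).trans hz) (bracket_rpow_pos z _)

/-- The integrand of the space-time potential of `f` with kernel `k`. -/
def potIntegrand (k f : Plane → ℝ) (y : Plane) (p : ℝ × Plane) : ℝ :=
  (1 - p.1) ^ (-(3 / 2) : ℝ) * k (parab p.1 y p.2) * f p.2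

/-- The space-time potential of `f` with kernel `k`. -/
def stPotential (k f : Plane → ℝ) (y : Plane) : ℝ := ∫ p, potIntegrand k f y p ∂stMeasure

theorem aesm_potIntegrand {k f : Plane → ℝ} (hk : Continuous k) (hf : AEStronglyMeasurable f)
    (y : Plane) : AEStronglyMeasurable (potIntegrand k f y) stMeasure := by
  have h1 : Measurable fun p : ℝ × Plane => (1 - p.1) ^ (-(3 / 2) : ℝ) * k (parab p.1 y p.2) :=
    ((measurable_const.sub measurable_fst).pow_const _).mul
      (hk.measurable.comp (measurable_parab y))
  exact h1.aestronglyMeasurable.mul hf.comp_snd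

/-- For a kernel of order −3 with prefactor (1-s)^(-3/2) one has σ = 0 in
`exists_parab_integral_le`, and its condition σ + p < 2 becomes γ > 1. This is the room in which all
exponents 1 + α with 0 < α < 1 lie. -/
theorem exists_potIntegrand_le {k : Plane → ℝ} (hk : Continuous k) (dk : Decays (-3) k) {γ : ℝ}
    (hγ1 : 1 < γ) (hγ2 : γ ≤ 2) : ∃ C, 0 < C ∧ ∀ (M : ℝ) (f : Plane → ℝ), QuadDecay M f →
      ∀ y, Integrable (potIntegrand k f y) stMeasure ∧
        ∫ p, |potIntegrand k f y p| ∂stMeasure ≤ C * M * bracket y ^ (-γ) := by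
  obtain ⟨D, hD0, hD⟩ := dk.exists_pos
  obtain ⟨C, hC0, hC⟩ := exists_parab_integral_le (m := 3) (e := 3 / 2) (γ := γ) (by linarith)
    (by linarith) hγ2 (by norm_num) (by linarith)
  refine ⟨D * C, by positivity, fun M f hf y => ?_⟩
  obtain ⟨hi, hle⟩ := hC y
  have hM := hf.nonneg
  have hb : ∀ᵐ p ∂stMeasure, |potIntegrand k f y p| ≤ (D * M) * ((1 - p.1) ^ (-(3 / 2) : ℝ) *
      bracket (parab p.1 y p.2) ^ (-3 : ℝ) * bracket p.2 ^ (-2 : ℝ)) := by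
    have h0 : ∀ᵐ p ∂stMeasure, 0 < 1 - p.1 := ae_stMeasure fun s hs z => by
      change 0 < 1 - s; linarith [hs.2]
    filter_upwards [h0, ae_stMeasure_snd hf.le] with p h1 h2
    have h3 := Real.rpow_pos_of_pos h1 (-(3 / 2))
    rw [potIntegrand, abs_mul, abs_mul, abs_of_pos h3]
    calc (1 - p.1) ^ (-(3 / 2) : ℝ) * |k (parab p.1 y p.2)| * |f p.2|
        ≤ (1 - p.1) ^ (-(3 / 2) : ℝ) * (D * bracket (parab p.1 y p.2) ^ (-3 : ℝ)) *
          (M * bracket p.2 ^ (-2 : ℝ)) := by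
          have := hD (parab p.1 y p.2)
          have := bracket_rpow_pos (parab p.1 y p.2) (-3)
          gcongr
      _ = _ := by ring
  have hint : Integrable (potIntegrand k f y) stMeasure :=
    (hi.const_mul (D * M)).mono' (aesm_potIntegrand hk hf.aesm y) hb
  refine ⟨hint, (integral_mono_ae hint.abs (hi.const_mul (D * M)) hb).trans ?_⟩
  rw [integral_const_mul]
  calc D * M * _ ≤ D * M * (C * bracket y ^ (-γ)) := mul_le_mul_of_nonneg_left hle (by positivity)
    _ = _ := by ring

theorem exists_stPotential_le {k : Plane → ℝ} (hk : Continuous k) (dk : Decays (-3) k) {γ : ℝ}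
    (hγ1 : 1 < γ) (hγ2 : γ ≤ 2) : ∃ C, 0 < C ∧ ∀ (M : ℝ) (f : Plane → ℝ), QuadDecay M f →
      ∀ y, |stPotential k f y| ≤ C * M * bracket y ^ (-γ) := by
  obtain ⟨C, hC0, hC⟩ := exists_potIntegrand_le hk dk hγ1 hγ2
  exact ⟨C, hC0, fun M f hf y => (abs_integral_le_integral_abs).trans (hC M f hf y).2⟩

theorem stPotential_sub {k : Plane → ℝ} (hk : Continuous k) (dk : Decays (-3) k) {M N : ℝ}
    {f g : Plane → ℝ} (hf : QuadDecay M f) (hg : QuadDecay N g) (y : Plane) :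
    stPotential k (fun z => f z - g z) y = stPotential k f y - stPotential k g y := by
  obtain ⟨C, hC0, hC⟩ := exists_potIntegrand_le hk dk (γ := 2) (by norm_num) le_rfl
  rw [stPotential, stPotential, stPotential, ← integral_sub (hC M f hf y).1 (hC N g hg y).1]
  refine integral_congr_ae (ae_of_all _ fun p => ?_)
  simp only [potIntegrand]
  ring

theorem min_le_rpow_mul_rpow {u a b θ : ℝ} (hu : 0 ≤ u) (ha : u ≤ a) (hb : u ≤ b)
    (hθ0 : 0 ≤ θ) (hθ1 : θ ≤ 1) : u ≤ a ^ θ * b ^ (1 - θ) := by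
  calc u = u ^ θ * u ^ (1 - θ) := by
        rw [← Real.rpow_add_of_nonneg hu hθ0 (by linarith)]; simp
    _ ≤ _ := mul_le_mul (Real.rpow_le_rpow hu ha hθ0) (Real.rpow_le_rpow hu hb (by linarith))
        (Real.rpow_nonneg hu _) (Real.rpow_nonneg (hu.trans ha) _)

/-- Interpolate the Lipschitz bound of the kernel (weight 1/4) with its decay (weight 3/4). The
increment of `parab` is |y − y'|/√(1-s), so the gain |y − y'|^(1/4) costs an extra (1-s)^(-1/8),
which the time integral still tolerates. -/
theorem exists_stPotential_holder {k : Plane → ℝ} (sk : ContDiff ℝ ∞ k) (dk : IsSymbol 1 (-3) k) :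
    ∃ C, 0 < C ∧ ∀ (M : ℝ) (f : Plane → ℝ), QuadDecay M f →
      ∀ y y', |stPotential k f y - stPotential k f y'| ≤ C * M * ‖y - y'‖ ^ (1 / 4 : ℝ) := by
  have hk := sk.continuous
  obtain ⟨D, hD0, hD⟩ := dk.decays.exists_pos
  obtain ⟨L, hL0, hL⟩ := lipschitz_of_pd_bounded sk fun j => (dk.pd j).decays.mono (by norm_num)
  -- Here 9/4 is three quarters of the decay 3, and 13/8 = 3/2 + 1/8. With γ = 3/2 the critical sum
  -- is 1/2 + 11/8 = 15/8 < 2; only boundedness in y is used afterwards.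
  obtain ⟨C, hC0, hC⟩ := exists_parab_integral_le (m := 9 / 4) (e := 13 / 8) (γ := 3 / 2)
    (by norm_num) (by norm_num) (by norm_num) (by norm_num) (by norm_num)
  obtain ⟨C', -, hC'⟩ := exists_potIntegrand_le hk dk.decays (γ := 2) (by norm_num) le_rfl
  have hdiff : ∀ u v, |k u - k v| ≤ L ^ (1 / 4 : ℝ) * D ^ (3 / 4 : ℝ) * ‖u - v‖ ^ (1 / 4 : ℝ) *
      (bracket u ^ (-(9 / 4) : ℝ) + bracket v ^ (-(9 / 4) : ℝ)) := by
    intro u v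
    have pu := bracket_rpow_pos u (-3)
    have pv := bracket_rpow_pos v (-3)
    have h1 := hL u v
    have h2 : |k u - k v| ≤ D * (bracket u ^ (-3 : ℝ) + bracket v ^ (-3 : ℝ)) := by
      refine (abs_sub _ _).trans ?_
      rw [mul_add]; exact add_le_add (hD u) (hD v)
    have h3 := min_le_rpow_mul_rpow (θ := 1 / 4) (abs_nonneg (k u - k v)) h1 h2 (by norm_num)
      (by norm_num)
    rw [Real.mul_rpow hL0.le (norm_nonneg _), Real.mul_rpow hD0.le (by positivity)] at h3
    have h4 : (bracket u ^ (-3 : ℝ) + bracket v ^ (-3 : ℝ)) ^ (1 - 1 / 4 : ℝ) ≤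
        bracket u ^ (-(9 / 4) : ℝ) + bracket v ^ (-(9 / 4) : ℝ) := by
      refine (Real.rpow_add_le_add_rpow pu.le pv.le (by norm_num) (by norm_num)).trans
        (le_of_eq ?_)
      rw [← Real.rpow_mul (bracket_pos u).le, ← Real.rpow_mul (bracket_pos v).le]
      norm_num
    refine h3.trans ?_
    rw [show (1 - 1 / 4 : ℝ) = 3 / 4 by norm_num] at h4 ⊢
    calc L ^ (1 / 4 : ℝ) * ‖u - v‖ ^ (1 / 4 : ℝ) * (D ^ (3 / 4 : ℝ) *
          (bracket u ^ (-3 : ℝ) + bracket v ^ (-3 : ℝ)) ^ (3 / 4 : ℝ))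
        ≤ L ^ (1 / 4 : ℝ) * ‖u - v‖ ^ (1 / 4 : ℝ) * (D ^ (3 / 4 : ℝ) *
          (bracket u ^ (-(9 / 4) : ℝ) + bracket v ^ (-(9 / 4) : ℝ))) := by gcongr
      _ = _ := by ring
  set K := L ^ (1 / 4 : ℝ) * D ^ (3 / 4 : ℝ)
  have hK0 : 0 < K := by positivity
  refine ⟨K * (C + C), by positivity, fun M f hf y y' => ?_⟩
  have hM := hf.nonneg
  set h := ‖y - y'‖ ^ (1 / 4 : ℝ)
  have hh : 0 ≤ h := Real.rpow_nonneg (norm_nonneg _) _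
  set G : Plane → ℝ × Plane → ℝ := fun y p =>
    (1 - p.1) ^ (-(13 / 8) : ℝ) * bracket (parab p.1 y p.2) ^ (-(9 / 4) : ℝ) *
      bracket p.2 ^ (-2 : ℝ) with hG
  have hG1 : ∀ y, ∫ p, G y p ∂stMeasure ≤ C := fun y => by
    refine (hC y).2.trans ?_
    have : bracket y ^ (-(3 / 2) : ℝ) ≤ 1 :=
      Real.rpow_le_one_of_one_le_of_nonpos (one_le_bracket y) (by norm_num)
    nlinarith
  rw [stPotential, stPotential, ← integral_sub (hC' M f hf y).1 (hC' M f hf y').1,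
    ← Real.norm_eq_abs]
  have hle : ‖∫ p, (potIntegrand k f y p - potIntegrand k f y' p) ∂stMeasure‖ ≤
      ∫ p, (K * M * h) * (G y p + G y' p) ∂stMeasure := by
    refine norm_integral_le_of_norm_le (((hC y).1.add (hC y').1).const_mul _) ?_
    have h0 : ∀ᵐ p ∂stMeasure, 0 < 1 - p.1 := ae_stMeasure fun s hs z => by
      change 0 < 1 - s; linarith [hs.2]
    filter_upwards [h0, ae_stMeasure_snd hf.le] with p h1 h2
    have e1 : parab p.1 y p.2 - parab p.1 y' p.2 = (√(1 - p.1))⁻¹ • (y - y') := by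
      simp only [parab]; module
    have e2 : ‖(√(1 - p.1))⁻¹ • (y - y')‖ ^ (1 / 4 : ℝ) = (1 - p.1) ^ (-(1 / 8) : ℝ) * h := by
      rw [norm_smul, Real.mul_rpow (norm_nonneg _) (norm_nonneg _), norm_inv, Real.norm_eq_abs,
        abs_of_nonneg (Real.sqrt_nonneg _), Real.sqrt_eq_rpow, ← Real.rpow_neg h1.le,
        ← Real.rpow_mul h1.le]
      norm_num [h]
    have e3 : (1 - p.1) ^ (-(13 / 8) : ℝ) =
        (1 - p.1) ^ (-(3 / 2) : ℝ) * (1 - p.1) ^ (-(1 / 8) : ℝ) := by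
      rw [← Real.rpow_add h1]; norm_num
    have h3 := hdiff (parab p.1 y p.2) (parab p.1 y' p.2)
    rw [e1, e2] at h3
    have p1 := Real.rpow_pos_of_pos h1 (-(3 / 2))
    rw [potIntegrand, potIntegrand, ← sub_mul, ← mul_sub, Real.norm_eq_abs, abs_mul, abs_mul,
      abs_of_pos p1]
    calc _ ≤ (1 - p.1) ^ (-(3 / 2) : ℝ) * (K * ((1 - p.1) ^ (-(1 / 8) : ℝ) * h) *
          (bracket (parab p.1 y p.2) ^ (-(9 / 4) : ℝ) +
            bracket (parab p.1 y' p.2) ^ (-(9 / 4) : ℝ))) * (M * bracket p.2 ^ (-2 : ℝ)) := by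
          refine mul_le_mul (mul_le_mul_of_nonneg_left h3 p1.le) h2 (abs_nonneg _) ?_
          exact mul_nonneg p1.le ((abs_nonneg _).trans h3)
      _ = _ := by simp only [hG]; rw [e3]; ring
  refine hle.trans ?_
  rw [integral_const_mul, integral_add (hC y).1 (hC y').1]
  calc K * M * h * _ ≤ K * M * h * (C + C) :=
        mul_le_mul_of_nonneg_left (add_le_add (hG1 y) (hG1 y')) (by positivity)
    _ = _ := by ring

/-! ### The solution operator -/

/-- The `i`-th component of `-∫₀¹ e^{(1-s)Δ} ℙ div (s⁻¹ F(·/√s)) ds`. -/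
def solComp (F : Fin 2 → Fin 2 → Plane → ℝ) (i : Fin 2) (y : Plane) : ℝ :=
  -∑ j, ∑ k, stPotential (oseen i j k) (F j k) y

/-- The vector field with components `solComp F i`. -/
def solField (F : Fin 2 → Fin 2 → Plane → ℝ) (y : Plane) : Plane :=
  WithLp.toLp 2 fun i => solComp F i y

theorem solField_apply (F : Fin 2 → Fin 2 → Plane → ℝ) (y : Plane) (i : Fin 2) :
    solField F y i = solComp F i y := rfl

theorem norm_le_sum_abs (v : Plane) : ‖v‖ ≤ ∑ i, |v i| := by
  rw [Fin.sum_univ_two]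
  refine abs_le_of_sq_le_sq' ?_ (by positivity) |>.2
  rw [EuclideanSpace.norm_sq_eq, Fin.sum_univ_two, Real.norm_eq_abs, Real.norm_eq_abs]
  nlinarith [mul_nonneg (abs_nonneg (v 0)) (abs_nonneg (v 1))]

theorem exists_norm_solField_le {γ : ℝ} (hγ1 : 1 < γ) (hγ2 : γ ≤ 2) : ∃ C, 0 < C ∧
    ∀ (M : ℝ) (F : Fin 2 → Fin 2 → Plane → ℝ), (∀ j k, QuadDecay M (F j k)) →
      ∀ y, ‖solField F y‖ ≤ C * M * bracket y ^ (-γ) := by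
  choose C hC0 hC using fun i j k : Fin 2 => exists_stPotential_le
    (contDiff_oseen i j k).continuous (isSymbol_oseen 0 i j k).decays hγ1 hγ2
  refine ⟨∑ i, ∑ j, ∑ k, C i j k, Finset.sum_pos (fun i _ => Finset.sum_pos (fun j _ =>
    Finset.sum_pos (fun k _ => hC0 i j k) ⟨0, Finset.mem_univ _⟩) ⟨0, Finset.mem_univ _⟩)
    ⟨0, Finset.mem_univ _⟩, fun M F hF y => ?_⟩
  refine (norm_le_sum_abs _).trans ?_
  simp only [Finset.sum_mul, solField_apply, solComp, abs_neg]
  refine Finset.sum_le_sum fun i _ => (Finset.abs_sum_le_sum_abs _ _).trans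
    (Finset.sum_le_sum fun j _ => (Finset.abs_sum_le_sum_abs _ _).trans
    (Finset.sum_le_sum fun k _ => hC i j k M _ (hF j k) y))

theorem exists_solField_holder : ∃ C, 0 < C ∧
    ∀ (M : ℝ) (F : Fin 2 → Fin 2 → Plane → ℝ), (∀ j k, QuadDecay M (F j k)) →
      ∀ y y', ‖solField F y - solField F y'‖ ≤ C * M * ‖y - y'‖ ^ (1 / 4 : ℝ) := by
  choose C hC0 hC using fun i j k : Fin 2 => exists_stPotential_holder
    (contDiff_oseen i j k) (isSymbol_oseen 1 i j k)
  refine ⟨∑ i, ∑ j, ∑ k, C i j k, Finset.sum_pos (fun i _ => Finset.sum_pos (fun j _ =>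
    Finset.sum_pos (fun k _ => hC0 i j k) ⟨0, Finset.mem_univ _⟩) ⟨0, Finset.mem_univ _⟩)
    ⟨0, Finset.mem_univ _⟩, fun M F hF y y' => ?_⟩
  refine (norm_le_sum_abs _).trans ?_
  simp only [Finset.sum_mul, PiLp.sub_apply, solField_apply, solComp]
  refine Finset.sum_le_sum fun i _ => ?_
  rw [neg_sub_neg, abs_sub_comm, ← Finset.sum_sub_distrib]
  refine (Finset.abs_sum_le_sum_abs _ _).trans (Finset.sum_le_sum fun j _ => ?_)
  rw [← Finset.sum_sub_distrib]
  exact (Finset.abs_sum_le_sum_abs _ _).trans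
    (Finset.sum_le_sum fun k _ => hC i j k M _ (hF j k) y y')

theorem solField_sub {M N : ℝ} {F G : Fin 2 → Fin 2 → Plane → ℝ}
    (hF : ∀ j k, QuadDecay M (F j k)) (hG : ∀ j k, QuadDecay N (G j k)) (y : Plane) :
    solField (fun j k z => F j k z - G j k z) y = solField F y - solField G y := by
  ext i
  simp only [PiLp.sub_apply, solField_apply, solComp,
    stPotential_sub (contDiff_oseen i _ _).continuous (isSymbol_oseen 0 i _ _).decays
      (hF _ _) (hG _ _), Finset.sum_sub_distrib]
  ring

/-! ### The weak form of the equation for the potentials -/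

theorem sqrt_pos_of_mem {s : ℝ} (hs : s ∈ Set.Ioo (0 : ℝ) 1) : 0 < √s ∧ 0 < √(1 - s) :=
  ⟨Real.sqrt_pos.2 hs.1, Real.sqrt_pos.2 (by linarith [hs.2])⟩

theorem parab_eq_affine_right (s : ℝ) (y z : Plane) :
    parab s y z = (-((√(1 - s))⁻¹ * √s)) • z + (√(1 - s))⁻¹ • y := by
  simp only [parab]; module

theorem parab_eq_affine_left (s : ℝ) (y z : Plane) :
    parab s y z = (√(1 - s))⁻¹ • y + -((√(1 - s))⁻¹ • √s • z) := by
  simp only [parab]; module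

theorem continuous_parab (s : ℝ) : Continuous fun p : Plane × Plane => parab s p.1 p.2 := by
  unfold parab; fun_prop

/-- For fixed s, ⟨z⟩ ≤ K⟨y⟩⟨`parab`⟩ converts decay of k into ⟨z⟩⁻², which pairs with an L²
function, and growth in y, which is harmless on the support of η. Only f in L² is assumed, because
the pressure has no pointwise bound. -/
theorem integrable_slice {f k η : Plane → ℝ} (hf : MemLp f 2) (hk : Continuous k)
    (dk : Decays (-2) k) (hη : Continuous η) (cη : HasCompactSupport η) {s : ℝ}
    (hs : s ∈ Set.Ioo (0 : ℝ) 1) : Integrable (Function.uncurry fun y z : Plane =>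
      η y * (f z * k (parab s y z))) (volume.prod volume) := by
  obtain ⟨h1, h2⟩ := sqrt_pos_of_mem hs
  obtain ⟨C, hC0, hC⟩ := dk.exists_pos
  set r := (√(1 - s))⁻¹
  have hr : 0 < r := inv_pos.2 h2
  set K := 1 + (1 + r) / (r * √s)
  have hK0 : 0 < K := by positivity
  have hz : ∀ y z, bracket z ≤ K * bracket y * bracket (parab s y z) := by
    intro y z
    rw [parab_eq_affine_right]
    have := bracket_le_affine (c₀ := r * √s) (B := r * ‖y‖) (c := -(r * √s)) (b := r • y)
      (by positivity) (by rw [abs_neg]; exact le_abs_self _)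
      (by rw [norm_smul, Real.norm_eq_abs, abs_of_pos hr]) z
    refine this.trans (mul_le_mul_of_nonneg_right ?_ (bracket_pos _).le)
    have hy := one_le_bracket y
    have hy2 := norm_le_bracket y
    have e : (1 + r * ‖y‖) / (r * √s) ≤ (1 + r) / (r * √s) * bracket y := by
      rw [div_mul_eq_mul_div]
      gcongr
      nlinarith
    calc _ ≤ bracket y + (1 + r) / (r * √s) * bracket y := add_le_add hy e
      _ = _ := by ring
  have i1 : Integrable fun x : Plane => |η x| * bracket x ^ (2 : ℝ) :=
    (hη.abs.mul (continuous_bracket_rpow 2)).integrable_of_hasCompactSupport cη.norm.mul_right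
  have i2 : Integrable fun z : Plane => |f z| * bracket z ^ (-2 : ℝ) :=
    hf.abs.integrable_mul (memLp_two_bracket_rpow (by norm_num))
  refine ((i1.mul_prod i2).const_mul (C * K ^ (2 : ℝ))).mono' ?_ (ae_of_all _ fun p => ?_)
  · exact (hη.comp continuous_fst).aestronglyMeasurable.mul
      (hf.1.comp_snd.mul (hk.comp (continuous_parab s)).aestronglyMeasurable)
  · have h3 := hC (parab s p.1 p.2)
    have pu := bracket_pos (parab s p.1 p.2)
    have pz := bracket_pos p.2
    have py := bracket_pos p.1
    have h4 : bracket (parab s p.1 p.2) ^ (-2 : ℝ) ≤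
        K ^ (2 : ℝ) * bracket p.1 ^ (2 : ℝ) * bracket p.2 ^ (-2 : ℝ) := by
      have h5 := Real.rpow_le_rpow pz.le (hz p.1 p.2) (by norm_num : (0 : ℝ) ≤ 2)
      rw [Real.mul_rpow (by positivity) pu.le, Real.mul_rpow hK0.le py.le] at h5
      rw [Real.rpow_neg pu.le, Real.rpow_neg pz.le, ← div_eq_mul_inv,
        le_div_iff₀ (bracket_rpow_pos _ _), inv_mul_le_iff₀ (bracket_rpow_pos _ _)]
      linarith
    simp only [Function.uncurry, norm_mul, Real.norm_eq_abs]
    calc |η p.1| * (|f p.2| * |k (parab s p.1 p.2)|)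
        ≤ |η p.1| * (|f p.2| *
          (C * (K ^ (2 : ℝ) * bracket p.1 ^ (2 : ℝ) * bracket p.2 ^ (-2 : ℝ)))) := by
          gcongr
          exact h3.trans (mul_le_mul_of_nonneg_left h4 hC0.le)
      _ = _ := by ring

theorem slice_swap {f k η : Plane → ℝ} (hf : MemLp f 2) (hk : Continuous k)
    (dk : Decays (-2) k) (hη : Continuous η) (cη : HasCompactSupport η) {s : ℝ}
    (hs : s ∈ Set.Ioo (0 : ℝ) 1) :
    ∫ z, f z * ∫ y, η y * k (parab s y z) = ∫ y, η y * ∫ z, f z * k (parab s y z) := by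
  have h := integral_integral_swap (integrable_slice hf hk dk hη cη hs)
  simp only [integral_const_mul] at h
  rw [h]
  refine integral_congr_ae (ae_of_all _ fun z => ?_)
  simp only [← integral_const_mul]
  refine integral_congr_ae (ae_of_all _ fun y => ?_)
  simp only
  ring

theorem integral_mul_pd_gauss_parab {η : Plane → ℝ} (sη : ContDiff ℝ ∞ η)
    (cη : HasCompactSupport η) (j : Fin 2) {s : ℝ} (hs : s ∈ Set.Ioo (0 : ℝ) 1) (z : Plane) :
    ∫ y, η y * pd j gauss (parab s y z) =
      -(√(1 - s) * ∫ y, pd j η y * gauss (parab s y z)) := by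
  obtain ⟨-, h2⟩ := sqrt_pos_of_mem hs
  set b := -((√(1 - s))⁻¹ • √s • z)
  have aff : ContDiff ℝ ∞ fun y : Plane => (√(1 - s))⁻¹ • y + b := by fun_prop
  have h := integral_mul_pd (contDiff_gauss.comp aff) sη cη j
  simp only [Function.comp_def, pd_comp_affine (differentiable_of_smooth contDiff_gauss)] at h
  have e : ∀ y, parab s y z = (√(1 - s))⁻¹ • y + b := fun y => parab_eq_affine_left s y z
  simp only [e, mul_comm (η _), mul_comm (pd j η _), h, mul_assoc, integral_const_mul]
  rw [mul_neg, neg_neg, mul_inv_cancel_left₀ h2.ne']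

theorem integral_mul_gauss_parab (η : Plane → ℝ) {s : ℝ} (hs : s ∈ Set.Ioo (0 : ℝ) 1)
    (z : Plane) : ∫ y, η y * gauss (parab s y z) =
      (1 - s) * mollify (√(1 - s)) η (√s • z) := by
  obtain ⟨-, h2⟩ := sqrt_pos_of_mem hs
  have h := integral_gauss_scaled_mul η h2 (√s • z)
  rw [Real.sq_sqrt (by linarith [hs.2])] at h
  rw [← h]
  exact integral_congr_ae (ae_of_all _ fun y => mul_comm _ _)

theorem integrable_mul_potIntegrand {k f η : Plane → ℝ} (hk : Continuous k) (dk : Decays (-3) k)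
    {M : ℝ} (hf : QuadDecay M f) (hη : Continuous η) (cη : HasCompactSupport η) :
    Integrable (Function.uncurry fun y p => η y * potIntegrand k f y p)
      ((volume : Measure Plane).prod stMeasure) := by
  obtain ⟨C, hC0, hC⟩ := exists_potIntegrand_le hk dk (γ := 2) (by norm_num) le_rfl
  have hM := hf.nonneg
  have hm : AEStronglyMeasurable (Function.uncurry fun y p => η y * potIntegrand k f y p)
      ((volume : Measure Plane).prod stMeasure) := by
    have h1 : Measurable fun p : Plane × ℝ × Plane =>
        (1 - p.2.1) ^ (-(3 / 2) : ℝ) * k (parab p.2.1 p.1 p.2.2) :=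
      ((measurable_const.sub measurable_snd.fst).pow_const _).mul
        (hk.measurable.comp measurable_parab')
    have h2 : AEStronglyMeasurable (fun p : ℝ × Plane => f p.2) stMeasure := hf.aesm.comp_snd
    exact (hη.comp continuous_fst).aestronglyMeasurable.mul
      (h1.aestronglyMeasurable.mul h2.comp_snd)
  rw [integrable_prod_iff hm]
  refine ⟨ae_of_all _ fun y => (hC M f hf y).1.const_mul (η y), ?_⟩
  have i1 : Integrable fun y : Plane => |η y| * (C * M * bracket y ^ (-2 : ℝ)) :=
    (hη.abs.mul ((continuous_bracket_rpow (-2)).const_mul (C * M))).integrable_of_hasCompactSupport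
      cη.norm.mul_right
  refine i1.mono' hm.norm.integral_prod_right' (ae_of_all _ fun y => ?_)
  rw [Real.norm_eq_abs, abs_of_nonneg (integral_nonneg fun p => norm_nonneg _)]
  simp only [Function.uncurry, norm_mul, Real.norm_eq_abs, integral_const_mul]
  exact mul_le_mul_of_nonneg_left (hC M f hf y).2 (abs_nonneg _)

/-- Fubini's theorem for the pairing of a potential with a function of compact support. -/
theorem integral_mul_stPotential {k f η : Plane → ℝ} (hk : Continuous k) (dk : Decays (-3) k)
    {M : ℝ} (hf : QuadDecay M f) (hη : Continuous η) (cη : HasCompactSupport η) :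
    IntegrableOn (fun s : ℝ => (1 - s) ^ (-(3 / 2) : ℝ) *
      ∫ z, f z * ∫ y, η y * k (parab s y z)) (Set.Ioo 0 1) ∧
    ∫ y, η y * stPotential k f y = ∫ s in Set.Ioo (0 : ℝ) 1, (1 - s) ^ (-(3 / 2) : ℝ) *
      ∫ z, f z * ∫ y, η y * k (parab s y z) := by
  have hi := integrable_mul_potIntegrand hk dk hf hη cη
  have e : ∀ p : ℝ × Plane, ∫ y, η y * potIntegrand k f y p =
      (1 - p.1) ^ (-(3 / 2) : ℝ) * (f p.2 * ∫ y, η y * k (parab p.1 y p.2)) := by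
    intro p
    rw [← integral_const_mul, ← integral_const_mul]
    refine integral_congr_ae (ae_of_all _ fun y => ?_)
    simp only [potIntegrand]
    ring
  have h2 : Integrable (fun p : ℝ × Plane => (1 - p.1) ^ (-(3 / 2) : ℝ) *
      (f p.2 * ∫ y, η y * k (parab p.1 y p.2))) stMeasure := by
    have := hi.integral_prod_right
    simpa only [Function.uncurry, e] using this
  constructor
  · refine (Integrable.integral_prod_left h2).congr (ae_of_all _ fun s => ?_)
    exact integral_const_mul ((1 - s) ^ (-(3 / 2) : ℝ)) fun z => f z * ∫ y, η y * k (parab s y z)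
  · have h := integral_integral_swap hi
    simp only [e] at h
    have e' : ∀ y, η y * stPotential k f y = ∫ p, η y * potIntegrand k f y p ∂stMeasure :=
      fun y => (integral_const_mul _ _).symm
    rw [funext e', h, stMeasure, integral_prod _ h2]
    exact integral_congr_ae (ae_of_all _ fun s =>
      integral_const_mul ((1 - s) ^ (-(3 / 2) : ℝ)) fun z => f z * ∫ y, η y * k (parab s y z))

/-- Pairing the solution field with a test function, in terms of the total stress. -/
theorem integral_mul_solComp {F : Fin 2 → Fin 2 → Plane → ℝ} {q : Plane → ℝ} {M : ℝ}
    (hF : ∀ j k, QuadDecay M (F j k)) (hq : IsPressure F q) (i : Fin 2) {η : Plane → ℝ}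
    (sη : ContDiff ℝ ∞ η) (cη : HasCompactSupport η) :
    ∫ y, η y * solComp F i y = ∫ s in Set.Ioo (0 : ℝ) 1,
      ∑ j, ∫ z, stress F q i j z * mollify (√(1 - s)) (pd j η) (√s • z) := by
  have ck := fun j k => (contDiff_oseen i j k).continuous
  have dk := fun j k => (isSymbol_oseen 0 i j k).decays
  have hη := sη.continuous
  have I := fun j k => integral_mul_stPotential (ck j k) (dk j k) (hF j k) hη cη
  have hint : ∀ j k, Integrable fun y => η y * stPotential (oseen i j k) (F j k) y := fun j k => by
    refine (integrable_mul_potIntegrand (ck j k) (dk j k) (hF j k) hη cη).integral_prod_left.congr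
      (ae_of_all _ fun y => ?_)
    exact integral_const_mul (η y) (potIntegrand (oseen i j k) (F j k) y)
  have e1 : ∫ y, η y * solComp F i y =
      -∑ j, ∑ k, ∫ y, η y * stPotential (oseen i j k) (F j k) y := by
    simp only [solComp, mul_neg, Finset.mul_sum, integral_neg]
    rw [integral_finsetSum _ fun j _ => integrable_finsetSum _ fun k _ => hint j k]
    simp only [integral_finsetSum _ fun k _ => hint _ k]
  rw [e1]
  simp only [(I _ _).2]
  have e2 : ∑ j, ∑ k, ∫ s in Set.Ioo (0 : ℝ) 1, (1 - s) ^ (-(3 / 2) : ℝ) *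
      (∫ z, F j k z * ∫ y, η y * oseen i j k (parab s y z)) =
      ∫ s in Set.Ioo (0 : ℝ) 1, ∑ j, ∑ k, (1 - s) ^ (-(3 / 2) : ℝ) *
      (∫ z, F j k z * ∫ y, η y * oseen i j k (parab s y z)) := by
    rw [integral_finsetSum _ fun j _ => integrable_finsetSum _ fun k _ => (I j k).1]
    simp only [integral_finsetSum _ fun k _ => (I _ k).1]
  rw [e2, ← integral_neg]
  refine setIntegral_congr_fun measurableSet_Ioo fun s hs => ?_
  obtain ⟨h1, h2⟩ := sqrt_pos_of_mem hs
  have ht : 0 < 1 - s := by linarith [hs.2]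
  have hc : -((√(1 - s))⁻¹ * √s) ≠ 0 := neg_ne_zero.2 (by positivity)
  simp only [← Finset.mul_sum]
  -- Exchanging y and z at fixed s exposes the z-pairing to which `IsPressure.oseen_eq` applies. The
  -- nonlocal kernel disappears and the pressure enters through the total stress.
  have e3 : ∑ j, ∑ k, ∫ z, F j k z * ∫ y, η y * oseen i j k (parab s y z) =
      ∑ j, ∫ z, stress F q i j z * ∫ y, η y * pd j gauss (parab s y z) := by
    have dg := fun j => ((isSymbol_gauss 1 (-1)).pd j).decays.mono (b := -2) (by norm_num)
    have cg := fun j => (contDiff_pd contDiff_gauss j).continuous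
    simp only [slice_swap (hF _ _).memLp (ck _ _) ((dk _ _).mono (by norm_num)) hη cη hs,
      slice_swap (hq.memLp_total i _) (cg _) (dg _) hη cη hs]
    have i1 : ∀ j k, Integrable fun y => η y * ∫ z, F j k z * oseen i j k (parab s y z) :=
      fun j k => by
        have := (integrable_slice (hF j k).memLp (ck j k) ((dk j k).mono (by norm_num)) hη cη
          hs).integral_prod_left
        simpa only [Function.uncurry, integral_const_mul] using this
    have i2 : ∀ j, Integrable fun y => η y * ∫ z, stress F q i j z * pd j gauss (parab s y z) :=
      fun j => by
        have := (integrable_slice (hq.memLp_total i j) (cg j) (dg j) hη cη hs).integral_prod_left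
        simpa only [Function.uncurry, integral_const_mul] using this
    rw [← integral_finsetSum _ fun j _ => i2 j]
    simp only [← integral_finsetSum _ fun k _ => i1 _ k]
    rw [← integral_finsetSum _ fun j _ => integrable_finsetSum _ fun k _ => i1 j k]
    refine integral_congr_ae (ae_of_all _ fun y => ?_)
    simp only [← Finset.mul_sum, parab_eq_affine_right]
    rw [hq.oseen_eq i hc]
  rw [e3, Finset.mul_sum, ← Finset.sum_neg_distrib]
  refine Finset.sum_congr rfl fun j _ => ?_
  simp only [integral_mul_pd_gauss_parab sη cη j hs, integral_mul_gauss_parab _ hs]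
  rw [← integral_const_mul, ← integral_neg]
  refine integral_congr_ae (ae_of_all _ fun z => ?_)
  -- The prefactor of the potential cancels against √(1-s) from the integration by parts and 1 − s
  -- from the normalisation of the Gaussian mean.
  have e4 : (1 - s) ^ (-(3 / 2) : ℝ) * (√(1 - s) * (1 - s)) = 1 := by
    have : √(1 - s) * (1 - s) = (1 - s) ^ (3 / 2 : ℝ) := by
      rw [Real.sqrt_eq_rpow, ← Real.rpow_add_one ht.ne']; norm_num
    rw [this, ← Real.rpow_add ht]; norm_num
  simp only
  generalize mollify (√(1 - s)) (pd j η) (√s • z) = Q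
  calc -((1 - s) ^ (-(3 / 2) : ℝ) * (stress F q i j z * -(√(1 - s) * ((1 - s) * Q))))
      = ((1 - s) ^ (-(3 / 2) : ℝ) * (√(1 - s) * (1 - s))) * (stress F q i j z * Q) := by ring
    _ = _ := by rw [e4, one_mul]

/-- The solution field is divergence free. -/
theorem sum_integral_solComp_mul_pd {F : Fin 2 → Fin 2 → Plane → ℝ} {q : Plane → ℝ}
    (hq : IsPressure F q) {ψ : Plane → ℝ}
    (sψ : ContDiff ℝ ∞ ψ) (cψ : HasCompactSupport ψ) :
    ∫ s in Set.Ioo (0 : ℝ) 1, ∑ i,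
      ∑ j, ∫ z, stress F q i j z * mollify (√(1 - s)) (pd j (pd i ψ)) (√s • z) = 0 := by
  have : ∀ s ∈ Set.Ioo (0 : ℝ) 1, ∑ i,
      ∑ j, ∫ z, stress F q i j z * mollify (√(1 - s)) (pd j (pd i ψ)) (√s • z) = 0 := by
    intro s hs
    obtain ⟨h1, h2⟩ := sqrt_pos_of_mem hs
    have ht : 0 < 1 - s := by linarith [hs.2]
    have hc : -((√(1 - s))⁻¹ * √s) ≠ 0 := neg_ne_zero.2 (by positivity)
    -- Both derivatives are moved from ψ to the Gaussian. They contribute one factor (1-s)⁻¹ and the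
    -- normalisation of the mean the other; the sum over i and j then vanishes by
    -- `IsPressure.hessian_eq_zero`.
    have e1 : ∀ i j z, mollify (√(1 - s)) (pd j (pd i ψ)) (√s • z) =
        ((1 - s)⁻¹ * (1 - s)⁻¹) * ∫ y, ψ y * pd i (pd j gauss) (parab s y z) := by
      intro i j z
      set b := -((√(1 - s))⁻¹ • √s • z)
      have aff : ContDiff ℝ ∞ fun y : Plane => (√(1 - s))⁻¹ • y + b := by fun_prop
      have sg := contDiff_gauss.comp aff
      have g1 := integral_mul_pd sg (contDiff_pd sψ i) (hasCompactSupport_pd cψ i) j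
      have g2 := integral_mul_pd (contDiff_pd sg j) sψ cψ i
      rw [g2, neg_neg] at g1
      simp only [Function.comp_def, pd_pd_comp_affine contDiff_gauss] at g1
      have hm := integral_mul_gauss_parab (pd j (pd i ψ)) hs z
      have e : ∀ y, parab s y z = (√(1 - s))⁻¹ • y + b := fun y => parab_eq_affine_left s y z
      simp only [e, mul_comm (pd j (pd i ψ) _), g1, mul_assoc, integral_const_mul, inv_pow,
        Real.sq_sqrt ht.le] at hm
      simp only [e, mul_comm (ψ _)]
      rw [mul_assoc, hm]
      field_simp
    have sg2 := fun i j => contDiff_pd (contDiff_pd contDiff_gauss j) i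
    have dg := fun i j => (((isSymbol_gauss 2 0).pd j).pd i).decays.mono (b := -2) (by norm_num)
    have i1 : ∀ i j, Integrable fun y =>
        ψ y * ∫ z, stress F q i j z * pd i (pd j gauss) (parab s y z) := fun i j => by
      have := (integrable_slice (hq.memLp_total i j) (sg2 i j).continuous (dg i j) sψ.continuous cψ
        hs).integral_prod_left
      simpa only [Function.uncurry, integral_const_mul] using this
    simp only [e1, mul_left_comm (stress F q _ _ _), integral_const_mul, ← Finset.mul_sum,
      slice_swap (hq.memLp_total _ _) (sg2 _ _).continuous (dg _ _) sψ.continuous cψ hs]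
    simp only [← integral_finsetSum _ fun j _ => i1 _ j]
    rw [← integral_finsetSum _ fun i _ => integrable_finsetSum _ fun j _ => i1 i j]
    simp only [← Finset.mul_sum, parab_eq_affine_right, hq.hessian_eq_zero hc, mul_zero,
      integral_zero]
  rw [setIntegral_congr_fun measurableSet_Ioo this]
  simp

/-! ### The evolution of a test function along the backward flow -/

/-- The operator `χ ↦ Δχ - χ - ½ y · ∇χ`, for which `∂ⱼ (ℒ* ψ) = ℒ₁* (∂ⱼ ψ)`. -/
def lerayAdjGrad (f : Plane → ℝ) : Plane → ℝ := fun y =>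
  lapl f y - f y - (1 / 2) * ∑ k, y k * pd k f y

/-- The commutator of ∂ⱼ with y · ∇ is ∂ⱼ, which raises the zeroth-order coefficient from ½ to 1. -/
theorem pd_lerayAdj {f : Plane → ℝ} (hf : ContDiff ℝ ∞ f) (j : Fin 2) :
    pd j (lerayAdj f) = lerayAdjGrad (pd j f) := by
  have d := fun k => differentiable_of_smooth (contDiff_pd hf k)
  have d2 := fun k l => differentiable_of_smooth (contDiff_pd (contDiff_pd hf k) l)
  have df := differentiable_of_smooth hf
  have dl := differentiable_of_smooth (contDiff_lapl hf)
  have dc : ∀ k : Fin 2, Differentiable ℝ fun y : Plane => y k * pd k f y := fun k =>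
    (differentiable_coord k).mul (d k)
  have ds : Differentiable ℝ fun y : Plane => ∑ k, y k * pd k f y :=
    Differentiable.fun_sum fun k _ => dc k
  have e1 : pd j (lapl f) = lapl (pd j f) := by
    unfold lapl
    rw [pd_sum _ (fun k => d2 k k)]
    simp only [pd_comm (contDiff_pd hf _) j, pd_comm hf j]
  have e2 : pd j (fun y : Plane => ∑ k, y k * pd k f y) =
      fun y => pd j f y + ∑ k, y k * pd k (pd j f) y := by
    rw [pd_sum _ dc]
    funext y
    simp only [pd_mul (differentiable_coord _) (d _), pd_coord, pd_comm hf j,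
      Finset.sum_add_distrib, ite_mul, one_mul, zero_mul, Finset.sum_ite_eq', Finset.mem_univ,
      if_true]
  unfold lerayAdj
  rw [pd_sub (f := fun y => lapl f y - 1 / 2 * f y) (dl.sub (df.const_mul _)) (ds.const_mul _),
    pd_sub dl (df.const_mul _), pd_const_mul df, pd_const_mul ds, e1, e2]
  funext y
  simp only [lerayAdjGrad]
  ring

theorem contDiff_lerayAdjGrad {f : Plane → ℝ} (hf : ContDiff ℝ ∞ f) :
    ContDiff ℝ ∞ (lerayAdjGrad f) :=
  ((contDiff_lapl hf).sub hf).sub (contDiff_const.mul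
    (ContDiff.sum fun k _ => (contDiff_coord k).mul (contDiff_pd hf k)))

theorem hasCompactSupport_lerayAdjGrad {f : Plane → ℝ} (hf : HasCompactSupport f) :
    HasCompactSupport (lerayAdjGrad f) := by
  have h3 : HasCompactSupport fun y : Plane => (1 / 2 : ℝ) * ∑ j, y j * pd j f y := by
    have a : ∀ j, HasCompactSupport fun y : Plane => y j * pd j f y := fun j =>
      (hasCompactSupport_pd hf j).mul_left
    simp only [Fin.sum_univ_two]
    exact ((a 0).add (a 1)).mul_left
  exact ((hasCompactSupport_lapl hf).sub hf).sub h3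

/-- In the plane ½ div (y g) = g + ½ y · ∇g, so the zeroth-order terms cancel and the transpose of
`lerayAdjGrad` is Δ + ½ y · ∇. The right-hand side is this operator evaluated on the Gaussian. -/
theorem integral_gauss_affine_mul_lerayAdjGrad {χ : Plane → ℝ} (sχ : ContDiff ℝ ∞ χ)
    (cχ : HasCompactSupport χ) (c : ℝ) (b : Plane) :
    ∫ y, gauss (c • y + b) * lerayAdjGrad χ y =
      ∫ y, χ y * ((c ^ 2 * (‖c • y + b‖ ^ 2 / 4 - 1) - 1 / 4 * c * inner ℝ (c • y + b) y) *
        gauss (c • y + b)) := by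
  have aff : ContDiff ℝ ∞ fun x : Plane => c • x + b := by fun_prop
  have sG : ContDiff ℝ ∞ fun y : Plane => gauss (c • y + b) := contDiff_gauss.comp aff
  have dG := differentiable_of_smooth sG
  have int : ∀ {u v : Plane → ℝ}, ContDiff ℝ ∞ u → ContDiff ℝ ∞ v → HasCompactSupport v →
      Integrable fun y => u y * v y := fun hu hv hc =>
    (hu.continuous.mul hv.continuous).integrable_of_hasCompactSupport hc.mul_left
  have k1 : ∀ k, ∫ y, gauss (c • y + b) * pd k (pd k χ) y =
      ∫ y, (c ^ 2 * pd k (pd k gauss) (c • y + b)) * χ y := fun k => by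
    rw [integral_mul_pd sG (contDiff_pd sχ k) (hasCompactSupport_pd cχ k) k,
      integral_mul_pd (contDiff_pd sG k) sχ cχ k, neg_neg]
    simp only [pd_pd_comp_affine contDiff_gauss]
  have sy : ∀ k : Fin 2, ContDiff ℝ ∞ fun y : Plane => y k * gauss (c • y + b) := fun k =>
    (contDiff_coord k).mul sG
  have k2 : ∀ k : Fin 2, ∫ y : Plane, (y k * gauss (c • y + b)) * pd k χ y =
      -∫ y : Plane, (gauss (c • y + b) + y k * (c * pd k gauss (c • y + b))) * χ y := fun k => by
    rw [integral_mul_pd (sy k) sχ cχ k, pd_mul (differentiable_coord k) dG,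
      pd_comp_affine (differentiable_of_smooth contDiff_gauss)]
    simp [pd_coord]
  have s1 : ∀ k, ContDiff ℝ ∞ fun y : Plane => c ^ 2 * pd k (pd k gauss) (c • y + b) := fun k =>
    contDiff_const.mul ((contDiff_pd (contDiff_pd contDiff_gauss k) k).comp aff)
  have s2 : ∀ k : Fin 2, ContDiff ℝ ∞ fun y : Plane =>
      gauss (c • y + b) + y k * (c * pd k gauss (c • y + b)) := fun k =>
    sG.add ((contDiff_coord k).mul (contDiff_const.mul ((contDiff_pd contDiff_gauss k).comp aff)))
  have e1 : ∫ y, gauss (c • y + b) * lerayAdjGrad χ y =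
      (∑ k, ∫ y, gauss (c • y + b) * pd k (pd k χ) y) - (∫ y, gauss (c • y + b) * χ y) -
        1 / 2 * ∑ k : Fin 2, ∫ y : Plane, (y k * gauss (c • y + b)) * pd k χ y := by
    have j1 := fun k => int sG (contDiff_pd (contDiff_pd sχ k) k)
      (hasCompactSupport_pd (hasCompactSupport_pd cχ k) k)
    have j2 := int sG sχ cχ
    have j3 := fun k => int (sy k) (contDiff_pd sχ k) (hasCompactSupport_pd cχ k)
    have j4 : Integrable fun y => ∑ k, gauss (c • y + b) * pd k (pd k χ) y -
        gauss (c • y + b) * χ y := (integrable_finsetSum _ fun k _ => j1 k).sub j2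
    rw [← integral_finsetSum _ fun k _ => j1 k, ← integral_finsetSum _ fun k _ => j3 k,
      ← integral_const_mul, ← integral_sub (integrable_finsetSum _ fun k _ => j1 k) j2,
      ← integral_sub j4 ((integrable_finsetSum _ fun k _ => j3 k).const_mul _)]
    refine integral_congr_ae (ae_of_all _ fun y => ?_)
    simp only [lerayAdjGrad, lapl, Fin.sum_univ_two]
    ring
  rw [e1]
  simp only [k1, k2, Finset.sum_neg_distrib, mul_neg, sub_neg_eq_add]
  have j1 := fun k => int (s1 k) sχ cχ
  have j2 := int sG sχ cχ
  have j3 := fun k => int (s2 k) sχ cχ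
  have j4 : Integrable fun y => ∑ k, (c ^ 2 * pd k (pd k gauss) (c • y + b)) * χ y -
      gauss (c • y + b) * χ y := (integrable_finsetSum _ fun k _ => j1 k).sub j2
  rw [← integral_finsetSum _ fun k _ => j1 k, ← integral_finsetSum _ fun k _ => j3 k,
    ← integral_const_mul, ← integral_sub (integrable_finsetSum _ fun k _ => j1 k) j2,
    ← integral_add j4 ((integrable_finsetSum _ fun k _ => j3 k).const_mul _)]
  refine integral_congr_ae (ae_of_all _ fun y => ?_)
  have hl := congrFun lapl_gauss (c • y + b)
  simp only [lapl] at hl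
  simp only [← Finset.sum_mul, ← Finset.mul_sum, hl, inner_eq_sum]
  simp only [pd_gauss, Fin.sum_univ_two]
  ring

/-- Write E for e^((1-s)Δ) and x = √s z. The derivative of s (Eχ)(√s z) is Eχ − sΔEχ + ½ x · ∇Eχ. By
the commutation E(y · ∇χ) = x · ∇Eχ + 2(1-s)ΔEχ this equals −E(Δχ − χ − ½ y · ∇χ). -/
theorem hasDerivAt_mul_mollify {χ : Plane → ℝ} (sχ : ContDiff ℝ ∞ χ) (cχ : HasCompactSupport χ)
    (z : Plane) {s : ℝ} (hs : s ∈ Set.Ioo (0 : ℝ) 1) :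
    HasDerivAt (fun s => s * mollify (√(1 - s)) χ (√s • z))
      (-mollify (√(1 - s)) (lerayAdjGrad χ) (√s • z)) s := by
  have hm : MemLp χ 2 := sχ.continuous.memLp_of_hasCompactSupport cχ
  -- In this form the parameter s sits only in the Gaussian and its prefactor, so
  -- `hasDerivAt_integral_gauss` differentiates without touching χ.
  have eq : ∀ ψ : Plane → ℝ, ∀ s ∈ Set.Ioo (0 : ℝ) 1, mollify (√(1 - s)) ψ (√s • z) =
      (1 - s)⁻¹ * ∫ y, gauss ((√(1 - s))⁻¹ • y + (-((√(1 - s))⁻¹ * √s)) • z) * ψ y := by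
    intro ψ s hs
    have := integral_mul_gauss_parab ψ hs z
    have ht : 1 - s ≠ 0 := by linarith [hs.2]
    rw [← mul_right_inj' ht, ← this, mul_inv_cancel_left₀ ht]
    refine integral_congr_ae (ae_of_all _ fun y => ?_)
    simp only [parab_eq_affine_left, smul_smul, neg_smul, mul_comm (ψ y)]
  have hnhds : ∀ᶠ s' in 𝓝 s, s' ∈ Set.Ioo (0 : ℝ) 1 := Ioo_mem_nhds hs.1 hs.2
  have dr : ∀ s ∈ Set.Ioo (0 : ℝ) 1, HasDerivAt (fun s => (√(1 - s))⁻¹)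
      (1 / 2 * (√(1 - s))⁻¹ ^ 3) s := by
    intro s hs
    obtain ⟨-, h2⟩ := sqrt_pos_of_mem hs
    have := (((hasDerivAt_id s).const_sub 1).sqrt (by simp only [id]; linarith [hs.2])).inv h2.ne'
    refine this.congr_deriv ?_
    simp only [id]
    field_simp
  have dA : ∀ s ∈ Set.Ioo (0 : ℝ) 1, HasDerivAt (fun s => s * (1 - s)⁻¹) ((1 - s)⁻¹ ^ 2) s := by
    intro s hs
    have ht : 1 - s ≠ 0 := by linarith [hs.2]
    have := (hasDerivAt_id s).mul (((hasDerivAt_id s).const_sub 1).inv ht)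
    refine this.congr_deriv ?_
    simp only [id, Pi.inv_apply]
    field_simp
    ring
  have db : ∀ s ∈ Set.Ioo (0 : ℝ) 1, HasDerivAt (fun s => (-((√(1 - s))⁻¹ * √s)) • z)
      ((-(1 / 2 * (√(1 - s))⁻¹ ^ 3 * (√s)⁻¹)) • z) s := by
    intro s hs
    obtain ⟨h1, h2⟩ := sqrt_pos_of_mem hs
    refine (((dr s hs).mul ((hasDerivAt_id s).sqrt hs.1.ne')).neg.smul_const z).congr_deriv ?_
    congr 1
    have e1 := Real.sq_sqrt hs.1.le
    have e2 : √(1 - s) ^ 2 = 1 - s := Real.sq_sqrt (by linarith [hs.2])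
    simp only [id]
    field_simp
    rw [e1, e2]; ring
  obtain ⟨h1, h2⟩ := sqrt_pos_of_mem hs
  have cr : ContinuousAt (fun s => (√(1 - s))⁻¹) s := (dr s hs).continuousAt
  have key := hasDerivAt_integral_gauss hm (hnhds.mono dA) (hnhds.mono dr) (hnhds.mono db)
    (by
      have : (1 - s) ≠ 0 := by linarith [hs.2]
      fun_prop (disch := assumption))
    ((cr.pow 3).const_mul _)
    ((((cr.pow 3).const_mul _).mul (Real.continuous_sqrt.continuousAt.inv₀ h1.ne')).neg.smul
      continuousAt_const) (inv_pos.2 h2).ne'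
  refine (key.congr_of_eventuallyEq (hnhds.mono fun s hs => ?_)).congr_deriv ?_
  · simp only
    rw [eq χ s hs, ← mul_assoc, ← integral_const_mul]
    refine integral_congr_ae (ae_of_all _ fun y => ?_)
    simp only; ring
  · rw [eq _ s hs, integral_gauss_affine_mul_lerayAdjGrad sχ cχ, ← integral_const_mul,
      ← integral_neg]
    refine integral_congr_ae (ae_of_all _ fun y => ?_)
    simp only
    set u := (√(1 - s))⁻¹ • y + (-((√(1 - s))⁻¹ * √s)) • z with hu
    -- Expanding only one of the two factors u keeps everything linear in ⟨u, y⟩ and ⟨u, z⟩, so the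
    -- comparison is an identity in two free quantities.
    have n1 : ‖u‖ ^ 2 = (√(1 - s))⁻¹ * (inner ℝ u y - √s * inner ℝ u z) := by
      rw [← real_inner_self_eq_norm_sq]
      conv_lhs => arg 2; rw [hu]
      rw [inner_add_right, inner_smul_right, inner_smul_right]
      ring
    rw [n1, inner_add_right, inner_smul_right, inner_smul_right]
    generalize inner ℝ u y = P
    generalize inner ℝ u z = Q
    have e2 : 1 - s = √(1 - s) ^ 2 := (Real.sq_sqrt (by linarith [hs.2])).symm
    have e3 : s = √s ^ 2 := (Real.sq_sqrt hs.1.le).symm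
    have e4 : √(1 - s) ^ 2 = 1 - √s ^ 2 := by rw [← e2, ← e3]
    generalize gauss u = g
    generalize √(1 - s) = r at *
    generalize √s = a at *
    rw [e2, e3]
    have : (r ^ 2)⁻¹ ^ 2 - 1 / 2 * (a ^ 2 * (r ^ 2)⁻¹) *
        (1 / 2 * r⁻¹ ^ 3 * P + -(1 / 2 * r⁻¹ ^ 3 * a⁻¹) * Q) =
        -((r ^ 2)⁻¹ * (r⁻¹ ^ 2 * (r⁻¹ * (P - a * Q) / 4 - 1) - 1 / 4 * r⁻¹ * P)) := by
      field_simp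
      linear_combination (-4 * P) * e4
    rw [this]
    ring

/-- The fundamental theorem of calculus for s times the Gaussian mean: at s = 1 the scale is 0 and
the point is z, giving χ(z), while the prefactor s kills the other endpoint. -/
theorem integral_mollify_lerayAdjGrad {χ : Plane → ℝ} (sχ : ContDiff ℝ ∞ χ)
    (cχ : HasCompactSupport χ) (z : Plane) :
    ∫ s in Set.Ioo (0 : ℝ) 1, mollify (√(1 - s)) (lerayAdjGrad χ) (√s • z) = -χ z := by
  have cont : ∀ {ψ : Plane → ℝ}, Continuous ψ → HasCompactSupport ψ →
      Continuous fun s : ℝ => mollify (√(1 - s)) ψ (√s • z) := fun hψ cψ =>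
    (continuous_mollify hψ (decays_of_hasCompactSupport hψ cψ 0)).comp
      (f := fun s : ℝ => ((√(1 - s), √s • z) : ℝ × Plane)) (by fun_prop)
  have c1 := cont sχ.continuous cχ
  have c2 := cont (contDiff_lerayAdjGrad sχ).continuous (hasCompactSupport_lerayAdjGrad cχ)
  have h := intervalIntegral.integral_eq_sub_of_hasDerivAt_of_le (zero_le_one' ℝ)
    (continuous_id.mul c1).continuousOn (fun s hs => hasDerivAt_mul_mollify sχ cχ z hs)
    (c2.neg.intervalIntegrable 0 1)
  rw [intervalIntegral.integral_neg, intervalIntegral.integral_of_le (zero_le_one' ℝ),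
    integral_Ioc_eq_integral_Ioo] at h
  rw [← neg_eq_iff_eq_neg, h]
  simp [mollify_zero]

/-! ### The equation satisfied by the solution field -/

/-- Decay of order 3/2 is a compromise: ⟨z⟩^(-3/2) is square integrable in the plane, and ⟨√s z⟩ ≥
√s⟨z⟩ costs only s^(-3/4), integrable at 0. -/
theorem integrable_mul_mollify {f χ : Plane → ℝ} (hf : MemLp f 2) (hχ : Continuous χ)
    (cχ : HasCompactSupport χ) :
    Integrable (Function.uncurry fun (s : ℝ) (z : Plane) =>
      f z * mollify (√(1 - s)) χ (√s • z)) stMeasure := by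
  obtain ⟨C, hC0, hC⟩ := exists_mollify_le (a := 3 / 2) (by norm_num)
    (decays_of_hasCompactSupport hχ cχ (-(3 / 2)))
  have hm := continuous_mollify hχ (decays_of_hasCompactSupport hχ cχ 0)
  have i1 : IntegrableOn (fun s : ℝ => s ^ (-(3 / 4) : ℝ)) (Set.Ioo 0 1) :=
    integrableOn_rpow_Ioo (by norm_num)
  have i2 : Integrable fun z => |f z| * bracket z ^ (-(3 / 2) : ℝ) :=
    hf.abs.integrable_mul (memLp_two_bracket_rpow (by norm_num))
  refine ((Integrable.mul_prod i1 i2).const_mul C).mono' ?_ (ae_stMeasure fun s hs z => ?_)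
  · exact (hf.1.comp_snd (μ := volume.restrict (Set.Ioo (0 : ℝ) 1))).mul
      (hm.comp (f := fun p : ℝ × Plane => (√(1 - p.1), √p.1 • p.2))
        (by fun_prop)).aestronglyMeasurable
  · obtain ⟨h1, h2⟩ := sqrt_pos_of_mem hs
    have h3 := hC (√(1 - s)) h2.le (by rw [Real.sqrt_le_one]; linarith [hs.1]) (√s • z)
    have h4 : √s * bracket z ≤ bracket (√s • z) := by
      refine Real.le_sqrt_of_sq_le ?_
      rw [mul_pow, bracket_sq, norm_smul, mul_pow, Real.norm_eq_abs, sq_abs, Real.sq_sqrt hs.1.le]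
      nlinarith [hs.2]
    have h5 : bracket (√s • z) ^ (-(3 / 2) : ℝ) ≤
        s ^ (-(3 / 4) : ℝ) * bracket z ^ (-(3 / 2) : ℝ) := by
      refine (Real.rpow_le_rpow_of_nonpos (mul_pos h1 (bracket_pos z)) h4 (by norm_num)).trans
        (le_of_eq ?_)
      rw [Real.mul_rpow h1.le (bracket_pos z).le, Real.sqrt_eq_rpow, ← Real.rpow_mul hs.1.le]
      norm_num
    simp only [Function.uncurry, norm_mul, Real.norm_eq_abs]
    calc _ ≤ |f z| * (C * (s ^ (-(3 / 4) : ℝ) * bracket z ^ (-(3 / 2) : ℝ))) :=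
          mul_le_mul_of_nonneg_left (h3.trans (mul_le_mul_of_nonneg_left h5 hC0.le)) (abs_nonneg _)
      _ = _ := by ring

theorem integrable_integral_mul_mollify {f χ : Plane → ℝ} (hf : MemLp f 2) (hχ : Continuous χ)
    (cχ : HasCompactSupport χ) :
    IntegrableOn (fun s : ℝ => ∫ z, f z * mollify (√(1 - s)) χ (√s • z)) (Set.Ioo 0 1) :=
  (integrable_mul_mollify hf hχ cχ).integral_prod_left

theorem integral_mul_mollify_lerayAdjGrad {f χ : Plane → ℝ} (hf : MemLp f 2)
    (sχ : ContDiff ℝ ∞ χ) (cχ : HasCompactSupport χ) :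
    ∫ s in Set.Ioo (0 : ℝ) 1, ∫ z, f z * mollify (√(1 - s)) (lerayAdjGrad χ) (√s • z) =
      -∫ z, f z * χ z := by
  rw [integral_integral_swap (integrable_mul_mollify hf (contDiff_lerayAdjGrad sχ).continuous
    (hasCompactSupport_lerayAdjGrad cχ)), ← integral_neg]
  refine integral_congr_ae (ae_of_all _ fun z => ?_)
  simp only [integral_const_mul, integral_mollify_lerayAdjGrad sχ cχ, mul_neg]

/-- The solution field solves the equation weakly. -/
theorem integral_lerayAdj_mul_solComp {F : Fin 2 → Fin 2 → Plane → ℝ} {q : Plane → ℝ} {M : ℝ}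
    (hF : ∀ j k, QuadDecay M (F j k)) (hq : IsPressure F q) (i : Fin 2) {ψ : Plane → ℝ}
    (sψ : ContDiff ℝ ∞ ψ) (cψ : HasCompactSupport ψ) :
    ∫ y, lerayAdj ψ y * solComp F i y = -∑ j, ∫ z, stress F q i j z * pd j ψ z := by
  rw [integral_mul_solComp hF hq i (contDiff_lerayAdj sψ) (hasCompactSupport_lerayAdj cψ)]
  simp only [pd_lerayAdj sψ]
  have s1 := fun j => contDiff_pd sψ j
  have c1 := fun j => hasCompactSupport_pd cψ j
  rw [integral_finsetSum _ fun j _ => integrable_integral_mul_mollify (hq.memLp_total i j)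
    (contDiff_lerayAdjGrad (s1 j)).continuous (hasCompactSupport_lerayAdjGrad (c1 j))]
  simp only [integral_mul_mollify_lerayAdjGrad (hq.memLp_total i _) (s1 _) (c1 _),
    Finset.sum_neg_distrib]

theorem sum_integral_pd_mul_solComp {F : Fin 2 → Fin 2 → Plane → ℝ} {q : Plane → ℝ} {M : ℝ}
    (hF : ∀ j k, QuadDecay M (F j k)) (hq : IsPressure F q) {ψ : Plane → ℝ}
    (sψ : ContDiff ℝ ∞ ψ) (cψ : HasCompactSupport ψ) :
    ∑ i, ∫ y, pd i ψ y * solComp F i y = 0 := by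
  have s1 := fun j => contDiff_pd sψ j
  have c1 := fun j => hasCompactSupport_pd cψ j
  simp only [integral_mul_solComp hF hq _ (s1 _) (c1 _)]
  rw [← integral_finsetSum _ fun i _ => integrable_finsetSum _ fun j _ =>
    integrable_integral_mul_mollify (hq.memLp_total i j) (contDiff_pd (s1 i) j).continuous
      (hasCompactSupport_pd (c1 i) j)]
  exact sum_integral_solComp_mul_pd hq sψ cψ

/-! ### The space `X_α` in terms of weighted pointwise bounds -/

namespace XSpace

variable {α : ℝ}

theorem aestronglyMeasurable_field (V : XSpace α) : AEStronglyMeasurable V.field :=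
  (Lp.memLp (V.1 : Lp Plane ∞ (volume : Measure Plane))).1

theorem locallyIntegrable_field (V : XSpace α) (i : Fin 2) :
    LocallyIntegrable fun y => V.field y i := locallyIntegrable_coord V.1 i

theorem ext_field {V W : XSpace α} (h : V.field =ᵐ[volume] W.field) : V = W :=
  Subtype.ext (Lp.ext h)

theorem field_sub (V W : XSpace α) :
    (V - W).field =ᵐ[volume] fun y => V.field y - W.field y :=
  Lp.coeFn_sub (V.1 : Lp Plane ∞ (volume : Measure Plane)) W.1

theorem norm_smul_bracket (a : ℝ) (y v : Plane) :
    ‖bracket y ^ a • v‖ = bracket y ^ a * ‖v‖ := by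
  rw [norm_smul, Real.norm_eq_abs, abs_of_pos (bracket_rpow_pos y a)]

theorem ae_norm_field_le (V : XSpace α) :
    ∀ᵐ y, ‖V.field y‖ ≤ ‖V‖ * bracket y ^ (-(1 + α)) := by
  have h : MemLp (fun y => bracket y ^ (1 + α) • V.field y) ∞ volume := V.2.1
  have hae := ae_le_eLpNormEssSup (f := fun y => bracket y ^ (1 + α) • V.field y)
    (μ := volume)
  filter_upwards [hae] with y hy
  have h2 : ‖bracket y ^ (1 + α) • V.field y‖ ≤ ‖V‖ := by
    rw [norm_def, ← toReal_enorm]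
    refine ENNReal.toReal_mono h.2.ne ?_
    rw [eLpNorm_exponent_top]
    exact hy
  rw [norm_smul_bracket] at h2
  rw [Real.rpow_neg (bracket_pos y).le, ← div_eq_mul_inv, le_div_iff₀ (bracket_rpow_pos _ _)]
  linarith

theorem norm_le {V : XSpace α} {C : ℝ} (hC : 0 ≤ C)
    (h : ∀ᵐ y, bracket y ^ (1 + α) * ‖V.field y‖ ≤ C) : ‖V‖ ≤ C := by
  rw [norm_def, eLpNorm_exponent_top]
  refine ENNReal.toReal_le_of_le_ofReal hC (eLpNormEssSup_le_of_ae_bound (C := C) ?_)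
  filter_upwards [h] with y hy
  rwa [norm_smul_bracket]

/-- A field with a weighted bound that is weakly divergence free defines an element of `X_α`. -/
theorem exists_field_ae_eq (hα : 0 ≤ 1 + α) {f : Plane → Plane} (hm : AEStronglyMeasurable f) {C : ℝ}
    (hC : ∀ y, ‖f y‖ ≤ C * bracket y ^ (-(1 + α)))
    (hdiv : ∀ φ : Test, ∑ i, ∫ y, pd i φ y * f y i = 0) :
    ∃ W : XSpace α, W.field =ᵐ[volume] f := by
  have hC0 : 0 ≤ C := nonneg_of_mul_nonneg_left ((norm_nonneg _).trans (hC 0)) (bracket_rpow_pos 0 _)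
  have hf : MemLp f ∞ volume := memLp_top_of_bound hm C (ae_of_all _ fun y => by
    refine (hC y).trans (mul_le_of_le_one_right hC0 ?_)
    exact Real.rpow_le_one_of_one_le_of_nonpos (one_le_bracket y) (by linarith))
  have hae := hf.coeFn_toLp
  have h1 : MemLp (weighted α (hf.toLp f)) ∞ volume := by
    refine memLp_top_of_bound (((continuous_bracket_rpow _).aestronglyMeasurable).smul
      (Lp.memLp (hf.toLp f)).1) C ?_
    filter_upwards [hae] with y hy
    rw [weighted, hy, norm_smul_bracket]
    refine (mul_le_mul_of_nonneg_left (hC y) (bracket_rpow_pos y _).le).trans (le_of_eq ?_)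
    rw [mul_left_comm, ← Real.rpow_add (bracket_pos y)]
    simp
  have h2 : div (ofField (hf.toLp f)) = 0 := by
    refine DFunLike.ext _ _ fun φ => ?_
    rw [div_ofField_apply (locallyIntegrable_coord _)]
    have : ∀ i, ∫ x, (hf.toLp f) x i * pd i φ x = ∫ x, pd i φ x * f x i := fun i => by
      refine integral_congr_ae ?_
      filter_upwards [hae] with y hy
      rw [hy, mul_comm]
    simp only [this, hdiv φ, neg_zero]
    rfl
  exact ⟨(⟨hf.toLp f, h1, h2⟩ : XSubmodule α), hae⟩

end XSpace

/-! ### A compact set of continuous fields -/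

/-- Continuous fields with a weighted bound, a Hölder bound of exponent `1/4` and vanishing weak
divergence. -/
def holderBall (C γ : ℝ) : Set C(Plane, Plane) :=
  {f | (∀ y, ‖f y‖ ≤ C * bracket y ^ (-γ)) ∧
    (∀ y y', ‖f y - f y'‖ ≤ C * ‖y - y'‖ ^ (1 / 4 : ℝ)) ∧
    ∀ φ : Test, ∑ i, ∫ y, pd i φ y * f y i = 0}

theorem continuous_of_holder {f : Plane → Plane} {C : ℝ}
    (h : ∀ y y', ‖f y - f y'‖ ≤ C * ‖y - y'‖ ^ (1 / 4 : ℝ)) : Continuous f := by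
  refine continuous_iff_continuousAt.2 fun y₀ => ?_
  rw [ContinuousAt, tendsto_iff_norm_sub_tendsto_zero]
  refine squeeze_zero (fun y => norm_nonneg _) (fun y => h y y₀) ?_
  have : Continuous fun y : Plane => C * ‖y - y₀‖ ^ (1 / 4 : ℝ) :=
    continuous_const.mul ((by fun_prop : Continuous fun y : Plane => ‖y - y₀‖).rpow_const
      fun _ => Or.inr (by norm_num))
  simpa using this.tendsto y₀

/-- The bounds pass to pointwise limits, and the Hölder bound forces continuity of the limit. So the
set is closed in a product of compact balls, and the common modulus supplies equicontinuity. -/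
theorem isCompact_setOf_holder (C γ : ℝ) : IsCompact {f : C(Plane, Plane) |
    (∀ y, ‖f y‖ ≤ C * bracket y ^ (-γ)) ∧
      ∀ y y', ‖f y - f y'‖ ≤ C * ‖y - y'‖ ^ (1 / 4 : ℝ)} := by
  refine ArzelaAscoli.isCompact_of_equicontinuous _ ?_ ?_
  · have e : ContinuousMap.toFun '' {f : C(Plane, Plane) |
        (∀ y, ‖f y‖ ≤ C * bracket y ^ (-γ)) ∧
          ∀ y y', ‖f y - f y'‖ ≤ C * ‖y - y'‖ ^ (1 / 4 : ℝ)} =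
        Set.pi Set.univ (fun y => Metric.closedBall (0 : Plane) (C * bracket y ^ (-γ))) ∩
          {f | ∀ y y', ‖f y - f y'‖ ≤ C * ‖y - y'‖ ^ (1 / 4 : ℝ)} := by
      ext f
      simp only [Set.mem_image, Set.mem_ofPred_eq, Set.mem_inter_iff, Set.mem_pi, Set.mem_univ,
        true_implies, mem_closedBall_zero_iff]
      constructor
      · rintro ⟨g, hg, rfl⟩
        exact hg
      · intro hf
        exact ⟨⟨f, continuous_of_holder hf.2⟩, hf, rfl⟩
    rw [e]
    refine (isCompact_univ_pi fun y => isCompact_closedBall _ _).inter_right ?_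
    simp only [Set.ofPred_forall]
    exact isClosed_iInter fun y => isClosed_iInter fun y' =>
      isClosed_le (by fun_prop) continuous_const
  · refine Metric.equicontinuous_of_continuity_modulus (fun t => C * t ^ (1 / 4 : ℝ)) ?_ _ ?_
    · have : Continuous fun t : ℝ => C * t ^ (1 / 4 : ℝ) :=
        continuous_const.mul (continuous_id.rpow_const fun _ => Or.inr (by norm_num))
      simpa using this.tendsto 0
    · intro y y' f
      rw [dist_eq_norm, dist_eq_norm]
      exact f.2.2 y y'

/-- Only values on the compact support of g matter, and these converge uniformly in the compact-open
topology. Hence the weak divergence condition is closed. -/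
theorem continuous_integral_mul_apply {g : Plane → ℝ} (hg : Continuous g)
    (cg : HasCompactSupport g) (i : Fin 2) :
    Continuous fun f : C(Plane, Plane) => ∫ y, g y * f y i := by
  have int : ∀ f : C(Plane, Plane), Integrable fun y => g y * f y i := fun f =>
    (hg.mul (by fun_prop)).integrable_of_hasCompactSupport cg.mul_right
  refine continuous_iff_continuousAt.2 fun f₀ => Metric.tendsto_nhds.2 fun ε hε => ?_
  set J := ∫ y, |g y|
  have hJ : 0 ≤ J := integral_nonneg fun y => abs_nonneg _
  have hδ : 0 < ε / (J + 1) := by positivity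
  have h := Metric.tendstoUniformlyOn_iff.1
    (ContinuousMap.tendsto_iff_forall_isCompact_tendstoUniformlyOn.1
      (tendsto_id (α := C(Plane, Plane)) (x := 𝓝 f₀)) (tsupport g) cg) _ hδ
  filter_upwards [h] with f hf
  rw [Real.dist_eq, ← integral_sub (int f) (int f₀), ← Real.norm_eq_abs]
  have hle : ‖∫ y, (g y * f y i - g y * f₀ y i)‖ ≤ ∫ y, ε / (J + 1) * |g y| := by
    refine norm_integral_le_of_norm_le
      ((hg.abs.integrable_of_hasCompactSupport cg.norm).const_mul _) (ae_of_all _ fun y => ?_)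
    by_cases hy : y ∈ tsupport g
    · have h1 : |f y i - f₀ y i| ≤ ε / (J + 1) := by
        have h2 := PiLp.norm_apply_le (f y - f₀ y) i
        have h3 := (hf y hy).le
        rw [dist_comm, dist_eq_norm] at h3
        exact h2.trans h3
      rw [← mul_sub, Real.norm_eq_abs, abs_mul, mul_comm]
      exact mul_le_mul_of_nonneg_right h1 (abs_nonneg _)
    · have : g y = 0 := image_eq_zero_of_notMem_tsupport hy
      simp [this]
  refine hle.trans_lt ?_
  rw [integral_const_mul, div_mul_eq_mul_div, div_lt_iff₀ (by positivity)]
  change ε * J < _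
  nlinarith

theorem isCompact_holderBall (C γ : ℝ) : IsCompact (holderBall C γ) := by
  have h : IsClosed {f : C(Plane, Plane) | ∀ φ : Test, ∑ i, ∫ y, pd i φ y * f y i = 0} := by
    simp only [Set.ofPred_forall]
    exact isClosed_iInter fun φ => isClosed_eq (continuous_finsetSum _ fun i _ =>
      continuous_integral_mul_apply (contDiff_pd (smooth_test φ) i).continuous
        (hasCompactSupport_pd φ.hasCompactSupport i) i) continuous_const
  convert (isCompact_setOf_holder C γ).inter_right h using 1
  exact Set.ext fun f => and_assoc.symm

/-- The fields of `X_α` with a representative in a Hölder ball with faster decay form a relatively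
compact set. -/
theorem isCompact_closure_of_holderBall {α γ C : ℝ} (hα : 0 ≤ 1 + α) (hγ : 1 + α < γ)
    {A : Set (XSpace α)}
    (hA : ∀ W ∈ A, ∃ f ∈ holderBall C γ, W.field =ᵐ[volume] f) : IsCompact (closure A) := by
  have hex : ∀ f : holderBall C γ, ∃ W : XSpace α, W.field =ᵐ[volume] (f : C(Plane, Plane)) := by
    rintro ⟨f, hf⟩
    have hC0 : 0 ≤ C :=
      nonneg_of_mul_nonneg_left ((norm_nonneg _).trans (hf.1 0)) (bracket_rpow_pos 0 _)
    exact XSpace.exists_field_ae_eq hα f.continuous.aestronglyMeasurable (C := C)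
      (fun y => (hf.1 y).trans (mul_le_mul_of_nonneg_left
        (bracket_rpow_le_rpow y (by linarith)) hC0)) hf.2.2
  choose T hT using hex
  have hcont : Continuous T := by
    refine continuous_iff_continuousAt.2 fun f₀ => Metric.tendsto_nhds.2 fun ε hε => ?_
    have hC0 : 0 ≤ C :=
      nonneg_of_mul_nonneg_left ((norm_nonneg _).trans (f₀.2.1 0)) (bracket_rpow_pos 0 _)
    -- The strict inequality 1 + α < γ makes the weighted difference small wherever ⟨y⟩ ≥ R,
    -- uniformly over the ball. On the rest the weight is at most R^(1+α), and uniform convergence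
    -- on a disc is enough.
    obtain ⟨R, hR1, hR⟩ : ∃ R : ℝ, 1 ≤ R ∧ 2 * C * R ^ (-(γ - (1 + α))) ≤ ε / 2 := by
      have h := ((tendsto_rpow_neg_atTop (sub_pos.2 hγ)).const_mul (2 * C)).eventually_le_const
        (u := ε / 2) (by rw [mul_zero]; positivity)
      obtain ⟨R, h1, h2⟩ := (h.and (eventually_ge_atTop 1)).exists
      exact ⟨R, h2, h1⟩
    have hδ : 0 < ε / 2 / R ^ (1 + α) := by
      have := Real.rpow_pos_of_pos (by linarith : 0 < R) (1 + α)
      positivity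
    have h := Metric.tendstoUniformlyOn_iff.1
      (ContinuousMap.tendsto_iff_forall_isCompact_tendstoUniformlyOn.1
        (continuous_subtype_val.tendsto f₀) (Metric.closedBall (0 : Plane) R)
        (isCompact_closedBall _ _)) _ hδ
    filter_upwards [h] with f hf
    rw [dist_eq_norm]
    refine lt_of_le_of_lt (XSpace.norm_le (C := ε / 2) (by positivity) ?_) (half_lt_self hε)
    filter_upwards [XSpace.field_sub (T f) (T f₀), hT f, hT f₀] with y h1 h2 h3
    rw [h1, h2, h3]
    have hy := bracket_pos y
    have hp := bracket_rpow_pos y (1 + α)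
    rcases le_total (bracket y) R with hyR | hyR
    · have h4 := hf y (by simpa using (norm_le_bracket y).trans hyR)
      rw [dist_comm, dist_eq_norm, lt_div_iff₀ (Real.rpow_pos_of_pos (by linarith) _)] at h4
      refine le_trans ?_ h4.le
      rw [mul_comm]
      exact mul_le_mul_of_nonneg_left (Real.rpow_le_rpow hy.le hyR hα) (norm_nonneg _)
    · have h4 : ‖(f : C(Plane, Plane)) y - (f₀ : C(Plane, Plane)) y‖ ≤
          2 * C * bracket y ^ (-γ) := by
        refine (norm_sub_le _ _).trans ((add_le_add (f.2.1 y) (f₀.2.1 y)).trans (le_of_eq ?_))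
        ring
      calc _ ≤ bracket y ^ (1 + α) * (2 * C * bracket y ^ (-γ)) :=
            mul_le_mul_of_nonneg_left h4 hp.le
        _ = 2 * C * bracket y ^ (-(γ - (1 + α))) := by
            rw [mul_left_comm, ← Real.rpow_add hy]
            ring_nf
        _ ≤ 2 * C * R ^ (-(γ - (1 + α))) := by
            refine mul_le_mul_of_nonneg_left ?_ (by positivity)
            exact Real.rpow_le_rpow_of_nonpos (by linarith) hyR (by linarith)
        _ ≤ _ := hR
  have : CompactSpace (holderBall C γ) := isCompact_iff_compactSpace.1 (isCompact_holderBall C γ)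
  refine (isCompact_range hcont).closure_of_subset fun W hW => ?_
  obtain ⟨f, hf, hWf⟩ := hA W hW
  exact ⟨⟨f, hf⟩, XSpace.ext_field ((hT ⟨f, hf⟩).trans hWf.symm)⟩

section

/-! ### The profile `e^Δ u₀` -/

variable {β : ℝ≥0} {u : Plane → Plane}

theorem HolderOffZero.continuousOn (hβ : 0 < β) (h : HolderOffZero β u) :
    ContinuousOn u {0}ᶜ := by
  intro x hx
  have hx0 : 0 < ‖x‖ := norm_pos_iff.2 hx
  obtain ⟨C, hC⟩ := h (Metric.closedBall x (‖x‖ / 2)) (isCompact_closedBall _ _) (by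
    rw [Metric.mem_closedBall, dist_comm, dist_zero_right]; linarith)
  exact ((hC.continuousOn hβ).continuousAt
    (Metric.closedBall_mem_nhds x (half_pos hx0))).continuousWithinAt

theorem HolderOffZero.aestronglyMeasurable (hβ : 0 < β) (h : HolderOffZero β u) :
    AEStronglyMeasurable u := by
  have := (h.continuousOn hβ).aestronglyMeasurable (μ := volume)
    (measurableSet_singleton (0 : Plane)).compl
  rwa [Measure.restrict_eq_self_of_ae_mem] at this
  exact compl_mem_ae_iff.2 (measure_singleton 0)

/-- Boundedness on the unit circle, by compactness and continuity there, is spread to the punctured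
plane by homogeneity. -/
theorem exists_norm_le_inv_norm (hβ : 0 < β) (h : HolderOffZero β u)
    (hu : IsNegOneHomogeneous u) : ∃ C, 0 < C ∧ ∀ x, x ≠ 0 → ‖u x‖ ≤ C * ‖x‖⁻¹ := by
  have hs : Metric.sphere (0 : Plane) 1 ⊆ {0}ᶜ := fun x hx h0 => by
    rw [Set.mem_singleton_iff.1 h0] at hx
    simp at hx
  obtain ⟨C, hC⟩ := (isCompact_sphere (0 : Plane) 1).exists_bound_of_continuousOn
    ((h.continuousOn hβ).mono hs)
  refine ⟨|C| + 1, by positivity, fun x hx => ?_⟩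
  have hx0 : 0 < ‖x‖ := norm_pos_iff.2 hx
  have h1 : ‖‖x‖⁻¹ • x‖ = 1 := by
    rw [norm_smul, norm_inv, norm_norm, inv_mul_cancel₀ hx0.ne']
  have h2 := hC (‖x‖⁻¹ • x) (by simpa using h1)
  have h3 := hu ‖x‖ hx0 (‖x‖⁻¹ • x) (norm_pos_iff.1 (by rw [h1]; exact one_pos))
  rw [smul_smul, mul_inv_cancel₀ hx0.ne', one_smul] at h3
  rw [h3, norm_smul, norm_inv, norm_norm, mul_comm]
  exact mul_le_mul_of_nonneg_right (by linarith [le_abs_self C]) (inv_nonneg.2 hx0.le)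

theorem heat_one_eq (u : Plane → Plane) (y : Plane) :
    heat 1 u y = ∫ x, gauss (y - x) • u x := by
  simp only [heat, gauss, mul_one, neg_div]

theorem aestronglyMeasurable_heat_one (hu : AEStronglyMeasurable u) :
    AEStronglyMeasurable (heat 1 u) := by
  have h : AEStronglyMeasurable (fun p : Plane × Plane => gauss (p.1 - p.2) • u p.2)
      (volume.prod volume) :=
    (contDiff_gauss.continuous.comp (by fun_prop)).aestronglyMeasurable.smul hu.comp_snd
  exact h.integral_prod_right'.congr (ae_of_all _ fun y => (heat_one_eq u y).symm)

theorem integrableOn_inv_norm :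
    IntegrableOn (fun x : Plane => ‖x‖⁻¹) (Metric.closedBall 0 1) := by
  have h : LocallyIntegrable fun x : Plane => ‖x‖⁻¹ :=
    locallyIntegrable_of_norm_le_rpow (by simp) (C := 1) (α := 1) (by simp)
      (ae_of_all _ fun x => by rw [one_mul, norm_inv, norm_norm, Real.rpow_neg_one])
      measurable_norm.inv.aestronglyMeasurable
  exact h.integrableOn_isCompact (isCompact_closedBall _ _)

/-- Peetre's inequality trades one power of the Gaussian's decay in y − x for ⟨y⟩⁻¹⟨x⟩. The
remaining ⟨x⟩/|x| is unbounded only near 0, where 1/|x| is integrable in the plane; elsewhere the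
decay in y − x provides integrability. -/
theorem exists_norm_heat_one_le {C : ℝ} (hC0 : 0 < C) (hC : ∀ x, x ≠ 0 → ‖u x‖ ≤ C * ‖x‖⁻¹) :
    ∃ D, 0 < D ∧ ∀ y, ‖heat 1 u y‖ ≤ D * bracket y ^ (-1 : ℝ) := by
  obtain ⟨A, hA0, hA⟩ := (decays_gauss (-4)).exists_pos
  set B := Metric.closedBall (0 : Plane) 1
  set J := ∫ x : Plane in B, ‖x‖⁻¹
  set L := ∫ w : Plane, bracket w ^ (-3 : ℝ)
  have hi1 : Integrable (B.indicator fun x : Plane => ‖x‖⁻¹) :=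
    (integrable_indicator_iff Metric.isClosed_closedBall.measurableSet).2 integrableOn_inv_norm
  have hi2 : ∀ y, Integrable fun x : Plane => bracket (y - x) ^ (-3 : ℝ) := fun y =>
    (integrable_bracket_rpow (r := 3) (by norm_num)).comp_sub_left y
  have hJ : 0 ≤ J := integral_nonneg fun x => inv_nonneg.2 (norm_nonneg x)
  have hL : 0 ≤ L := integral_nonneg fun x => (bracket_rpow_pos x _).le
  refine ⟨2 * A * C * (J + 2 * L) + 1, by positivity, fun y => ?_⟩
  have hb := bracket_pos y
  rw [heat_one_eq, Real.rpow_neg_one]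
  have hle : ‖∫ x, gauss (y - x) • u x‖ ≤ ∫ x, (2 * A * C * (bracket y)⁻¹) *
      (B.indicator (fun x : Plane => ‖x‖⁻¹) x + 2 * bracket (y - x) ^ (-3 : ℝ)) := by
    refine norm_integral_le_of_norm_le ((hi1.add ((hi2 y).const_mul 2)).const_mul _) ?_
    filter_upwards [compl_mem_ae_iff.2 (measure_singleton (0 : Plane))] with x hx
    have hx0 : 0 < ‖x‖ := norm_pos_iff.2 hx
    have hw := bracket_pos (y - x)
    have h1 := hA (y - x)
    have h2 := hC x hx
    have hp3 := bracket_rpow_pos (y - x) (-3)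
    have hp31 : bracket (y - x) ^ (-3 : ℝ) ≤ 1 :=
      Real.rpow_le_one_of_one_le_of_nonpos (one_le_bracket _) (by norm_num)
    have h3 : bracket (y - x) ^ (-4 : ℝ) ≤
        2 * (bracket y)⁻¹ * bracket x * bracket (y - x) ^ (-3 : ℝ) := by
      have h4 := bracket_add_le (y - x) x
      rw [sub_add_cancel] at h4
      have e : bracket (y - x) ^ (-3 : ℝ) = bracket (y - x) ^ (-4 : ℝ) * bracket (y - x) := by
        rw [← Real.rpow_add_one hw.ne']; norm_num
      have h5 : 1 ≤ (bracket y)⁻¹ * (2 * bracket (y - x) * bracket x) := by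
        rw [inv_mul_eq_div, one_le_div hb]; exact h4
      calc _ ≤ bracket (y - x) ^ (-4 : ℝ) * ((bracket y)⁻¹ * (2 * bracket (y - x) * bracket x)) :=
            le_mul_of_one_le_right (bracket_rpow_pos _ _).le h5
        _ = _ := by rw [e]; ring
    have h6 : bracket x * ‖x‖⁻¹ * bracket (y - x) ^ (-3 : ℝ) ≤
        B.indicator (fun x : Plane => ‖x‖⁻¹) x + 2 * bracket (y - x) ^ (-3 : ℝ) := by
      have h7 : bracket x * ‖x‖⁻¹ ≤ ‖x‖⁻¹ + 1 := by
        rw [← div_eq_mul_inv, div_le_iff₀ hx0, add_mul, inv_mul_cancel₀ hx0.ne', one_mul]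
        exact bracket_le_one_add_norm x
      have h8 := mul_le_mul_of_nonneg_right h7 hp3.le
      by_cases hxB : x ∈ B
      · rw [Set.indicator_of_mem hxB]
        have : ‖x‖⁻¹ * bracket (y - x) ^ (-3 : ℝ) ≤ ‖x‖⁻¹ :=
          mul_le_of_le_one_right (inv_nonneg.2 hx0.le) hp31
        nlinarith
      · rw [Set.indicator_of_notMem hxB]
        have h9 : ‖x‖⁻¹ ≤ 1 := inv_le_one_of_one_le₀ (by
          have : ¬ ‖x‖ ≤ 1 := by simpa [B] using hxB
          linarith)
        nlinarith
    rw [norm_smul, Real.norm_eq_abs]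
    calc |gauss (y - x)| * ‖u x‖ ≤ (A * (2 * (bracket y)⁻¹ * bracket x *
          bracket (y - x) ^ (-3 : ℝ))) * (C * ‖x‖⁻¹) :=
          mul_le_mul (h1.trans (mul_le_mul_of_nonneg_left h3 hA0.le)) h2 (norm_nonneg _)
            (by have := bracket_pos x; positivity)
      _ = (2 * A * C * (bracket y)⁻¹) * (bracket x * ‖x‖⁻¹ * bracket (y - x) ^ (-3 : ℝ)) := by ring
      _ ≤ _ := mul_le_mul_of_nonneg_left h6 (by positivity)
  refine hle.trans ?_
  rw [integral_const_mul, integral_add hi1 ((hi2 y).const_mul 2), integral_const_mul,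
    integral_indicator Metric.isClosed_closedBall.measurableSet,
    integral_sub_left_eq_self (fun w : Plane => bracket w ^ (-3 : ℝ)) volume y]
  have := inv_pos.2 hb
  calc _ = 2 * A * C * (J + 2 * L) * (bracket y)⁻¹ := by ring
    _ ≤ _ := by gcongr; linarith

end

/-! ### The weak form of the stationary equation -/

/-- The momentum flux `Uⱼ Uₖ`. -/
def momentum (U : Plane → Plane) (j k : Fin 2) (y : Plane) : ℝ := U y j * U y k

theorem convection_apply {U : Plane → Plane} (hU : ∀ j k, LocallyIntegrable (momentum U j k))
    (i : Fin 2) (φ : Test) :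
    convection U i φ = -∑ j, ∫ y, momentum U j i y * pd j φ y := by
  rw [convection, distr_sum_apply, ← Finset.sum_neg_distrib]
  refine Finset.sum_congr rfl fun j _ => ?_
  have h : ofFun (fun y => U y j * U y i) (∂_{stdVec j} φ) = _ :=
    ofFun_apply (hU j i) (∂_{stdVec j} φ)
  rw [lineDeriv_distr, h, coe_lineDeriv_test]
  simp only [mul_comm]

theorem div_convection_apply {U : Plane → Plane} (hU : ∀ j k, LocallyIntegrable (momentum U j k))
    (φ : Test) :
    div (convection U) φ = ∑ j, ∑ k, ∫ y, momentum U j k y * pd j (pd k φ) y := by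
  rw [div, distr_sum_apply, Finset.sum_comm]
  refine Finset.sum_congr rfl fun i _ => ?_
  rw [lineDeriv_distr, convection_apply hU, neg_neg, coe_lineDeriv_test]

/-- Square integrability of the momentum flux lets every distributional identity be written as
integrals against test functions. The term U · ∇U − ∇q becomes the divergence of the total stress.
-/
theorem isLerayProjection_convection_iff {U W : Plane → Plane}
    (hU : ∀ j k, MemLp (momentum U j k) 2) (hW : ∀ i, LocallyIntegrable fun y => W y i) :
    IsLerayProjection (convection U) (lerayOp (ofField W)) ↔
      ∃ q, IsPressure (momentum U) q ∧ ∀ i, ∀ φ : Test,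
        ∫ y, W y i * lerayAdj φ y = -∑ j, ∫ y, stress (momentum U) q i j y * pd j φ y := by
  have hU' := fun j k => (hU j k).locallyIntegrable (by norm_num)
  have key : ∀ q : Plane → ℝ, MemLp q 2 → ∀ i, ∀ φ : Test,
      (convection U i - ∂_{stdVec i} (ofFun q)) φ =
        -∑ j, ∫ y, stress (momentum U) q i j y * pd j φ y := by
    intro q hq i φ
    have hq' := hq.locallyIntegrable (by norm_num : (1 : ℝ≥0∞) ≤ 2)
    change convection U i φ - (∂_{stdVec i} (ofFun q)) φ = _
    rw [convection_apply hU', lineDeriv_distr, ofFun_apply hq', coe_lineDeriv_test]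
    have hm : ∀ j, MemLp (pd j φ) 2 := fun j =>
      (contDiff_pd (smooth_test φ) j).continuous.memLp_of_hasCompactSupport
        (hasCompactSupport_pd φ.hasCompactSupport j)
    have e : ∀ j, ∫ y, stress (momentum U) q i j y * pd j φ y =
        (∫ y, momentum U j i y * pd j φ y) -
          (if i = j then 1 else 0) * ∫ y, pd j φ y * q y := fun j => by
      have i1 : Integrable fun y => momentum U j i y * pd j φ y := (hU j i).integrable_mul (hm j)
      have i2 : Integrable fun y => pd j φ y * q y := (hm j).integrable_mul hq
      rw [← integral_const_mul, ← integral_sub i1 (i2.const_mul _)]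
      refine integral_congr_ae (ae_of_all _ fun y => ?_)
      simp only [stress]
      ring
    simp only [e, Finset.sum_sub_distrib, ite_mul, one_mul, zero_mul, Finset.sum_ite_eq,
      Finset.mem_univ, if_true]
    ring
  constructor
  · rintro ⟨q, hq, h1, h2⟩
    refine ⟨q, ⟨hq, hU, fun φ => ?_⟩, fun i φ => ?_⟩
    · rw [← lap_ofFun_apply (hq.locallyIntegrable (by norm_num)), h1, div_convection_apply hU']
    · rw [← lerayOp_ofField_apply hW, h2 i, key q hq]
  · rintro ⟨q, hq, h⟩
    refine ⟨q, hq.memLp, DFunLike.ext _ _ fun φ => ?_, fun i => DFunLike.ext _ _ fun φ => ?_⟩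
    · rw [lap_ofFun_apply (hq.memLp.locallyIntegrable (by norm_num)), hq.eq,
        div_convection_apply hU']
    · rw [lerayOp_ofField_apply hW, h, key q hq.memLp]

/-- ℒ is linear and acts on each component separately, so the scalar uniqueness statement applies to
the components of the difference. -/
theorem XSpace.eq_of_weak_eq {α : ℝ} (hα0 : 0 < α) (hα1 : α < 1) {V W : XSpace α}
    (h : ∀ i, ∀ φ : Test,
      ∫ y, V.field y i * lerayAdj φ y = ∫ y, W.field y i * lerayAdj φ y) : V = W := by
  have int : ∀ (X : XSpace α) (i : Fin 2) (φ : Test),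
      Integrable fun y => X.field y i * lerayAdj φ y := fun X i φ => by
    have := (X.locallyIntegrable_field i).integrable_smul_left_of_hasCompactSupport
      (contDiff_lerayAdj (smooth_test φ)).continuous
      (hasCompactSupport_lerayAdj φ.hasCompactSupport)
    exact this.congr (ae_of_all _ fun y => mul_comm _ _)
  have h0 : ∀ i, (fun y => V.field y i - W.field y i) =ᵐ[volume] 0 := fun i => by
    refine ae_eq_zero_of_lerayAdj hα0 hα1 (K := ‖V - W‖)
      ((V.locallyIntegrable_field i).aestronglyMeasurable.sub
        (W.locallyIntegrable_field i).aestronglyMeasurable) ?_ fun φ => ?_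
    · filter_upwards [(V - W).ae_norm_field_le, XSpace.field_sub V W] with y h1 h2
      rw [h2] at h1
      exact (PiLp.norm_apply_le (V.field y - W.field y) i).trans h1
    · simp only [sub_mul]
      rw [integral_sub (int V i φ) (int W i φ), h, sub_self]
  refine XSpace.ext_field ?_
  filter_upwards [h0 0, h0 1] with y h1 h2
  ext i
  fin_cases i
  · exact sub_eq_zero.1 h1
  · exact sub_eq_zero.1 h2

/-! ### Bounds for the momentum flux -/

theorem QuadDecay.of_mul {U U' : Plane → Plane} {M N : ℝ} (hU : AEStronglyMeasurable U)
    (hU' : AEStronglyMeasurable U') (hM : ∀ᵐ y, ‖U y‖ ≤ M * bracket y ^ (-1 : ℝ))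
    (hN : ∀ᵐ y, ‖U' y‖ ≤ N * bracket y ^ (-1 : ℝ)) (j k : Fin 2) :
    QuadDecay (M * N) fun y => U y j * U' y k := by
  have coord : ∀ (i : Fin 2) {X : Plane → Plane}, AEStronglyMeasurable X →
      AEStronglyMeasurable fun y => X y i := fun i {X} hX =>
    (EuclideanSpace.proj (𝕜 := ℝ) i : Plane →L[ℝ] ℝ).continuous.comp_aestronglyMeasurable hX
  refine ⟨(coord j hU).mul (coord k hU'), ?_⟩
  filter_upwards [hM, hN] with y h1 h2
  have h3 : |U y j| ≤ M * bracket y ^ (-1 : ℝ) := (PiLp.norm_apply_le (U y) j).trans h1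
  have h4 : |U' y k| ≤ N * bracket y ^ (-1 : ℝ) := (PiLp.norm_apply_le (U' y) k).trans h2
  rw [abs_mul]
  refine (mul_le_mul h3 h4 (abs_nonneg _) ((abs_nonneg _).trans h3)).trans (le_of_eq ?_)
  rw [mul_mul_mul_comm, ← Real.rpow_add (bracket_pos y)]
  norm_num

/-- Polarisation: U ⊗ U − U' ⊗ U' = U ⊗ (U − U') − (U' − U) ⊗ U'. The bound is linear in the size d
of the difference, which makes the operator locally Lipschitz. -/
theorem QuadDecay.momentum_sub {U U' : Plane → Plane} {M N d : ℝ} (hU : AEStronglyMeasurable U)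
    (hU' : AEStronglyMeasurable U') (hM : ∀ᵐ y, ‖U y‖ ≤ M * bracket y ^ (-1 : ℝ))
    (hN : ∀ᵐ y, ‖U' y‖ ≤ N * bracket y ^ (-1 : ℝ))
    (hd : ∀ᵐ y, ‖U y - U' y‖ ≤ d * bracket y ^ (-1 : ℝ)) (j k : Fin 2) :
    QuadDecay (M * d + d * N) fun y => momentum U j k y - momentum U' j k y := by
  have hd' : ∀ᵐ y, ‖U' y - U y‖ ≤ d * bracket y ^ (-1 : ℝ) := by
    simpa only [norm_sub_rev] using hd
  convert (QuadDecay.of_mul hU (hU.sub hU') hM hd j k).sub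
    (QuadDecay.of_mul (hU'.sub hU) hU' hd' hN j k) using 2 with y
  simp only [momentum, Pi.sub_apply, PiLp.sub_apply]
  ring

/-! ### The solution operator on `X_α` -/

/-- The profile enters only through its measurability and its decay of order −1, the borderline rate
at which the momentum flux is O(⟨y⟩⁻²). -/
theorem exists_solution_operator {α : ℝ} (hα0 : 0 < α) (hα1 : α < 1) {a : Plane → Plane}
    (ha : AEStronglyMeasurable a) {D : ℝ} (hD : ∀ y, ‖a y‖ ≤ D * bracket y ^ (-1 : ℝ)) :
    ∃ K : XSpace α → XSpace α,
      (∀ V W : XSpace α, IsLerayProjection (convection fun y => a y + V.field y)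
        (lerayOp (ofField W.field)) ↔ W = K V) ∧
      Continuous K ∧ MapsBoundedToRelCompact K := by
  set U : XSpace α → Plane → Plane := fun V y => a y + V.field y with hUdef
  have hUm : ∀ V, AEStronglyMeasurable (U V) := fun V => ha.add V.aestronglyMeasurable_field
  have hVb : ∀ V : XSpace α, ∀ᵐ y, ‖V.field y‖ ≤ ‖V‖ * bracket y ^ (-1 : ℝ) := fun V => by
    filter_upwards [V.ae_norm_field_le] with y hy
    exact hy.trans (mul_le_mul_of_nonneg_left (bracket_rpow_le_rpow y (by linarith))
      (norm_nonneg V))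
  have hUb : ∀ V, ∀ᵐ y, ‖U V y‖ ≤ (D + ‖V‖) * bracket y ^ (-1 : ℝ) := fun V => by
    filter_upwards [hVb V] with y hy
    rw [add_mul]
    exact (norm_add_le _ _).trans (add_le_add (hD y) hy)
  have hD0 : 0 ≤ D := nonneg_of_mul_nonneg_left ((norm_nonneg _).trans (hD 0)) (bracket_rpow_pos 0 _)
  have hF : ∀ V j k, QuadDecay ((D + ‖V‖) * (D + ‖V‖)) (momentum (U V) j k) := fun V j k =>
    QuadDecay.of_mul (hUm V) (hUm V) (hUb V) (hUb V) j k
  have hq : ∀ V, ∃ q, IsPressure (momentum (U V)) q := fun V =>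
    exists_isPressure fun j k => (hF V j k).memLp
  -- The exponent 1 + α gives membership in X_α and the Lipschitz bound. The midpoint (3 + α)/2 of 1
  -- + α and 2 gives the surplus decay needed for compactness.
  obtain ⟨C₀, hC₀, hle₀⟩ := exists_norm_solField_le (γ := 1 + α) (by linarith) (by linarith)
  obtain ⟨C₁, hC₁, hle₁⟩ := exists_norm_solField_le (γ := (3 + α) / 2) (by linarith) (by linarith)
  obtain ⟨C₂, hC₂, hhol⟩ := exists_solField_holder
  have hcont : ∀ V, Continuous (solField (momentum (U V))) := fun V =>
    continuous_of_holder (hhol _ _ (hF V))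
  have hdiv : ∀ V, ∀ φ : Test, ∑ i, ∫ y, pd i φ y * solField (momentum (U V)) y i = 0 :=
    fun V φ => by
      obtain ⟨q, hq⟩ := hq V
      exact sum_integral_pd_mul_solComp (hF V) hq (smooth_test φ) φ.hasCompactSupport
  have hex : ∀ V, ∃ W : XSpace α, W.field =ᵐ[volume] solField (momentum (U V)) := fun V =>
    XSpace.exists_field_ae_eq (by linarith) (hcont V).aestronglyMeasurable
      (hle₀ _ _ (hF V)) (hdiv V)
  choose K hK using hex
  have hsol : ∀ V q, IsPressure (momentum (U V)) q → ∀ i, ∀ φ : Test,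
      ∫ y, (K V).field y i * lerayAdj φ y =
        -∑ j, ∫ y, stress (momentum (U V)) q i j y * pd j φ y := by
    intro V q hq i φ
    rw [← integral_lerayAdj_mul_solComp (hF V) hq i (smooth_test φ) φ.hasCompactSupport]
    refine integral_congr_ae ?_
    filter_upwards [hK V] with y hy
    rw [hy, solField_apply, mul_comm]
  refine ⟨K, fun V W => ?_, ?_, ?_⟩
  · rw [isLerayProjection_convection_iff (fun j k => (hF V j k).memLp) W.locallyIntegrable_field]
    constructor
    · rintro ⟨q, hq, h⟩
      exact XSpace.eq_of_weak_eq hα0 hα1 fun i φ => by rw [h, hsol V q hq]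
    · rintro rfl
      obtain ⟨q, hq⟩ := hq V
      exact ⟨q, hq, hsol V q hq⟩
  · have hlip : ∀ V V', ‖K V - K V'‖ ≤
        C₀ * ((D + ‖V‖) * ‖V - V'‖ + ‖V - V'‖ * (D + ‖V'‖)) := by
      intro V V'
      refine XSpace.norm_le (by positivity) ?_
      have hd : ∀ᵐ y, ‖U V y - U V' y‖ ≤ ‖V - V'‖ * bracket y ^ (-1 : ℝ) := by
        filter_upwards [hVb (V - V'), XSpace.field_sub V V'] with y h1 h2
        rw [h2] at h1
        simpa only [hUdef, add_sub_add_left_eq_sub] using h1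
      have hdiff := hle₀ _ _
        (QuadDecay.momentum_sub (hUm V) (hUm V') (hUb V) (hUb V') hd)
      filter_upwards [XSpace.field_sub (K V) (K V'), hK V, hK V'] with y h1 h2 h3
      have h4 := hdiff y
      rw [solField_sub (hF V) (hF V')] at h4
      rw [h1, h2, h3]
      refine (mul_le_mul_of_nonneg_left h4 (bracket_rpow_pos y _).le).trans (le_of_eq ?_)
      rw [mul_left_comm, ← Real.rpow_add (bracket_pos y)]
      simp
    refine continuous_iff_continuousAt.2 fun V₀ => ?_
    rw [ContinuousAt, tendsto_iff_norm_sub_tendsto_zero]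
    refine squeeze_zero (fun V => norm_nonneg _) (fun V => hlip V V₀) ?_
    have : Continuous fun V => C₀ * ((D + ‖V‖) * ‖V - V₀‖ + ‖V - V₀‖ * (D + ‖V₀‖)) := by
      fun_prop
    simpa using this.tendsto V₀
  · intro B hB
    obtain ⟨R, hR⟩ := hB.exists_norm_le
    refine isCompact_closure_of_holderBall (γ := (3 + α) / 2)
      (C := max C₁ C₂ * ((D + R) * (D + R))) (by linarith) (by linarith) ?_
    rintro _ ⟨V, hV, rfl⟩
    have hVR := hR V hV
    have hR0 : 0 ≤ R := (norm_nonneg V).trans hVR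
    have hMN : (D + ‖V‖) * (D + ‖V‖) ≤ (D + R) * (D + R) := by gcongr
    refine ⟨⟨solField (momentum (U V)), hcont V⟩, ⟨fun y => ?_, fun y y' => ?_, hdiv V⟩, hK V⟩
    · refine (hle₁ _ _ (hF V) y).trans ?_
      have := bracket_rpow_pos y (-((3 + α) / 2))
      gcongr
      exact le_max_left _ _
    · refine (hhol _ _ (hF V) y y').trans ?_
      gcongr
      exact le_max_right _ _

end SelfSimilarNS

end

/-! ### The main theorem -/

theorem mainTheorem2 (u₀ : Plane → Plane)
    (β : ℝ≥0) (hβ0 : 0 < β) (hβ1 : β < 1) (hHolder : HolderOffZero β u₀)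
    (hHom : IsNegOneHomogeneous u₀)
    (hDiv : SelfSimilarNS.div (ofField u₀) = 0)
    (α : ℝ) (hα0 : 0 < α) (hα1 : α < 1) :
    ∃ K : XSpace α → XSpace α,
      (∀ V W : XSpace α, IsLInvProjConvection u₀ V W ↔ W = K V) ∧
        Continuous K ∧ MapsBoundedToRelCompact K := by
  obtain ⟨C, hC0, hC⟩ := exists_norm_le_inv_norm hβ0 hHolder hHom
  obtain ⟨D, -, hD⟩ := exists_norm_heat_one_le hC0 hC
  exact exists_solution_operator hα0 hα1
    (aestronglyMeasurable_heat_one (hHolder.aestronglyMeasurable hβ0)) hD
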